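/- Let $d\ge 1$, let $\gamma$ be the standard Gaussian measure on $\mathbb R^d$, $\mathbb I=[-\frac12,\frac12]$, and let functions be real- or complex-valued. Derivatives $D^\alpha$ are weak derivatives, $|\alpha|_\infty=\max_i\alpha_i$ for $\alpha\in\mathbb N_0^d$, and for $s>0$ write $s=\bar s+\tilde s$ with $\bar s=\lfloor s\rfloor$. *Spaces.* Let $1\le p<\infty$. Let $(\Omega,\mu)$ be either $\mathbb R^d$ with $\gamma$, or a cube $\mathbb U^d$ ($\mathbb U$ a bounded interval) with Lebesgue measure. For an integer $r\ge0$, $W^r_{p,\mathrm{mix}}(\Omega,\mu)$ is the space of $f\in L_p(\Omega,\mu)$ with $D^\alpha f\in L_p(\Omega,\mu)$ for all $|\alpha|_\infty\le r$, with norm $\big(\sum_{|\alpha|_\infty\le r}\|D^\alpha f\|^p_{L_p(\Omega,\mu)}\big)^{1/p}$. If $s>0$ is not an integer, $W^s_{p,\mathrm{mix}}(\Omega,\mu)$ consists of the $f\in W^{\bar s}_{p,\mathrm{mix}}(\Omega,\mu)$ for which $$[f]:=\sum_{|\alpha|_\infty=\bar s}\ \sum_{\emptyset\ne e\subseteq\{1,\dots,d\}}\Big(\int\!\!\int|\Delta^e_{y_e}D^\alpha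 f(x)|^p\prod_{j\in e}k(x_j,y_j)\,d\mu(x)\,d\mu_e(y_e)\Big)^{1/p}<\infty,$$ with norm $\|f\|_{W^{\bar s}_{p,\mathrm{mix}}(\Omega,\mu)}+[f]$. Here $y_e=(y_j)_{j\in e}$; $\mu_e$ is the corresponding measure (Gaussian, respectively Lebesgue on $\mathbb U^{|e|}$) in the variables $y_e$; $\Delta^e_{y_e}=\prod_{j\in e}\Delta_{y_j,j}$, where $\Delta_{y_j,j}f(x)$ is $f(x)$ minus the value of $f$ at the point obtained from $x$ by replacing $x_j$ with $y_j$. The kernel is $k(u,v)=|u-v|^{-1-\tilde sp}$ on a cube, and $k=K_{p\tilde s}$ in the Gaussian case, where $$K_\sigma(u,v)=\int_0^\infty\frac{M_t(u,v)}{t^{\sigma/2+1}}\,dt,\qquad M_t(u,v)=\frac1{(1-e^{-2t})^{1/2}}\exp\Big(-\frac{e^{-2t}u^2-2e^{-t}uv+e^{-2t}v^2}{2(1-e^{-2t})}\Big).$$ The spaces are denoted $W^s_{p,\mathrm{mix}}(\mathbb R^d,\gamma)$ and $W^s_{p,\mathrm{mix}}(\mathbb U^d)$. Finally $\tilde L_q(\mathbb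 I^d)=L_q(\mathbb I^d)$, its elements being identified with their extensions to $\mathbb R^d$ that are $1$-periodic in each variable, and $\tilde W^s_{p,\mathrm{mix}}(\mathbb I^d)$ is the space of functions on $\mathbb I^d$ whose $1$-periodic extension belongs to $W^s_{p,\mathrm{mix}}$ on every bounded cube, with the norm of $W^s_{p,\mathrm{mix}}(\mathbb I^d)$. *Statement.* Let $s>0$, $1\le q<p<\infty$, $a>0$, $b\ge0$ and $C>0$. There is a constant $C'>0$, depending only on $d,s,p,q,a,b,C$ and the scalar field, such that the following holds. Suppose that for each $m\in\mathbb N=\{1,2,\dots\}$ there is a linear operator $A_m$ on $\tilde L_q(\mathbb I^d)$ of rank at most $m$ with $$\|g-A_m(g)\|_{\tilde L_q(\mathbb I^d)}\le C\,m^{-a}(\log\max\{m,2\})^b\,\|g\|_{\tilde W^s_{p,\mathrm{mix}}(\mathbb I^d)},\qquad g\in\tilde W^s_{p,\mathrm{mix}}(\mathbb I^d).$$ Then for each $n\in\mathbb N$ there is a linear operator $A_n^\gamma$ on $L_q(\mathbb R^d,\gamma)$ of rank at most $n$ with $$\|f-A_n^\gamma(f)\|_{L_q(\mathbb R^d,\gamma)}\le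 C'\,n^{-a}(\log\max\{n,2\})^b\,\|f\|_{W^s_{p,\mathrm{mix}}(\mathbb R^d,\gamma)},\qquad f\in W^s_{p,\mathrm{mix}}(\mathbb R^d,\gamma).$$ If all the $A_m$ are bounded, then $A_n^\gamma$ can moreover be chosen bounded. -/

import Mathlib

open MeasureTheory ProbabilityTheory
open scoped ENNReal ContDiff

namespace MixedSobolev

/-- The `i`-th classical partial derivative. -/
noncomputable def partialDeriv {d : ℕ} (i : Fin d) (φ : (Fin d → ℝ) → ℝ) : (Fin d → ℝ) → ℝ :=
  fun x => fderiv ℝ φ x (Pi.single i 1)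

/-- The classical derivative `∂^α φ` of a smooth function: apply `∂_i` exactly `α i` times,
for every `i` (the order is immaterial for smooth `φ`). -/
noncomputable def multiDeriv {d : ℕ} (α : Fin d → ℕ) (φ : (Fin d → ℝ) → ℝ) :
    (Fin d → ℝ) → ℝ :=
  (List.finRange d).foldr (fun i h => (partialDeriv i)^[α i] h) φ

/-- `g` is a generalized (weak) derivative `D^α f` on the open set `Ω`. -/
def IsWeakDeriv {𝕜 : Type*} [RCLike 𝕜] {d : ℕ} (Ω : Set (Fin d → ℝ)) (α : Fin d → ℕ)
    (f g : (Fin d → ℝ) → 𝕜) : Prop :=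
  LocallyIntegrableOn f Ω ∧ LocallyIntegrableOn g Ω ∧
    ∀ φ : (Fin d → ℝ) → ℝ, ContDiff ℝ ∞ φ → HasCompactSupport φ → tsupport φ ⊆ Ω →
      ∫ x in Ω, multiDeriv α φ x • f x = (-1 : ℝ) ^ (∑ i, α i) • ∫ x in Ω, φ x • g x

open Classical in
/-- The weak derivative `D^α f` on `Ω` (a representative of it; only meaningful if it exists). -/
noncomputable def weakDeriv {𝕜 : Type*} [RCLike 𝕜] {d : ℕ} (Ω : Set (Fin d → ℝ))
    (α : Fin d → ℕ) (f : (Fin d → ℝ) → 𝕜) : (Fin d → ℝ) → 𝕜 :=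
  if h : ∃ g, IsWeakDeriv Ω α f g then h.choose else 0

/-- The point with coordinates `y j` for `j ∈ e` and `x j` for `j ∉ e`. -/
def replaceCoords {d : ℕ} (e : Finset (Fin d)) (y x : Fin d → ℝ) : Fin d → ℝ :=
  fun j => if j ∈ e then y j else x j

/-- The univariate difference `Δ_{t,j} f (x) = f (x) - f (x with x_j replaced by t)`. -/
def coordDiff {E : Type*} [AddCommGroup E] {d : ℕ} (j : Fin d) (t : ℝ)
    (f : (Fin d → ℝ) → E) : (Fin d → ℝ) → E :=
  fun x => f x - f (Function.update x j t)

/-- The mixed difference `Δ^e_{y_e} f = (∏_{j ∈ e} Δ_{y_j,j}) f`, with the product of the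
commuting operators `Δ_{y_j,j}` multiplied out; see `mixedDiff_empty` and `mixedDiff_insert`. -/
def mixedDiff {E : Type*} [AddCommGroup E] {d : ℕ} (e : Finset (Fin d)) (y : Fin d → ℝ)
    (f : (Fin d → ℝ) → E) : (Fin d → ℝ) → E :=
  fun x => ∑ t ∈ e.powerset, (-1 : ℤ) ^ t.card • f (replaceCoords t y x)

theorem mixedDiff_empty {E : Type*} [AddCommGroup E] {d : ℕ} (y : Fin d → ℝ)
    (f : (Fin d → ℝ) → E) : mixedDiff ∅ y f = f := by
  funext x
  simp only [mixedDiff, Finset.powerset_empty, Finset.sum_singleton, Finset.card_empty, pow_zero,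
    one_smul]
  rfl

theorem mixedDiff_insert {E : Type*} [AddCommGroup E] {d : ℕ} (e : Finset (Fin d)) (j : Fin d)
    (hj : j ∉ e) (y : Fin d → ℝ) (f : (Fin d → ℝ) → E) :
    mixedDiff (insert j e) y f = coordDiff j (y j) (mixedDiff e y f) := by
  funext x
  simp only [mixedDiff, coordDiff]
  rw [Finset.sum_powerset_insert hj, sub_eq_add_neg, ← Finset.sum_neg_distrib]
  congr 1
  refine Finset.sum_congr rfl fun t ht => ?_
  have hjt : j ∉ t := fun h => hj (Finset.mem_powerset.1 ht h)
  rw [Finset.card_insert_of_notMem hjt, pow_succ, mul_neg_one, neg_smul]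
  congr 3
  funext i
  by_cases hi : i = j
  · subst hi
    simp [replaceCoords, hjt]
  · simp [replaceCoords, hi]

/-- The point of `ℝ^d` with coordinates `y_j` for `j ∈ e` (the other coordinates, set to `0`,
are never used). -/
noncomputable def extendCoords {d : ℕ} (e : Finset (Fin d)) (y : e → ℝ) : Fin d → ℝ :=
  fun j => if h : j ∈ e then y ⟨j, h⟩ else 0

/-- The open box `U^d`. -/
def box (d : ℕ) (U : Set ℝ) : Set (Fin d → ℝ) := Set.univ.pi fun _ => U

/-- The product measure `ν^d` on `ℝ^d`. -/
noncomputable def prodMeasure (d : ℕ) (ν : Measure ℝ) : Measure (Fin d → ℝ) :=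
  Measure.pi fun _ => ν

/- Below, `U ⊆ ℝ` is an open interval, `ν` a measure on `ℝ` carried by `U`, and `k` a kernel
of two real variables. Two choices are used later: `U` a bounded interval with Lebesgue measure
and the kernel `|x - y|^{-(1 + σ)}`, and `U = ℝ` with the Gaussian measure and the kernel
obtained from the Mehler kernel. Norms take the value `∞` where the function is not in the
space. -/

/-- Membership in `W^r_{p,mix}` for an integer `r ≥ 0`: all `D^α f`, `|α|_∞ ≤ r`, are in
`L_p`. -/
def MemInt {𝕜 : Type*} [RCLike 𝕜] {d : ℕ} (U : Set ℝ) (ν : Measure ℝ) (r : ℕ) (p : ℝ)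
    (f : (Fin d → ℝ) → 𝕜) : Prop :=
  MemLp f (ENNReal.ofReal p) (prodMeasure d ν) ∧
    ∀ α : Fin d → ℕ, (∀ i, α i ≤ r) →
      (∃ g, IsWeakDeriv (box d U) α f g) ∧
      MemLp (weakDeriv (box d U) α f) (ENNReal.ofReal p) (prodMeasure d ν)

/-- `(∑_{|α|_∞ ≤ r} ‖D^α f‖_p^p)^{1/p}`. -/
noncomputable def normInt {𝕜 : Type*} [RCLike 𝕜] {d : ℕ} (U : Set ℝ) (ν : Measure ℝ) (r : ℕ)
    (p : ℝ) (f : (Fin d → ℝ) → 𝕜) : ℝ≥0∞ :=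
  (∑ α ∈ Finset.Iic (fun _ : Fin d => r),
    eLpNorm (weakDeriv (box d U) α f) (ENNReal.ofReal p) (prodMeasure d ν) ^ p) ^ (1 / p)

/-- `∑_{|α|_∞ = r} ∑_{∅ ≠ e ⊆ [d]}
(∫ ∫ |Δ^e_{y_e} D^α f (x)|^p ∏_{j ∈ e} k(x_j, y_j) dν^d(x) dν^e(y_e))^{1/p}`. -/
noncomputable def seminormMix {𝕜 : Type*} [RCLike 𝕜] {d : ℕ} (U : Set ℝ) (ν : Measure ℝ)
    (k : ℝ → ℝ → ℝ≥0∞) (r : ℕ) (p : ℝ) (f : (Fin d → ℝ) → 𝕜) : ℝ≥0∞ :=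
  ∑ α ∈ (Finset.Iic (fun _ : Fin d => r)).filter (fun α => Finset.univ.sup α = r),
    ∑ e ∈ (Finset.univ : Finset (Fin d)).powerset.erase ∅,
      (∫⁻ y : e → ℝ, ∫⁻ x : Fin d → ℝ,
          ‖mixedDiff e (extendCoords e y) (weakDeriv (box d U) α f) x‖ₑ ^ p *
            ∏ j : e, k (x j) (y j)
        ∂(prodMeasure d ν) ∂(Measure.pi fun _ : e => ν)) ^ (1 / p)

/-- Membership in `W^s_{p,mix}`, `s > 0`: if `s` is an integer this is `MemInt`, otherwise
membership with the integer part of `s` together with a finite seminorm. -/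
def MemMix {𝕜 : Type*} [RCLike 𝕜] {d : ℕ} (U : Set ℝ) (ν : Measure ℝ)
    (k : ℝ → ℝ → ℝ≥0∞) (s p : ℝ) (f : (Fin d → ℝ) → 𝕜) : Prop :=
  MemInt U ν ⌊s⌋₊ p f ∧ (Int.fract s ≠ 0 → seminormMix U ν k ⌊s⌋₊ p f < ⊤)

open Classical in
/-- The norm of `W^s_{p,mix}`, `s > 0`. -/
noncomputable def normMix {𝕜 : Type*} [RCLike 𝕜] {d : ℕ} (U : Set ℝ) (ν : Measure ℝ)
    (k : ℝ → ℝ → ℝ≥0∞) (s p : ℝ) (f : (Fin d → ℝ) → 𝕜) : ℝ≥0∞ :=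
  if Int.fract s = 0 then normInt U ν ⌊s⌋₊ p f
  else normInt U ν ⌊s⌋₊ p f + seminormMix U ν k ⌊s⌋₊ p f

/-! ### Lebesgue case, on the cubes `(-ℓ, ℓ)^d`, and periodic functions on `[-1/2, 1/2]^d` -/

/-- The kernel `|x - y|^{-(1 + σ)}`. -/
noncomputable def powerKernel (σ x y : ℝ) : ℝ≥0∞ := ENNReal.ofReal (1 / |x - y| ^ (1 + σ))

/-- Lebesgue measure on the interval `(-ℓ, ℓ)`. -/
noncomputable def intervalMeasure (ℓ : ℝ) : Measure ℝ := volume.restrict (Set.Ioo (-ℓ) ℓ)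

/-- Membership in `W^s_{p,mix}((-ℓ, ℓ)^d)`. -/
def MemCube {𝕜 : Type*} [RCLike 𝕜] {d : ℕ} (ℓ s p : ℝ) (f : (Fin d → ℝ) → 𝕜) : Prop :=
  MemMix (Set.Ioo (-ℓ) ℓ) (intervalMeasure ℓ) (powerKernel (Int.fract s * p)) s p f

/-- The norm of `W^s_{p,mix}((-ℓ, ℓ)^d)`. -/
noncomputable def normCube {𝕜 : Type*} [RCLike 𝕜] {d : ℕ} (ℓ s p : ℝ)
    (f : (Fin d → ℝ) → 𝕜) : ℝ≥0∞ :=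
  normMix (Set.Ioo (-ℓ) ℓ) (intervalMeasure ℓ) (powerKernel (Int.fract s * p)) s p f

/-- Lebesgue measure on the unit cube `[-1/2, 1/2]^d` (whose boundary is a null set). -/
noncomputable def unitCubeMeasure (d : ℕ) : Measure (Fin d → ℝ) :=
  prodMeasure d (intervalMeasure (1 / 2))

/-- The space `L_q` on the unit cube. Since a function on the cube, taken up to null sets, has
exactly one extension that is `1`-periodic in each variable, this is the periodic space. -/
noncomputable abbrev PerLp (𝕜 : Type*) [RCLike 𝕜] (d : ℕ) (q : ℝ) :=
  Lp 𝕜 (ENNReal.ofReal q) (unitCubeMeasure d)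

/-- Membership of `g` in the periodic space `W^s_{p,mix}` on the unit cube: the extension `G`
of `g` that is `1`-periodic in each variable belongs to `W^s_{p,mix}` on every cube. -/
def MemPer {𝕜 : Type*} [RCLike 𝕜] {d : ℕ} (s p : ℝ) (g : (Fin d → ℝ) → 𝕜) : Prop :=
  ∃ G : (Fin d → ℝ) → 𝕜, (∀ x i, G (x + Pi.single i 1) = G x) ∧
    G =ᵐ[unitCubeMeasure d] g ∧ ∀ ℓ : ℝ, 0 < ℓ → MemCube ℓ s p G

/-- The norm of the periodic space: that of `W^s_{p,mix}` on the unit cube. -/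
noncomputable def normPer {𝕜 : Type*} [RCLike 𝕜] {d : ℕ} (s p : ℝ)
    (g : (Fin d → ℝ) → 𝕜) : ℝ≥0∞ :=
  normCube (1 / 2) s p g

/-! ### Gaussian case, on `ℝ^d` -/

/-- The univariate Mehler kernel `M_t(x, y)`. -/
noncomputable def mehler (t x y : ℝ) : ℝ :=
  1 / (1 - Real.exp (-2 * t)) ^ (1 / 2 : ℝ) *
    Real.exp (-(Real.exp (-2 * t) * x ^ 2 - 2 * Real.exp (-t) * (x * y)
      + Real.exp (-2 * t) * y ^ 2) / (2 * (1 - Real.exp (-2 * t))))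

/-- The univariate kernel `K_σ(x, y) = ∫_0^∞ M_t(x, y) t^{-(σ/2 + 1)} dt`. -/
noncomputable def ouKernel (σ x y : ℝ) : ℝ≥0∞ :=
  ∫⁻ t in Set.Ioi (0 : ℝ), ENNReal.ofReal (mehler t x y / t ^ (σ / 2 + 1))

/-- The standard Gaussian measure `γ` on `ℝ^d`. -/
noncomputable def gaussMeasure (d : ℕ) : Measure (Fin d → ℝ) :=
  prodMeasure d (gaussianReal 0 1)

/-- The space `L_q(ℝ^d, γ)`. -/
noncomputable abbrev GaussLp (𝕜 : Type*) [RCLike 𝕜] (d : ℕ) (q : ℝ) :=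
  Lp 𝕜 (ENNReal.ofReal q) (gaussMeasure d)

/-- Membership in `W^s_{p,mix}(ℝ^d, γ)`. -/
def MemGauss {𝕜 : Type*} [RCLike 𝕜] {d : ℕ} (s p : ℝ) (f : (Fin d → ℝ) → 𝕜) : Prop :=
  MemMix Set.univ (gaussianReal 0 1) (ouKernel (p * Int.fract s)) s p f

/-- The norm of `W^s_{p,mix}(ℝ^d, γ)`. -/
noncomputable def normGauss {𝕜 : Type*} [RCLike 𝕜] {d : ℕ} (s p : ℝ)
    (f : (Fin d → ℝ) → 𝕜) : ℝ≥0∞ :=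
  normMix Set.univ (gaussianReal 0 1) (ouKernel (p * Int.fract s)) s p f

end MixedSobolev

/-! Tile `ℝ^d` by half-open cubes of side `1/2` centred at `c = k/2`, `k ∈ ℤ^d`, approximate `f` on
each tile by a periodic operator, and let the rank spent on a tile decay with its distance from the
origin. Let `ψ` be a smooth cutoff, `1` on `[-1/4, 1/4]` and supported inside `(-1/2, 1/2)`. The
function `g_k(x) = ∏ ψ(x_i) · f(x + c)` agrees with the shifted `f` on the tile and vanishes near
the boundary of the unit cube, so its periodic extension is as smooth as `f`. The operator on
`L_q(γ)` is `∑ S_k A_{m_k} T_k`, where `T_k f = g_k`, `S_k` translates back and restricts to the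
tile, and `m_k = ⌊n w_k⌋` with `w_k` proportional to `exp(-∑|k_j|)` and of total mass one. The total
rank is then at most `n`. Tiles with `m_k = 0` are left out, and there the trivial bound `‖g_k‖` is
already of the required size.

The error is summable because of `q < p`. The Gaussian mass of a tile is about `exp(-|c|²/2)`, and
it multiplies the `q`-th power of the local error (`ofReal_norm_sub_rpow_le_tsum`). The local error
is at most a multiple of `(n w_k)^{-a}`, a logarithm and the periodic norm of `g_k`, and this norm
is at most the Gaussian norm of `f` times `exp((1-θ)|c|²/p)` up to terms linear in `|c|`, for any
fixed `θ < 1/2` (`exists_normPer_localized_le`). The series converges once `(1-θ) q/p < 1/2`, which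
some `θ < 1/2` satisfies exactly because `q/p < 1`; the factors `w_k^{-aq}` are only exponential in
`|k|` (`tsum_tileWeight_ne_top`).

The local norm bound is the analytic core. In a fractional seminorm, passing from Lebesgue measure
to `γ` in both `x_j` and `y_j` costs `exp(c_j²)`. The kernel gives back `exp(θ c_j²)`: for `t` of
the order of `|u-v|²` the Mehler kernel is at least a constant times `|u-v|^{-1} exp(θ c²)`, so
`K_σ` dominates the power kernel by this factor (`exists_powerKernel_le_ouKernel`).

Multiplication by the cutoff is controlled by the Leibniz rule (`exists_leibniz_list`) and a
coordinatewise product estimate for mixed differences (`exists_pairEnergy_prod_smul_le`). The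
Leibniz rule brings in derivatives of lower order, whose fractional energies are not part of the
norm; writing each difference as the integral of one further derivative along a line bounds them by
`L_p` norms (`exists_pairEnergy_weakDeriv_le`). -/

namespace MixedSobolev

/-! ### Classical partial derivatives -/

section Classical

variable {d : ℕ}

theorem contDiff_partialDeriv (i : Fin d) {φ : (Fin d → ℝ) → ℝ} (hφ : ContDiff ℝ ∞ φ) :
    ContDiff ℝ ∞ (partialDeriv i φ) := by
  unfold partialDeriv
  exact (hφ.fderiv_right (m := ∞) (by simp)).clm_apply contDiff_const

theorem tsupport_partialDeriv_subset (i : Fin d) (φ : (Fin d → ℝ) → ℝ) :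
    tsupport (partialDeriv i φ) ⊆ tsupport φ := by
  refine closure_minimal (fun x hx => ?_) (isClosed_tsupport φ)
  by_contra h
  apply hx
  have : fderiv ℝ φ x = 0 := by
    by_contra h'
    exact h (support_fderiv_subset ℝ h')
  simp [partialDeriv, this]

theorem hasCompactSupport_partialDeriv (i : Fin d) {φ : (Fin d → ℝ) → ℝ}
    (hφ : HasCompactSupport φ) : HasCompactSupport (partialDeriv i φ) :=
  hφ.of_isClosed_subset (isClosed_tsupport _) (tsupport_partialDeriv_subset i φ)

theorem partialDeriv_comm (i j : Fin d) {φ : (Fin d → ℝ) → ℝ} (hφ : ContDiff ℝ ∞ φ) :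
    partialDeriv i (partialDeriv j φ) = partialDeriv j (partialDeriv i φ) := by
  funext x
  have hs : IsSymmSndFDerivAt ℝ φ x :=
    (hφ.contDiffAt (x := x)).isSymmSndFDerivAt (by
      simpa using WithTop.coe_le_coe.2 (le_top : (2 : ℕ∞) ≤ ⊤))
  have hd : DifferentiableAt ℝ (fderiv ℝ φ) x :=
    ((hφ.fderiv_right (m := ∞) (by simp)).differentiable (by simp)) x
  have key : ∀ v w, fderiv ℝ (fun y => fderiv ℝ φ y v) x w = fderiv ℝ (fderiv ℝ φ) x w v := by
    intro v w
    rw [fderiv_clm_apply hd (differentiableAt_const v)]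
    simp
  exact (key _ _).trans ((hs _ _).trans (key _ _).symm)

theorem partialDeriv_comp_add (i : Fin d) (φ : (Fin d → ℝ) → ℝ) (c : Fin d → ℝ) :
    partialDeriv i (fun x => φ (x + c)) = fun x => partialDeriv i φ (x + c) := by
  funext x
  simp only [partialDeriv]
  rw [fderiv_comp_add_right]

theorem partialDeriv_mul (i : Fin d) {φ ψ : (Fin d → ℝ) → ℝ} (hφ : ContDiff ℝ ∞ φ)
    (hψ : ContDiff ℝ ∞ ψ) :
    partialDeriv i (fun x => φ x * ψ x) =
      fun x => partialDeriv i φ x * ψ x + φ x * partialDeriv i ψ x := by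
  funext x
  simp only [partialDeriv]
  rw [fderiv_fun_mul (hφ.differentiable (by simp) x) (hψ.differentiable (by simp) x)]
  simp
  ring

theorem iterate_partialDeriv_induction {P : ((Fin d → ℝ) → ℝ) → Prop} (i : Fin d)
    (h : ∀ φ, P φ → P (partialDeriv i φ)) (n : ℕ) {φ : (Fin d → ℝ) → ℝ} (hφ : P φ) :
    P ((partialDeriv i)^[n] φ) := by
  induction n generalizing φ with
  | zero => exact hφ
  | succ n ih => exact ih (h _ hφ)

theorem foldr_partialDeriv_induction {P : ((Fin d → ℝ) → ℝ) → Prop}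
    (h : ∀ i φ, P φ → P (partialDeriv i φ)) (α : Fin d → ℕ) (l : List (Fin d))
    {φ : (Fin d → ℝ) → ℝ} (hφ : P φ) :
    P (l.foldr (fun i h => (partialDeriv i)^[α i] h) φ) := by
  induction l with
  | nil => exact hφ
  | cons i l ih => exact iterate_partialDeriv_induction i (h i) _ ih

theorem multiDeriv_induction {P : ((Fin d → ℝ) → ℝ) → Prop}
    (h : ∀ i φ, P φ → P (partialDeriv i φ)) (α : Fin d → ℕ)
    {φ : (Fin d → ℝ) → ℝ} (hφ : P φ) : P (multiDeriv α φ) :=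
  foldr_partialDeriv_induction h α _ hφ

theorem contDiff_multiDeriv (α : Fin d → ℕ) {φ : (Fin d → ℝ) → ℝ} (hφ : ContDiff ℝ ∞ φ) :
    ContDiff ℝ ∞ (multiDeriv α φ) :=
  multiDeriv_induction (fun i _ h => contDiff_partialDeriv i h) α hφ

theorem tsupport_multiDeriv_subset (α : Fin d → ℕ) (φ : (Fin d → ℝ) → ℝ) :
    tsupport (multiDeriv α φ) ⊆ tsupport φ :=
  multiDeriv_induction (P := fun χ => tsupport χ ⊆ tsupport φ)
    (fun i χ h => (tsupport_partialDeriv_subset i χ).trans h) α subset_rfl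

theorem multiDeriv_zero (φ : (Fin d → ℝ) → ℝ) : multiDeriv 0 φ = φ := by
  unfold multiDeriv
  simp

theorem foldr_partialDeriv_partialDeriv (α : Fin d → ℕ) (j : Fin d) (l : List (Fin d))
    {φ : (Fin d → ℝ) → ℝ} (hφ : ContDiff ℝ ∞ φ) :
    l.foldr (fun i h => (partialDeriv i)^[α i] h) (partialDeriv j φ) =
      partialDeriv j (l.foldr (fun i h => (partialDeriv i)^[α i] h) φ) := by
  induction l with
  | nil => rfl
  | cons i l ih =>
    simp only [List.foldr_cons, ih]
    have hs : ContDiff ℝ ∞ (l.foldr (fun i h => (partialDeriv i)^[α i] h) φ) :=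
      foldr_partialDeriv_induction (fun i _ h => contDiff_partialDeriv i h) α l hφ
    generalize (l.foldr (fun i h => (partialDeriv i)^[α i] h) φ) = χ at hs
    generalize α i = n
    induction n generalizing χ with
    | zero => rfl
    | succ n ih' =>
      simp only [Function.iterate_succ, Function.comp]
      rw [partialDeriv_comm i j hs]
      exact ih' _ (contDiff_partialDeriv i hs)

theorem multiDeriv_add_single (α : Fin d → ℕ) (j : Fin d) {φ : (Fin d → ℝ) → ℝ}
    (hφ : ContDiff ℝ ∞ φ) :
    multiDeriv (α + Pi.single j 1) φ = multiDeriv α (partialDeriv j φ) := by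
  unfold multiDeriv
  have hmem : j ∈ List.finRange d := List.mem_finRange j
  have hnd : (List.finRange d).Nodup := List.nodup_finRange d
  have hnot : ∀ l : List (Fin d), j ∉ l →
      l.foldr (fun i h => (partialDeriv i)^[(α + Pi.single j 1 : Fin d → ℕ) i] h) φ =
        l.foldr (fun i h => (partialDeriv i)^[α i] h) φ := by
    intro l
    induction l with
    | nil => intro _; rfl
    | cons i l ih =>
      intro h
      simp only [List.mem_cons, not_or] at h
      simp only [List.foldr_cons, ih h.2]
      have : (α + Pi.single j 1 : Fin d → ℕ) i = α i := by
        simp [Ne.symm h.1]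
      rw [this]
  generalize List.finRange d = L at hmem hnd
  induction L with
  | nil => simp at hmem
  | cons i l ih =>
    rw [List.nodup_cons] at hnd
    simp only [List.foldr_cons]
    by_cases hij : j = i
    · subst hij
      rw [hnot l hnd.1, foldr_partialDeriv_partialDeriv α j l hφ]
      simp [Function.iterate_succ]
    · have hjl : j ∈ l := by simpa [hij] using hmem
      rw [ih hjl hnd.2]
      have : (α + Pi.single j 1 : Fin d → ℕ) i = α i := by
        simp [Ne.symm hij]
      rw [this]

theorem multiDeriv_single (j : Fin d) {φ : (Fin d → ℝ) → ℝ} (hφ : ContDiff ℝ ∞ φ) :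
    multiDeriv (Pi.single j 1) φ = partialDeriv j φ := by
  rw [← zero_add (Pi.single j 1 : Fin d → ℕ), multiDeriv_add_single 0 j hφ, multiDeriv_zero]

theorem multiDeriv_comp_add (α : Fin d → ℕ) (φ : (Fin d → ℝ) → ℝ) (c : Fin d → ℝ) :
    multiDeriv α (fun x => φ (x + c)) = fun x => multiDeriv α φ (x + c) := by
  unfold multiDeriv
  induction List.finRange d with
  | nil => rfl
  | cons i l ih =>
    simp only [List.foldr_cons, ih]
    generalize (l.foldr (fun i h => (partialDeriv i)^[α i] h) φ) = χ
    generalize α i = n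
    induction n generalizing χ with
    | zero => rfl
    | succ n ih' =>
      simp only [Function.iterate_succ, Function.comp]
      rw [partialDeriv_comp_add, ih']

theorem sum_add_single (α : Fin d → ℕ) (j : Fin d) :
    ∑ i, (α + Pi.single j 1 : Fin d → ℕ) i = ∑ i, α i + 1 := by
  simp [Finset.sum_add_distrib, Finset.sum_pi_single']

end Classical

/-! ### Weak derivatives -/

section Weak

variable {𝕜 : Type*} [RCLike 𝕜] {d : ℕ}

theorem isWeakDeriv_univ_iff {α : Fin d → ℕ} {f g : (Fin d → ℝ) → 𝕜} :
    IsWeakDeriv Set.univ α f g ↔ LocallyIntegrable f ∧ LocallyIntegrable g ∧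
      ∀ φ : (Fin d → ℝ) → ℝ, ContDiff ℝ ∞ φ → HasCompactSupport φ →
        ∫ x, multiDeriv α φ x • f x = (-1 : ℝ) ^ (∑ i, α i) • ∫ x, φ x • g x := by
  simp [IsWeakDeriv, locallyIntegrableOn_univ]

theorem LocallyIntegrable.integrable_test_smul {φ : (Fin d → ℝ) → ℝ} {f : (Fin d → ℝ) → 𝕜}
    (hf : LocallyIntegrable f) (hφ : ContDiff ℝ ∞ φ) (hc : HasCompactSupport φ) :
    Integrable fun x => φ x • f x :=
  hf.integrable_smul_left_of_hasCompactSupport hφ.continuous hc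

/-- The du Bois-Reymond lemma applied to `g - g'`. It makes every later estimate independent of the
representative chosen in `weakDeriv`. -/
theorem IsWeakDeriv.ae_eq {Ω : Set (Fin d → ℝ)} (hΩ : IsOpen Ω) {α : Fin d → ℕ}
    {f g g' : (Fin d → ℝ) → 𝕜} (h : IsWeakDeriv Ω α f g) (h' : IsWeakDeriv Ω α f g') :
    g =ᵐ[volume.restrict Ω] g' := by
  have key : ∀ᵐ x ∂(volume : Measure (Fin d → ℝ)), x ∈ Ω → (g - g') x = 0 := by
    refine hΩ.ae_eq_zero_of_integral_contDiff_smul_eq_zero (h.2.1.sub h'.2.1) ?_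
    intro φ hφ hc hs
    have e1 := h.2.2 φ hφ hc hs
    have e2 := h'.2.2 φ hφ hc hs
    have e3 : ∫ x in Ω, φ x • g x = ∫ x in Ω, φ x • g' x := by
      rw [e1] at e2
      have hne : ((-1 : ℝ) ^ (∑ i, α i)) ≠ 0 := pow_ne_zero _ (by norm_num)
      exact smul_right_injective 𝕜 hne e2
    have hi : ∀ u : (Fin d → ℝ) → 𝕜, LocallyIntegrableOn u Ω →
        Integrable (fun x => φ x • u x) (volume.restrict Ω) := by
      intro u hu
      have hK : IntegrableOn u (tsupport φ) :=
        hu.integrableOn_compact_subset hs hc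
      have : Integrable (fun x => φ x • u x) := by
        rw [← integrableOn_iff_integrable_of_support_subset (s := tsupport φ)]
        · exact hK.continuousOn_smul hφ.continuous.continuousOn hc
        · exact (Function.support_smul_subset_left _ _).trans (subset_tsupport φ)
      exact this.integrableOn
    have e4 : ∫ x in Ω, φ x • (g - g') x = 0 := by
      have : ∀ x, φ x • (g - g') x = φ x • g x - φ x • g' x := fun x => by
        simp [smul_sub]
      simp_rw [this]
      rw [integral_sub (hi _ h.2.1) (hi _ h'.2.1), e3, sub_self]
    rw [setIntegral_eq_integral_of_forall_compl_eq_zero] at e4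
    · exact e4
    · intro x hx
      have : φ x = 0 := image_eq_zero_of_notMem_tsupport fun h => hx (hs h)
      simp [this]
  rw [Filter.EventuallyEq, ae_restrict_iff' hΩ.measurableSet]
  filter_upwards [key] with x hx hxΩ
  exact sub_eq_zero.1 (hx hxΩ)

theorem IsWeakDeriv.congr {Ω : Set (Fin d → ℝ)} {α : Fin d → ℕ}
    {f f' g g' : (Fin d → ℝ) → 𝕜} (h : IsWeakDeriv Ω α f g)
    (hf : f =ᵐ[volume.restrict Ω] f') (hg : g =ᵐ[volume.restrict Ω] g') :
    IsWeakDeriv Ω α f' g' := by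
  have loc : ∀ u v : (Fin d → ℝ) → 𝕜, u =ᵐ[volume.restrict Ω] v → LocallyIntegrableOn u Ω →
      LocallyIntegrableOn v Ω := by
    intro u v huv hu x hx
    obtain ⟨s, hs, hsu⟩ := hu x hx
    refine ⟨s ∩ Ω, Filter.inter_mem hs self_mem_nhdsWithin, ?_⟩
    have h1 : IntegrableOn u (s ∩ Ω) := hsu.mono_set Set.inter_subset_left
    exact h1.congr_fun_ae (ae_restrict_of_ae_restrict_of_subset Set.inter_subset_right huv)
  refine ⟨loc _ _ hf h.1, loc _ _ hg h.2.1, fun φ hφ hc hs => ?_⟩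
  have e := h.2.2 φ hφ hc hs
  rw [integral_congr_ae (g := fun x => multiDeriv α φ x • f x), e,
    integral_congr_ae (g := fun x => φ x • g' x)]
  · filter_upwards [hg] with x hx; rw [hx]
  · filter_upwards [hf] with x hx; rw [hx]

theorem isWeakDeriv_weakDeriv {Ω : Set (Fin d → ℝ)} {α : Fin d → ℕ} {f : (Fin d → ℝ) → 𝕜}
    (h : ∃ g, IsWeakDeriv Ω α f g) : IsWeakDeriv Ω α f (weakDeriv Ω α f) := by
  rw [weakDeriv, dif_pos h]
  exact h.choose_spec

theorem IsWeakDeriv.weakDeriv_ae_eq {Ω : Set (Fin d → ℝ)} (hΩ : IsOpen Ω) {α : Fin d → ℕ}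
    {f g : (Fin d → ℝ) → 𝕜} (h : IsWeakDeriv Ω α f g) :
    weakDeriv Ω α f =ᵐ[volume.restrict Ω] g :=
  (isWeakDeriv_weakDeriv ⟨g, h⟩).ae_eq hΩ h

theorem isWeakDeriv_zero {Ω : Set (Fin d → ℝ)} {f : (Fin d → ℝ) → 𝕜}
    (hf : LocallyIntegrableOn f Ω) : IsWeakDeriv Ω 0 f f :=
  ⟨hf, hf, fun φ _ _ _ => by simp [multiDeriv_zero]⟩

theorem IsWeakDeriv.single_comp {β : Fin d → ℕ} {j : Fin d} {f g h : (Fin d → ℝ) → 𝕜}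
    (hg : IsWeakDeriv Set.univ β f g) (hh : IsWeakDeriv Set.univ (Pi.single j 1) g h) :
    IsWeakDeriv Set.univ (β + Pi.single j 1) f h := by
  rw [isWeakDeriv_univ_iff] at *
  refine ⟨hg.1, hh.2.1, fun φ hφ hc => ?_⟩
  have e1 := hg.2.2 _ (contDiff_partialDeriv j hφ) (hasCompactSupport_partialDeriv j hc)
  have e2 := hh.2.2 φ hφ hc
  rw [multiDeriv_single j hφ] at e2
  rw [multiDeriv_add_single β j hφ, e1, e2, sum_add_single, smul_smul]
  simp [pow_succ]

/-- Test the identity for `β` with `∂_j φ`, the one for `β + e_j` with `φ`, and cancel the sign. The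
derivatives of `f` thus form chains of first-order steps, which is how the Leibniz rule and the line
integrals use them. -/
theorem IsWeakDeriv.single_of_add {β : Fin d → ℕ} {j : Fin d} {f g h : (Fin d → ℝ) → 𝕜}
    (hg : IsWeakDeriv Set.univ β f g) (hh : IsWeakDeriv Set.univ (β + Pi.single j 1) f h) :
    IsWeakDeriv Set.univ (Pi.single j 1) g h := by
  rw [isWeakDeriv_univ_iff] at *
  refine ⟨hg.2.1, hh.2.1, fun φ hφ hc => ?_⟩
  have e1 := hg.2.2 _ (contDiff_partialDeriv j hφ) (hasCompactSupport_partialDeriv j hc)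
  have e2 := hh.2.2 φ hφ hc
  rw [multiDeriv_add_single β j hφ, sum_add_single, e1] at e2
  rw [multiDeriv_single j hφ]
  have hne : ((-1 : ℝ) ^ (∑ i, β i)) ≠ 0 := pow_ne_zero _ (by norm_num)
  apply smul_right_injective 𝕜 hne
  simp only
  rw [e2, smul_smul, pow_succ]
  simp

theorem IsWeakDeriv.comp_add {α : Fin d → ℕ} {f g : (Fin d → ℝ) → 𝕜}
    (h : IsWeakDeriv Set.univ α f g) (c : Fin d → ℝ) :
    IsWeakDeriv Set.univ α (fun x => f (x + c)) (fun x => g (x + c)) := by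
  rw [isWeakDeriv_univ_iff] at *
  have loc : ∀ u : (Fin d → ℝ) → 𝕜, LocallyIntegrable u →
      LocallyIntegrable fun x => u (x + c) := by
    intro u hu x
    obtain ⟨s, hs, hsu⟩ := hu (x + c)
    refine ⟨(fun y => y + c) ⁻¹' s, (continuous_add_const c).continuousAt.preimage_mem_nhds hs, ?_⟩
    exact (measurePreserving_add_right volume c).integrableOn_comp_preimage
      (measurableEmbedding_addRight c) |>.2 hsu
  refine ⟨loc f h.1, loc g h.2.1, fun φ hφ hc => ?_⟩
  have e := h.2.2 (fun x => φ (x + -c)) (hφ.comp (contDiff_id.add contDiff_const))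
    (hc.comp_homeomorph (Homeomorph.addRight (-c)))
  rw [multiDeriv_comp_add] at e
  have e1 := integral_add_right_eq_self (μ := (volume : Measure (Fin d → ℝ)))
    (fun x => multiDeriv α φ (x + -c) • f x) c
  have e2 := integral_add_right_eq_self (μ := (volume : Measure (Fin d → ℝ)))
    (fun x => φ (x + -c) • g x) c
  simp only [add_neg_cancel_right] at e1 e2
  rw [e1, e2, e]

theorem IsWeakDeriv.smul_smooth {j : Fin d} {f g : (Fin d → ℝ) → 𝕜}
    (h : IsWeakDeriv Set.univ (Pi.single j 1) f g) {ψ : (Fin d → ℝ) → ℝ} (hψ : ContDiff ℝ ∞ ψ) :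
    IsWeakDeriv Set.univ (Pi.single j 1) (fun x => ψ x • f x)
      (fun x => partialDeriv j ψ x • f x + ψ x • g x) := by
  rw [isWeakDeriv_univ_iff] at *
  have hψ' := contDiff_partialDeriv j hψ
  have l1 : LocallyIntegrable fun x => ψ x • f x := h.1.continuous_smul hψ.continuous
  have l2 : LocallyIntegrable fun x => partialDeriv j ψ x • f x :=
    h.1.continuous_smul hψ'.continuous
  have l3 : LocallyIntegrable fun x => ψ x • g x := h.2.1.continuous_smul hψ.continuous
  refine ⟨l1, l2.add l3, fun φ hφ hc => ?_⟩
  have e := h.2.2 (fun x => φ x * ψ x) (hφ.mul hψ) hc.mul_right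
  rw [multiDeriv_single j (hφ.mul hψ), partialDeriv_mul j hφ hψ] at e
  rw [multiDeriv_single j hφ]
  simp only [Finset.sum_pi_single', Finset.mem_univ, if_true, pow_one, neg_smul, one_smul] at e ⊢
  have r1 : ∀ x, (partialDeriv j φ x * ψ x + φ x * partialDeriv j ψ x) • f x =
      partialDeriv j φ x • ψ x • f x + φ x • partialDeriv j ψ x • f x := fun x => by
    rw [add_smul, SemigroupAction.mul_smul, SemigroupAction.mul_smul]
  have r2 : ∀ x, (φ x * ψ x) • g x = φ x • ψ x • g x := fun x => SemigroupAction.mul_smul _ _ _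
  have r3 : ∀ x, φ x • (partialDeriv j ψ x • f x + ψ x • g x) =
      φ x • partialDeriv j ψ x • f x + φ x • ψ x • g x := fun x => smul_add _ _ _
  simp only [r1, r2] at e
  simp only [r3]
  have i1 := LocallyIntegrable.integrable_test_smul l1 (contDiff_partialDeriv j hφ)
    (hasCompactSupport_partialDeriv j hc)
  have i2 := LocallyIntegrable.integrable_test_smul l2 hφ hc
  have i3 := LocallyIntegrable.integrable_test_smul l3 hφ hc
  rw [integral_add i1 i2] at e
  rw [integral_add i2 i3, neg_add, ← e]
  abel

theorem IsWeakDeriv.add {Ω : Set (Fin d → ℝ)} {α : Fin d → ℕ}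
    {f g f' g' : (Fin d → ℝ) → 𝕜} (h : IsWeakDeriv Ω α f g) (h' : IsWeakDeriv Ω α f' g') :
    IsWeakDeriv Ω α (fun x => f x + f' x) (fun x => g x + g' x) := by
  refine ⟨h.1.add h'.1, h.2.1.add h'.2.1, fun φ hφ hc hs => ?_⟩
  have hi : ∀ (χ : (Fin d → ℝ) → ℝ) (u : (Fin d → ℝ) → 𝕜), ContDiff ℝ ∞ χ →
      tsupport χ ⊆ tsupport φ → LocallyIntegrableOn u Ω →
        Integrable (fun x => χ x • u x) (volume.restrict Ω) := by
    intro χ u hχ hχs hu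
    have hK : IntegrableOn u (tsupport φ) := hu.integrableOn_compact_subset hs hc
    have : Integrable (fun x => χ x • u x) := by
      rw [← integrableOn_iff_integrable_of_support_subset (s := tsupport φ)]
      · exact hK.continuousOn_smul hχ.continuous.continuousOn hc
      · exact (Function.support_smul_subset_left _ _).trans ((subset_tsupport χ).trans hχs)
    exact this.integrableOn
  have hm := contDiff_multiDeriv α hφ
  have ht := tsupport_multiDeriv_subset α φ
  simp only [smul_add]
  rw [integral_add (hi _ _ hm ht h.1) (hi _ _ hm ht h'.1),
    integral_add (hi _ _ hφ subset_rfl h.2.1) (hi _ _ hφ subset_rfl h'.2.1),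
    h.2.2 φ hφ hc hs, h'.2.2 φ hφ hc hs, smul_add]

theorem isWeakDeriv_const_zero {Ω : Set (Fin d → ℝ)} {α : Fin d → ℕ} :
    IsWeakDeriv Ω α (fun _ => (0 : 𝕜)) (fun _ => 0) :=
  ⟨locallyIntegrableOn_const 0, locallyIntegrableOn_const 0, by simp⟩

theorem IsWeakDeriv.finset_sum {ι : Type*} {Ω : Set (Fin d → ℝ)} {α : Fin d → ℕ}
    (s : Finset ι) {f g : ι → (Fin d → ℝ) → 𝕜} (h : ∀ i ∈ s, IsWeakDeriv Ω α (f i) (g i)) :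
    IsWeakDeriv Ω α (fun x => ∑ i ∈ s, f i x) (fun x => ∑ i ∈ s, g i x) := by
  classical
  induction s using Finset.induction with
  | empty => simpa using isWeakDeriv_const_zero
  | insert i s hi ih =>
    simp only [Finset.sum_insert hi]
    exact (h i (Finset.mem_insert_self i s)).add
      (ih fun k hk => h k (Finset.mem_insert_of_mem hk))

theorem IsWeakDeriv.mono {Ω : Set (Fin d → ℝ)} {α : Fin d → ℕ}
    {f g : (Fin d → ℝ) → 𝕜} (h : IsWeakDeriv Set.univ α f g) : IsWeakDeriv Ω α f g := by
  refine ⟨h.1.mono_set (Set.subset_univ _), h.2.1.mono_set (Set.subset_univ _),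
    fun φ hφ hc hs => ?_⟩
  have e := h.2.2 φ hφ hc (Set.subset_univ _)
  rw [setIntegral_univ, setIntegral_univ] at e
  rw [setIntegral_eq_integral_of_forall_compl_eq_zero, e,
    setIntegral_eq_integral_of_forall_compl_eq_zero]
  · intro x hx
    have : φ x = 0 := image_eq_zero_of_notMem_tsupport fun h => hx (hs h)
    simp [this]
  · intro x hx
    have : multiDeriv α φ x = 0 := image_eq_zero_of_notMem_tsupport
      fun h => hx (hs (tsupport_multiDeriv_subset α φ h))
    simp [this]

/-! ### The Leibniz rule for tensor products -/

/-- The derivative `∂^γ` of `x ↦ ∏ i, ψ (x i)`. -/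
noncomputable def tensorDeriv {d : ℕ} (ψ : ℝ → ℝ) (γ : Fin d → ℕ) (x : Fin d → ℝ) : ℝ :=
  ∏ i, iteratedDeriv (γ i) ψ (x i)

theorem contDiff_iteratedDeriv {ψ : ℝ → ℝ} (hψ : ContDiff ℝ ∞ ψ) (n : ℕ) :
    ContDiff ℝ ∞ (iteratedDeriv n ψ) := by
  rw [contDiff_infty] at *
  intro m
  exact (hψ (m + n)).iterate_deriv' m n |> fun h => by rwa [iteratedDeriv_eq_iterate]

theorem contDiff_tensorDeriv {ψ : ℝ → ℝ} (hψ : ContDiff ℝ ∞ ψ) (γ : Fin d → ℕ) :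
    ContDiff ℝ ∞ (tensorDeriv ψ γ) := by
  unfold tensorDeriv
  exact contDiff_prod fun i _ => (contDiff_iteratedDeriv hψ (γ i)).comp (contDiff_apply ℝ ℝ i)

theorem partialDeriv_tensorDeriv {ψ : ℝ → ℝ} (hψ : ContDiff ℝ ∞ ψ) (γ : Fin d → ℕ) (j : Fin d) :
    partialDeriv j (tensorDeriv ψ γ) = tensorDeriv ψ (γ + Pi.single j 1) := by
  funext x
  have hD : ∀ i, HasFDerivAt (fun x : Fin d → ℝ => iteratedDeriv (γ i) ψ (x i))
      (iteratedDeriv (γ i + 1) ψ (x i) • ContinuousLinearMap.proj (R := ℝ) (φ := fun _ => ℝ) i)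
      x := by
    intro i
    have h1 : HasDerivAt (iteratedDeriv (γ i) ψ) (iteratedDeriv (γ i + 1) ψ (x i)) (x i) := by
      rw [iteratedDeriv_succ]
      exact ((contDiff_iteratedDeriv hψ (γ i)).differentiable (by simp) (x i)).hasDerivAt
    exact h1.comp_hasFDerivAt x (ContinuousLinearMap.proj (R := ℝ) (φ := fun _ => ℝ) i).hasFDerivAt
  have h := HasFDerivAt.finsetProd (u := Finset.univ) fun i _ => hD i
  simp only [partialDeriv]
  have e : (fun x : Fin d → ℝ => ∏ i, iteratedDeriv (γ i) ψ (x i)) = tensorDeriv ψ γ := rfl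
  rw [← e, h.fderiv]
  simp only [sum_apply, smul_apply,
    ContinuousLinearMap.proj_apply, smul_eq_mul, Pi.single_apply, mul_ite, mul_one, mul_zero,
    Finset.sum_ite_eq', Finset.mem_univ, if_true, tensorDeriv]
  rw [← Finset.mul_prod_erase Finset.univ _ (Finset.mem_univ j), mul_comm]
  congr 1
  · simp
  · refine Finset.prod_congr rfl fun i hi => ?_
    simp [Finset.ne_of_mem_erase hi]

/-- The Leibniz rule without binomial coefficients: a term occurs in the list as often as its
coefficient says. Only two facts matter later: the list depends on `α` alone, not on `ψ` or `F`, and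
it uses only derivatives of `F` of order at most `α`. -/
theorem exists_leibniz_list (α : Fin d → ℕ) :
    ∃ L : List ((Fin d → ℕ) × (Fin d → ℕ)), (∀ t ∈ L, t.2 ≤ α) ∧
      ∀ (ψ : ℝ → ℝ), ContDiff ℝ ∞ ψ → ∀ F : (Fin d → ℕ) → (Fin d → ℝ) → 𝕜,
        LocallyIntegrable (F 0) →
        (∀ β j, β + Pi.single j 1 ≤ α →
          IsWeakDeriv Set.univ (Pi.single j 1) (F β) (F (β + Pi.single j 1))) →
        IsWeakDeriv Set.univ α (fun x => tensorDeriv ψ 0 x • F 0 x)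
          (fun x => (L.map fun t => tensorDeriv ψ t.1 x • F t.2 x).sum) := by
  induction hn : ∑ i, α i generalizing α with
  | zero =>
    have hα : α = 0 := by
      funext i
      exact (Finset.sum_eq_zero_iff.1 hn) i (Finset.mem_univ i)
    subst hα
    refine ⟨[(0, 0)], by simp, fun ψ hψ F hF _ => ?_⟩
    simp only [List.map_cons, List.map_nil, List.sum_cons, List.sum_nil, add_zero]
    refine isWeakDeriv_zero (locallyIntegrableOn_univ.2 ?_)
    exact hF.continuous_smul (contDiff_tensorDeriv hψ 0).continuous
  | succ n ih =>
    obtain ⟨j, hj⟩ : ∃ j, α j ≠ 0 := by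
      by_contra! h
      simp [h] at hn
    obtain ⟨β, hβ⟩ : ∃ β : Fin d → ℕ, α = β + Pi.single j 1 := by
      refine ⟨Function.update α j (α j - 1), ?_⟩
      funext i
      by_cases hi : i = j
      · subst hi; simp; omega
      · simp [hi]
    subst hβ
    obtain ⟨L, hL, hD⟩ := ih β (by rw [sum_add_single] at hn; omega)
    have hle : β ≤ β + Pi.single j 1 := le_self_add
    refine ⟨L.flatMap fun t => [(t.1 + Pi.single j 1, t.2), (t.1, t.2 + Pi.single j 1)], ?_, ?_⟩
    · intro t ht
      simp only [List.mem_flatMap, List.mem_cons, List.not_mem_nil, or_false] at ht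
      obtain ⟨u, hu, rfl | rfl⟩ := ht
      · exact (hL u hu).trans hle
      · exact add_le_add_left (hL u hu) _
    · intro ψ hψ F hF0 hF
      refine (hD ψ hψ F hF0 fun γ i h => hF γ i (h.trans hle)).single_comp ?_
      clear hD
      induction L with
      | nil => simpa using isWeakDeriv_const_zero
      | cons t L ihL =>
        have h1 := ihL fun u hu => hL u (List.mem_cons_of_mem _ hu)
        have h2 := (hF t.2 j (add_le_add_left (hL t List.mem_cons_self) _)).smul_smooth
          (contDiff_tensorDeriv hψ t.1)
        have h3 := h2.add h1
        rw [partialDeriv_tensorDeriv hψ] at h3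
        simpa [add_assoc] using h3

end Weak

/-! ### Weak derivatives and integration along lines -/

section Lines

variable {𝕜 : Type*} [RCLike 𝕜] {d : ℕ}

theorem measurePreserving_shear (μ : Measure ℝ) [SFinite μ] (v : Fin d → ℝ) :
    MeasurePreserving (fun p : ℝ × (Fin d → ℝ) => (p.1, p.2 + p.1 • v))
      (μ.prod volume) (μ.prod volume) := by
  refine (MeasurePreserving.id μ).skew_product (g := fun r x => x + r • v) ?_ ?_
  · exact (measurable_snd.add (measurable_fst.smul_const v))
  · exact Filter.Eventually.of_forall fun r => (measurePreserving_add_right volume (r • v)).map_eq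

/-- As `r` runs over a compact interval, the translates of the support of `φ` sweep out a compact
set `K`, so `H` can be replaced by its restriction to `K`, which is integrable. -/
theorem integrable_test_comp_shear_smul {φ : (Fin d → ℝ) → ℝ} (hφ : Continuous φ)
    (hc : HasCompactSupport φ) {H : (Fin d → ℝ) → 𝕜} (hH : LocallyIntegrable H)
    (v : Fin d → ℝ) (a b : ℝ) :
    Integrable (fun p : ℝ × (Fin d → ℝ) => φ (p.2 - p.1 • v) • H p.2)
      ((volume.restrict (Set.uIoc a b)).prod volume) := by
  set K : Set (Fin d → ℝ) :=
    (fun p : ℝ × (Fin d → ℝ) => p.2 + p.1 • v) '' (Set.uIcc a b ×ˢ tsupport φ) with hK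
  have hKc : IsCompact K := (isCompact_uIcc.prod hc).image (by fun_prop)
  obtain ⟨M, hM⟩ := hφ.bounded_above_of_compact_support hc
  have hi : Integrable (K.indicator H) := (integrable_indicator_iff hKc.measurableSet).2
    (hH.integrableOn_isCompact hKc)
  have hfin : IsFiniteMeasure (volume.restrict (Set.uIoc a b)) :=
    ⟨by simp [Set.uIoc]⟩
  have h2 := hi.comp_snd (volume.restrict (Set.uIoc a b))
  have h3 : Integrable (fun p : ℝ × (Fin d → ℝ) => φ (p.2 - p.1 • v) • K.indicator H p.2)
      ((volume.restrict (Set.uIoc a b)).prod volume) := by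
    refine h2.bdd_smul M ?_ (Filter.Eventually.of_forall fun p => hM _)
    exact (hφ.comp (by fun_prop)).aestronglyMeasurable
  refine h3.congr ?_
  have hI : ∀ᵐ p ∂((volume.restrict (Set.uIoc a b)).prod (volume : Measure (Fin d → ℝ))),
      p.1 ∈ Set.uIoc a b :=
    Measure.quasiMeasurePreserving_fst.ae (ae_restrict_mem measurableSet_uIoc)
  filter_upwards [hI] with p hp
  by_cases h : p.2 ∈ K
  · simp [h]
  · have : φ (p.2 - p.1 • v) = 0 := by
      apply image_eq_zero_of_notMem_tsupport
      intro h'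
      exact h ⟨(p.1, p.2 - p.1 • v), ⟨Set.uIoc_subset_uIcc hp, h'⟩, by simp⟩
    simp [this]

theorem integrable_test_smul_comp_shear {φ : (Fin d → ℝ) → ℝ} (hφ : Continuous φ)
    (hc : HasCompactSupport φ) {H : (Fin d → ℝ) → 𝕜} (hH : LocallyIntegrable H)
    (v : Fin d → ℝ) (a b : ℝ) :
    Integrable (fun p : ℝ × (Fin d → ℝ) => φ p.2 • H (p.2 + p.1 • v))
      ((volume.restrict (Set.uIoc a b)).prod volume) := by
  have h := integrable_test_comp_shear_smul hφ hc hH v a b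
  have h2 := (measurePreserving_shear (volume.restrict (Set.uIoc a b)) v).integrable_comp_of_integrable h
  simpa [Function.comp_def] using h2

theorem exists_test_eq_one (R : ℝ) : ∃ φ : (Fin d → ℝ) → ℝ, ContDiff ℝ ∞ φ ∧
    HasCompactSupport φ ∧ ∀ x ∈ Metric.closedBall 0 R, φ x = 1 := by
  let f : ContDiffBump (0 : Fin d → ℝ) := ⟨max R 0 + 1, max R 0 + 2, by positivity, by linarith⟩
  refine ⟨f, f.contDiff, f.hasCompactSupport, fun x hx => f.one_of_mem_closedBall ?_⟩
  refine Metric.closedBall_subset_closedBall ?_ hx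
  change R ≤ max R 0 + 1
  linarith [le_max_left R 0]

/-- One null set has to serve all intervals. Countably many balls and intervals `[-n, n]` exhaust
everything. -/
theorem ae_intervalIntegrable_line {H : (Fin d → ℝ) → 𝕜} (hH : LocallyIntegrable H)
    (v : Fin d → ℝ) :
    ∀ᵐ x : Fin d → ℝ, ∀ a b, IntervalIntegrable (fun r => H (x + r • v)) volume a b := by
  have key : ∀ n : ℕ, ∀ᵐ x : Fin d → ℝ, ‖x‖ ≤ n →
      IntegrableOn (fun r => H (x + r • v)) (Set.uIoc (-n : ℝ) n) := by
    intro n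
    obtain ⟨φ, hφ, hc, h1⟩ := exists_test_eq_one (d := d) n
    have h := (integrable_test_smul_comp_shear hφ.continuous hc hH v (-n) n).prod_left_ae
    filter_upwards [h] with x hx hxn
    simp only [h1 x (by simpa using hxn), one_smul] at hx
    exact hx
  rw [← ae_all_iff] at key
  filter_upwards [key] with x hx a b
  rw [intervalIntegrable_iff]
  obtain ⟨n, hn⟩ := exists_nat_ge (max ‖x‖ (max |a| |b|))
  have hxn : ‖x‖ ≤ n := (le_max_left _ _).trans hn
  have han : |a| ≤ n := ((le_max_left _ _).trans (le_max_right _ _)).trans hn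
  have hbn : |b| ≤ n := ((le_max_right _ _).trans (le_max_right _ _)).trans hn
  have hlt : (-n : ℝ) ≤ n := by linarith [abs_nonneg a]
  refine (hx n hxn).mono_set ?_
  rw [Set.uIoc_of_le hlt]
  intro r hr
  rw [Set.uIoc, Set.mem_Ioc] at hr
  rw [abs_le] at han hbn
  exact ⟨lt_of_le_of_lt (le_min han.1 hbn.1) hr.1, hr.2.trans (max_le han.2 hbn.2)⟩

theorem locallyIntegrable_intervalIntegral_line {H : (Fin d → ℝ) → 𝕜}
    (hH : LocallyIntegrable H) (v : Fin d → ℝ) (τ : ℝ) :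
    LocallyIntegrable fun x => ∫ r in (0 : ℝ)..τ, H (x + r • v) := by
  intro x
  obtain ⟨φ, hφ, hc, h1⟩ := exists_test_eq_one (d := d) (‖x‖ + 1)
  have h := (integrable_test_smul_comp_shear hφ.continuous hc hH v 0 τ).integral_prod_right
  refine ⟨Metric.ball x 1, Metric.ball_mem_nhds x one_pos, ?_⟩
  have h2 : IntegrableOn (fun y => ∫ r in Set.uIoc 0 τ, H (y + r • v)) (Metric.ball x 1) := by
    refine h.integrableOn.congr_fun (fun y hy => ?_) measurableSet_ball
    have : φ y = 1 := h1 y (by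
      rw [mem_closedBall_zero_iff]
      have := norm_le_norm_add_norm_sub x y
      rw [Metric.mem_ball, dist_eq_norm, norm_sub_rev] at hy
      linarith)
    simp [this]
  simp only [intervalIntegral.intervalIntegral_eq_integral_uIoc]
  exact Integrable.smul (if (0 : ℝ) ≤ τ then (1 : ℝ) else -1) h2

theorem hasDerivAt_line (φ : (Fin d → ℝ) → ℝ) (hφ : ContDiff ℝ ∞ φ) (j : Fin d)
    (x : Fin d → ℝ) (r : ℝ) :
    HasDerivAt (fun r : ℝ => φ (x - r • Pi.single j (1 : ℝ)))
      (-partialDeriv j φ (x - r • Pi.single j (1 : ℝ))) r := by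
  have h1 : HasDerivAt (fun r : ℝ => x - r • (Pi.single j (1 : ℝ) : Fin d → ℝ))
      (-(Pi.single j (1 : ℝ))) r := by
    simpa using ((hasDerivAt_id r).smul_const (Pi.single j (1 : ℝ) : Fin d → ℝ)).const_sub x
  have h2 := ((hφ.differentiable (by simp)) (x - r • Pi.single j (1 : ℝ))).hasFDerivAt.comp_hasDerivAt r h1
  rw [map_neg] at h2
  exact h2

/-- The fundamental theorem of calculus in weak form. Tested against `φ`, the shift moves onto `φ`,
the classical theorem applies to `φ` along the line, and the weak derivative together with Fubini
carries the result back to `G`. -/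
theorem IsWeakDeriv.ae_line_sub {j : Fin d} {H G : (Fin d → ℝ) → 𝕜}
    (h : IsWeakDeriv Set.univ (Pi.single j 1) H G) (τ : ℝ) :
    ∀ᵐ x : Fin d → ℝ, H (x + τ • Pi.single j (1 : ℝ)) - H x =
      ∫ r in (0 : ℝ)..τ, G (x + r • Pi.single j (1 : ℝ)) := by
  rw [isWeakDeriv_univ_iff] at h
  obtain ⟨hH, hG, hw⟩ := h
  set v : Fin d → ℝ := Pi.single j (1 : ℝ) with hv
  have hHs : LocallyIntegrable fun x => H (x + τ • v) := by
    have h0 := (isWeakDeriv_zero (locallyIntegrableOn_univ.2 hH)).comp_add (τ • v)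
    exact (isWeakDeriv_univ_iff.1 h0).1
  have hI := locallyIntegrable_intervalIntegral_line hG v τ
  have := ae_eq_zero_of_integral_contDiff_smul_eq_zero
    (f := fun x => (H (x + τ • v) - H x) - ∫ r in (0 : ℝ)..τ, G (x + r • v))
    ((hHs.sub hH).sub hI) ?_
  · filter_upwards [this] with x hx
    exact sub_eq_zero.1 hx
  intro φ hφ hc
  have hcs : ∀ r : ℝ, HasCompactSupport fun x => φ (x - r • v) := fun r =>
    hc.comp_homeomorph (Homeomorph.subRight (r • v))
  have hsm : ∀ r : ℝ, ContDiff ℝ ∞ fun x => φ (x - r • v) := fun r =>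
    hφ.comp (contDiff_id.sub contDiff_const)
  have i1 := LocallyIntegrable.integrable_test_smul hHs hφ hc
  have i2 := LocallyIntegrable.integrable_test_smul hH hφ hc
  have i3 := LocallyIntegrable.integrable_test_smul hI hφ hc
  have i4 := LocallyIntegrable.integrable_test_smul hH (hsm τ) (hcs τ)
  have hφ' := contDiff_partialDeriv j hφ
  have hc' := hasCompactSupport_partialDeriv j hc
  have tr : ∀ (r : ℝ) (F : (Fin d → ℝ) → 𝕜),
      ∫ x, φ x • F (x + r • v) = ∫ x, φ (x - r • v) • F x := by
    intro r F
    have := integral_add_right_eq_self (μ := (volume : Measure (Fin d → ℝ)))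
      (fun x => φ (x - r • v) • F x) (r • v)
    simpa using this
  have ftc : ∀ x, φ (x - τ • v) - φ x = -∫ r in (0 : ℝ)..τ, partialDeriv j φ (x - r • v) := by
    intro x
    have := intervalIntegral.integral_eq_sub_of_hasDerivAt (a := 0) (b := τ)
      (fun r _ => hasDerivAt_line φ hφ j x r)
      ((hφ'.continuous.comp (by fun_prop)).neg.intervalIntegrable _ _)
    simpa [intervalIntegral.integral_neg] using this.symm
  have s1 : ∫ x, φ x • (H (x + τ • v) - H x) =
      -∫ x, ∫ r in (0 : ℝ)..τ, partialDeriv j φ (x - r • v) • H x := by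
    simp only [smul_sub]
    rw [integral_sub i1 i2, tr τ H, ← integral_sub i4 i2, ← integral_neg]
    refine integral_congr_ae (Filter.Eventually.of_forall fun x => ?_)
    simp only
    rw [← sub_smul, ftc, neg_smul, intervalIntegral.integral_smul_const]
  have s2 : ∫ x, ∫ r in (0 : ℝ)..τ, partialDeriv j φ (x - r • v) • H x =
      ∫ r in (0 : ℝ)..τ, ∫ x, partialDeriv j φ (x - r • v) • H x :=
    (intervalIntegral_integral_swap
      (integrable_test_comp_shear_smul hφ'.continuous hc' hH v 0 τ)).symm
  have s3 : ∀ r : ℝ, ∫ x, partialDeriv j φ (x - r • v) • H x = -∫ x, φ x • G (x + r • v) := by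
    intro r
    have e := hw _ (hsm r) (hcs r)
    rw [multiDeriv_single j (hsm r)] at e
    have e2 : partialDeriv j (fun x => φ (x - r • v)) = fun x => partialDeriv j φ (x - r • v) := by
      simpa [sub_eq_add_neg] using partialDeriv_comp_add j φ (-(r • v))
    rw [e2] at e
    rw [e, tr r G]
    simp
  have s4 : ∫ r in (0 : ℝ)..τ, ∫ x : Fin d → ℝ, φ x • G (x + r • v) =
      ∫ x : Fin d → ℝ, φ x • ∫ r in (0 : ℝ)..τ, G (x + r • v) := by
    rw [intervalIntegral_integral_swap (integrable_test_smul_comp_shear hφ.continuous hc hG v 0 τ)]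
    simp_rw [intervalIntegral.integral_smul]
  have i12 : Integrable fun x => φ x • (H (x + τ • v) - H x) := by
    simp only [smul_sub]
    exact i1.sub i2
  have r1 : ∀ x, φ x • (H (x + τ • v) - H x - ∫ r in (0 : ℝ)..τ, G (x + r • v)) =
      φ x • (H (x + τ • v) - H x) - φ x • ∫ r in (0 : ℝ)..τ, G (x + r • v) :=
    fun x => smul_sub _ _ _
  simp only [r1]
  rw [integral_sub i12 i3, s1, s2]
  simp_rw [s3]
  rw [intervalIntegral.integral_neg, neg_neg, s4, sub_self]

theorem measurable_intervalIntegral_line {G : (Fin d → ℝ) → 𝕜} (hG : Measurable G)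
    (v : Fin d → ℝ) :
    Measurable fun p : (Fin d → ℝ) × ℝ => ∫ r in (0 : ℝ)..p.2, G (p.1 + r • v) := by
  have key : ∀ A : Set (((Fin d → ℝ) × ℝ) × ℝ), MeasurableSet A →
      Measurable fun p : (Fin d → ℝ) × ℝ =>
        ∫ r, A.indicator (fun q => G (q.1.1 + q.2 • v)) (p, r) := by
    intro A hA
    have : StronglyMeasurable (A.indicator fun q : ((Fin d → ℝ) × ℝ) × ℝ =>
        G (q.1.1 + q.2 • v)) := by
      refine (Measurable.indicator (hG.comp ?_) hA).stronglyMeasurable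
      exact (measurable_fst.fst).add (measurable_snd.smul_const v)
    exact (this.integral_prod_right' (ν := volume)).measurable
  have h1 := key {q | 0 < q.2 ∧ q.2 ≤ q.1.2} ((measurableSet_lt measurable_const measurable_snd).inter
    (measurableSet_le measurable_snd measurable_fst.snd))
  have h2 := key {q | q.1.2 < q.2 ∧ q.2 ≤ 0} ((measurableSet_lt measurable_fst.snd measurable_snd).inter
    (measurableSet_le measurable_snd measurable_const))
  convert h1.sub h2 using 2 with p
  simp only [intervalIntegral]
  rw [← integral_indicator measurableSet_Ioc, ← integral_indicator measurableSet_Ioc]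
  rfl

theorem quasiMeasurePreserving_sub_eval (j : Fin d) :
    Measure.QuasiMeasurePreserving
      (fun p : (Fin d → ℝ) × (Fin d → ℝ) => (p.1, p.2 j - p.1 j))
      (volume.prod volume) (volume.prod volume) := by
  have h1 : MeasurePreserving (fun p : (Fin d → ℝ) × ℝ => (p.1, p.2 - p.1 j))
      (volume.prod volume) (volume.prod volume) := by
    refine (MeasurePreserving.id volume).skew_product (g := fun (x : Fin d → ℝ) t => t - x j) ?_ ?_
    · exact measurable_snd.sub ((measurable_pi_apply j).comp measurable_fst)
    · exact Filter.Eventually.of_forall fun x => (measurePreserving_sub_right volume (x j)).map_eq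
  have h2 : Measure.QuasiMeasurePreserving
      (fun p : (Fin d → ℝ) × (Fin d → ℝ) => (p.1, p.2 j))
      (volume.prod volume) (volume.prod volume) := by
    have he : Measure.QuasiMeasurePreserving (fun y : Fin d → ℝ => y j) volume volume :=
      Measure.quasiMeasurePreserving_eval _ j
    refine ⟨measurable_fst.prodMk (he.measurable.comp measurable_snd), ?_⟩
    have := Measure.map_prod_map (volume : Measure (Fin d → ℝ)) (volume : Measure (Fin d → ℝ))
      measurable_id he.measurable
    rw [Measure.map_id] at this
    change Measure.map (Prod.map id fun y : Fin d → ℝ => y j) _ ≪ _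
    rw [← this]
    exact Measure.AbsolutelyContinuous.rfl.prod he.absolutelyContinuous
  exact h1.quasiMeasurePreserving.comp h2

theorem add_smul_single_eq_update (x : Fin d → ℝ) (j : Fin d) (t : ℝ) :
    x + (t - x j) • Pi.single j (1 : ℝ) = Function.update x j t := by
  funext i
  by_cases hi : i = j
  · subst hi; simp
  · simp [hi]

/-- The null set in `ae_line_sub` depends on the step `τ`. By joint measurability and Fubini the
identity holds for almost every `(x, τ)`, and `(x, y) ↦ (x, y_j - x_j)` pulls null sets back to null
sets. -/
theorem IsWeakDeriv.ae_sub_update {j : Fin d} {H G : (Fin d → ℝ) → 𝕜} (hHm : Measurable H)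
    (hGm : Measurable G) (h : IsWeakDeriv Set.univ (Pi.single j 1) H G) :
    ∀ᵐ p : (Fin d → ℝ) × (Fin d → ℝ),
      H p.1 - H (Function.update p.1 j (p.2 j)) =
        (∫ u in (p.2 j)..(p.1 j), G (Function.update p.1 j u)) ∧
      ∀ a b, IntervalIntegrable (fun u => G (Function.update p.1 j u)) volume a b := by
  set v : Fin d → ℝ := Pi.single j (1 : ℝ) with hv
  have h1 : ∀ᵐ p : (Fin d → ℝ) × ℝ ∂(volume.prod volume), H (p.1 + p.2 • v) - H p.1 =
      ∫ r in (0 : ℝ)..p.2, G (p.1 + r • v) := by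
    have hms : MeasurableSet {p : (Fin d → ℝ) × ℝ | H (p.1 + p.2 • v) - H p.1 =
      ∫ r in (0 : ℝ)..p.2, G (p.1 + r • v)} := by
      refine measurableSet_eq_fun ?_ (measurable_intervalIntegral_line hGm v)
      refine (hHm.comp ?_).sub (hHm.comp measurable_fst)
      exact measurable_fst.add (measurable_snd.smul_const v)
    rw [Measure.ae_prod_iff_ae_ae hms,
      Measure.ae_ae_comm (p := fun (x : Fin d → ℝ) (t : ℝ) => H (x + t • v) - H x =
      ∫ r in (0 : ℝ)..t, G (x + r • v)) hms]
    exact Filter.Eventually.of_forall fun τ => h.ae_line_sub τ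
  have h2 := (quasiMeasurePreserving_sub_eval j).ae h1
  have h3 : ∀ᵐ p : (Fin d → ℝ) × (Fin d → ℝ) ∂(volume.prod volume),
      ∀ a b, IntervalIntegrable (fun r => G (p.1 + r • v)) volume a b :=
    Measure.quasiMeasurePreserving_fst.ae (ae_intervalIntegrable_line
      (isWeakDeriv_univ_iff.1 h).2.1 v)
  rw [Measure.volume_eq_prod]
  filter_upwards [h2, h3] with p hp hp3
  have e : ∀ u, G (Function.update p.1 j u) = G (p.1 + (u - p.1 j) • v) := fun u => by
    rw [add_smul_single_eq_update]
  simp only [e]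
  refine ⟨?_, fun a b => ?_⟩
  · rw [intervalIntegral.integral_comp_sub_right (fun r => G (p.1 + r • v)), sub_self,
      intervalIntegral.integral_symm, ← hp, add_smul_single_eq_update]
    simp
  · simpa using (hp3 (a - p.1 j) (b - p.1 j)).comp_sub_right (p.1 j)

end Lines

/-! ### Integrals over product measures, one coordinate at a time -/

section PiMeasure

variable {ι : Type*} [Fintype ι] {X : Type*} [MeasurableSpace X]

/-- The device by which one-dimensional inequalities become inequalities for mixed differences: only
the coordinate `j` is touched, and all the others are frozen and integrated afterwards. -/
theorem lintegral_pi_le_of_coord [DecidableEq ι] {μ μ' : ι → Measure X} [∀ i, SigmaFinite (μ i)]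
    [∀ i, SigmaFinite (μ' i)] (j : ι) (hμ : ∀ i, i ≠ j → μ i = μ' i)
    {f f' : (ι → X) → ℝ≥0∞} (hf : Measurable f) (hf' : Measurable f')
    (h : ∀ z, ∫⁻ w, f (Function.update z j w) ∂μ j ≤ ∫⁻ w, f' (Function.update z j w) ∂μ' j) :
    ∫⁻ z, f z ∂Measure.pi μ ≤ ∫⁻ z, f' z ∂Measure.pi μ' := by
  rcases isEmpty_or_nonempty (ι → X) with hX | ⟨⟨z₀⟩⟩
  · simp
  rw [lintegral_eq_lmarginal_univ z₀, lintegral_eq_lmarginal_univ z₀,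
    lmarginal_erase' f hf (Finset.mem_univ j), lmarginal_erase' f' hf' (Finset.mem_univ j)]
  have e : ∀ g : (ι → X) → ℝ≥0∞,
      lmarginal μ (Finset.univ.erase j) g z₀ = lmarginal μ' (Finset.univ.erase j) g z₀ := by
    intro g
    have : (fun i : (Finset.univ.erase j : Finset ι) => μ i) =
        fun i : (Finset.univ.erase j : Finset ι) => μ' i := by
      funext i
      exact hμ i (Finset.ne_of_mem_erase i.2)
    simp only [lmarginal, this]
  rw [← e]
  exact lmarginal_mono h z₀

theorem pi_le_smul_pi {μ ν : ι → Measure X} [∀ i, SigmaFinite (μ i)] [∀ i, SigmaFinite (ν i)]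
    {D : ι → ℝ≥0∞} (h : ∀ i, μ i ≤ D i • ν i) :
    Measure.pi μ ≤ (∏ i, D i) • Measure.pi ν := by
  classical
  have key : ∀ (f : (ι → X) → ℝ≥0∞), Measurable f → ∀ (s : Finset ι) (z : ι → X),
      lmarginal μ s f z ≤ (∏ i ∈ s, D i) * lmarginal ν s f z := by
    intro f hf s
    induction s using Finset.induction with
    | empty => simp
    | insert i s hi ih =>
      intro z
      rw [lmarginal_insert f hf hi, lmarginal_insert f hf hi, Finset.prod_insert hi]
      have hm : Measurable fun x => lmarginal ν s f (Function.update z i x) :=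
        (hf.lmarginal ν).comp (measurable_update z)
      calc ∫⁻ x, lmarginal μ s f (Function.update z i x) ∂μ i
          ≤ ∫⁻ x, (∏ i ∈ s, D i) * lmarginal ν s f (Function.update z i x) ∂(D i • ν i) :=
            lintegral_mono' (h i) fun x => ih _
        _ = D i * ((∏ i ∈ s, D i) * ∫⁻ x, lmarginal ν s f (Function.update z i x) ∂ν i) := by
            rw [lintegral_smul_measure, lintegral_const_mul _ hm, smul_eq_mul]
        _ = _ := by rw [mul_assoc]
  refine Measure.le_iff.2 fun s hs => ?_
  rcases isEmpty_or_nonempty (ι → X) with hX | ⟨⟨z₀⟩⟩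
  · simp [Set.eq_empty_of_isEmpty s]
  have h1 := key (s.indicator 1) (measurable_one.indicator hs) Finset.univ z₀
  rw [← lintegral_eq_lmarginal_univ, ← lintegral_eq_lmarginal_univ,
    lintegral_indicator_one hs, lintegral_indicator_one hs] at h1
  simpa using h1

end PiMeasure

/-! ### Mixed differences in paired coordinates -/

section Paired

variable {d : ℕ}

/-- The point with coordinates `(z j).2` for `j ∈ t` and `(z j).1` otherwise. -/
def pick (t : Finset (Fin d)) (z : Fin d → ℝ × ℝ) : Fin d → ℝ :=
  fun j => if j ∈ t then (z j).2 else (z j).1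

theorem measurable_pick (t : Finset (Fin d)) : Measurable (pick t) := by
  refine measurable_pi_lambda _ fun j => ?_
  by_cases h : j ∈ t
  · simpa [pick, h] using (measurable_pi_apply j).snd
  · simpa [pick, h] using (measurable_pi_apply j).fst

theorem pick_update_of_notMem {t : Finset (Fin d)} {j : Fin d} (hj : j ∉ t)
    (z : Fin d → ℝ × ℝ) (w : ℝ × ℝ) :
    pick t (Function.update z j w) = Function.update (pick t z) j w.1 := by
  funext i
  by_cases hi : i = j
  · subst hi; simp [pick, hj]
  · simp [pick, hi]

theorem pick_insert {t : Finset (Fin d)} {j : Fin d} (z : Fin d → ℝ × ℝ) :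
    pick (insert j t) z = Function.update (pick t z) j (z j).2 := by
  funext i
  by_cases hi : i = j
  · subst hi; simp [pick]
  · simp [pick, hi]

/-- Exchange the two components of the coordinates in `t`. -/
def swapOn (t : Finset (Fin d)) (z : Fin d → ℝ × ℝ) : Fin d → ℝ × ℝ :=
  fun j => if j ∈ t then (z j).swap else z j

theorem measurePreserving_swapOn (t : Finset (Fin d)) {m : Fin d → Measure (ℝ × ℝ)}
    [∀ j, SigmaFinite (m j)]
    (hm : ∀ j ∈ t, MeasurePreserving Prod.swap (m j) (m j)) :
    MeasurePreserving (swapOn t) (Measure.pi m) (Measure.pi m) := by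
  have := measurePreserving_pi m m (f := fun j w => if j ∈ t then w.swap else w) fun j => by
    by_cases h : j ∈ t
    · simpa [h] using hm j h
    · simp only [h, if_false]
      exact MeasurePreserving.id (m j)
  exact this

theorem fst_swapOn (t : Finset (Fin d)) (z : Fin d → ℝ × ℝ) :
    (fun j => (swapOn t z j).1) = pick t z := by
  funext j
  by_cases h : j ∈ t <;> simp [swapOn, pick, h]

theorem swapOn_apply_of_notMem {t : Finset (Fin d)} {j : Fin d} (hj : j ∉ t)
    (z : Fin d → ℝ × ℝ) : swapOn t z j = z j := by simp [swapOn, hj]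

variable {𝕜 : Type*} [RCLike 𝕜]

/-- The mixed difference of `H` in the variables of `e`, at the pair of points encoded in `z`. -/
def diffZ (e : Finset (Fin d)) (H : (Fin d → ℝ) → 𝕜) (z : Fin d → ℝ × ℝ) : 𝕜 :=
  ∑ t ∈ e.powerset, (-1 : ℤ) ^ t.card • H (pick t z)

theorem measurable_diffZ (e : Finset (Fin d)) {H : (Fin d → ℝ) → 𝕜} (hH : Measurable H) :
    Measurable (diffZ e H) :=
  Finset.measurable_fun_sum _ fun t _ => by
    have := (hH.comp (measurable_pick t)).const_smul ((-1 : ℤ) ^ t.card)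
    exact this

theorem diffZ_insert' {e : Finset (Fin d)} {j : Fin d} (hj : j ∉ e) (H : (Fin d → ℝ) → 𝕜)
    (z : Fin d → ℝ × ℝ) :
    diffZ (insert j e) H z = ∑ t ∈ e.powerset, (-1 : ℤ) ^ t.card •
      (H (pick t z) - H (Function.update (pick t z) j (z j).2)) := by
  simp only [diffZ, smul_sub, Finset.sum_sub_distrib]
  rw [Finset.sum_powerset_insert hj, sub_eq_add_neg, ← Finset.sum_neg_distrib]
  congr 1
  refine Finset.sum_congr rfl fun t ht => ?_
  have hjt : j ∉ t := fun h => hj (Finset.mem_powerset.1 ht h)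
  rw [Finset.card_insert_of_notMem hjt, pow_succ, mul_neg_one, neg_smul, pick_insert]

/-- The second component `0` is a dummy, never read by `diffZ e` because `j ∉ e`. As a function of
the coordinate `j`, a mixed difference is thus an ordinary difference of a function of one variable.
-/
theorem diffZ_insert_update {e : Finset (Fin d)} {j : Fin d} (hj : j ∉ e)
    (H : (Fin d → ℝ) → 𝕜) (z : Fin d → ℝ × ℝ) (u v : ℝ) :
    diffZ (insert j e) H (Function.update z j (u, v)) =
      diffZ e H (Function.update z j (u, 0)) - diffZ e H (Function.update z j (v, 0)) := by
  rw [diffZ_insert' hj]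
  simp only [diffZ]
  rw [← Finset.sum_sub_distrib]
  refine Finset.sum_congr rfl fun t ht => ?_
  have hjt : j ∉ t := fun h => hj (Finset.mem_powerset.1 ht h)
  simp only [pick_update_of_notMem hjt, Function.update_self, Function.update_idem, smul_sub]

theorem diffZ_update_of_notMem {e : Finset (Fin d)} {j : Fin d} (hj : j ∉ e)
    (H : (Fin d → ℝ) → 𝕜) (z : Fin d → ℝ × ℝ) (w : ℝ × ℝ) :
    diffZ e H (Function.update z j w) = diffZ e H (Function.update z j (w.1, 0)) := by
  simp only [diffZ]
  refine Finset.sum_congr rfl fun t ht => ?_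
  have hjt : j ∉ t := fun h => hj (Finset.mem_powerset.1 ht h)
  simp only [pick_update_of_notMem hjt]

theorem diffZ_smul_of_notMem {e : Finset (Fin d)} {j : Fin d} (hj : j ∉ e) (a : ℝ → ℝ)
    (H : (Fin d → ℝ) → 𝕜) (z : Fin d → ℝ × ℝ) :
    diffZ e (fun x => a (x j) • H x) z = a (z j).1 • diffZ e H z := by
  simp only [diffZ, Finset.smul_sum]
  refine Finset.sum_congr rfl fun t ht => ?_
  have hjt : j ∉ t := fun h => hj (Finset.mem_powerset.1 ht h)
  have : pick t z j = (z j).1 := by simp [pick, hjt]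
  rw [this, smul_comm]

/-! ### Double integrals as integrals over pairs -/

variable (ν π : Measure ℝ)

/-- The pair measures: `ν ⊗ ν` for the coordinates in `e`, `ν ⊗ π` for the others. -/
noncomputable def pairMeasure (e : Finset (Fin d)) (j : Fin d) : Measure (ℝ × ℝ) :=
  ν.prod (if j ∈ e then ν else π)

instance sigmaFinite_pairMeasure [SigmaFinite ν] [SigmaFinite π] (e : Finset (Fin d)) (j : Fin d) :
    SigmaFinite (pairMeasure ν π e j) := by
  unfold pairMeasure
  split_ifs <;> infer_instance

theorem measurable_replaceCoords (t : Finset (Fin d)) :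
    Measurable fun q : (Fin d → ℝ) × (Fin d → ℝ) => replaceCoords t q.1 q.2 := by
  refine measurable_pi_lambda _ fun j => ?_
  by_cases hj : j ∈ t
  · simp only [replaceCoords, hj, if_true]
    exact (measurable_pi_apply j).comp measurable_fst
  · simp only [replaceCoords, hj, if_false]
    exact (measurable_pi_apply j).comp measurable_snd

theorem measurable_extendCoords (e : Finset (Fin d)) : Measurable (extendCoords e) := by
  refine measurable_pi_lambda _ fun j => ?_
  by_cases hj : j ∈ e
  · simpa only [extendCoords, hj, dif_pos] using measurable_pi_apply _
  · simp [extendCoords, hj]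

theorem measurePreserving_restrict_pi [SigmaFinite ν] [IsProbabilityMeasure π]
    (e : Finset (Fin d)) :
    MeasurePreserving (fun (y : Fin d → ℝ) (j : e) => y j)
      (Measure.pi fun j => if j ∈ e then ν else π) (Measure.pi fun _ : e => ν) := by
  have hs : ∀ j, SigmaFinite (if j ∈ e then ν else π) := fun j => by
    split_ifs <;> infer_instance
  have hp : ∀ j : {j // j ∉ e}, IsProbabilityMeasure (if (j : Fin d) ∈ e then ν else π) :=
    fun j => by rw [if_neg j.2]; infer_instance
  have h1 : MeasurePreserving (MeasurableEquiv.piEquivPiSubtypeProd (fun _ : Fin d => ℝ) (· ∈ e))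
      (Measure.pi fun j => if j ∈ e then ν else π) ((Measure.pi fun j : e => if (j : Fin d) ∈ e then ν else π).prod
      (Measure.pi fun j : {j // j ∉ e} => if (j : Fin d) ∈ e then ν else π)) := by
    convert measurePreserving_piEquivPiSubtypeProd (fun j => if j ∈ e then ν else π) (· ∈ e)
  have h2 := (measurePreserving_fst (μ := Measure.pi fun j : e =>
    if (j : Fin d) ∈ e then ν else π) (ν := Measure.pi fun j : {j // j ∉ e} =>
    if (j : Fin d) ∈ e then ν else π)).comp h1
  have e1 : (fun j : e => if (j : Fin d) ∈ e then ν else π) = fun _ => ν := by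
    funext j
    simp [j.2]
  rw [e1] at h2
  exact h2

theorem extendCoords_restrict_of_mem {e : Finset (Fin d)} {j : Fin d} (hj : j ∈ e)
    (y : Fin d → ℝ) : extendCoords e (fun j : e => y j) j = y j := by
  simp [extendCoords, hj]

/-- The variables `y_e` are completed by dummy variables of total mass one, and each `x_j` is paired
with its `y_j`. The result is one product integral over `Fin d`, to which induction over coordinates
applies. -/
theorem lintegral_lintegral_eq_lintegral_pair [SigmaFinite ν] [IsProbabilityMeasure π]
    (e : Finset (Fin d)) {Φ : (Fin d → ℝ) → (Fin d → ℝ) → ℝ≥0∞}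
    (hΦ : Measurable (Function.uncurry Φ))
    (hdep : ∀ y y' x, (∀ j ∈ e, y j = y' j) → Φ y x = Φ y' x) :
    ∫⁻ y : e → ℝ, ∫⁻ x, Φ (extendCoords e y) x ∂(Measure.pi fun _ => ν)
        ∂(Measure.pi fun _ : e => ν) =
      ∫⁻ z, Φ (fun j => (z j).2) (fun j => (z j).1) ∂(Measure.pi (pairMeasure ν π e)) := by
  have hs : ∀ j, SigmaFinite (if j ∈ e then ν else π) := fun j => by
    split_ifs <;> infer_instance
  have h1 := measurePreserving_arrowProdEquivProdArrow ℝ ℝ (Fin d) (fun _ => ν)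
    (fun j => if j ∈ e then ν else π)
  have hΦ2 : Measurable fun q : (Fin d → ℝ) × (Fin d → ℝ) => Φ q.2 q.1 := hΦ.comp measurable_swap
  have h2 := h1.lintegral_comp hΦ2
  have h3 : ∫⁻ z, Φ (fun j => (z j).2) (fun j => (z j).1) ∂(Measure.pi (pairMeasure ν π e)) =
      ∫⁻ q, Φ q.2 q.1 ∂((Measure.pi fun _ => ν).prod
        (Measure.pi fun j => if j ∈ e then ν else π)) := h2
  rw [h3, lintegral_prod_symm' _ hΦ2]
  have hΨ : Measurable fun y : e → ℝ =>
      ∫⁻ x, Φ (extendCoords e y) x ∂(Measure.pi fun _ => ν) := by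
    refine Measurable.lintegral_prod_right ?_
    exact hΦ.comp (((measurable_extendCoords e).comp measurable_fst).prodMk measurable_snd)
  rw [← (measurePreserving_restrict_pi ν π e).lintegral_comp hΨ]
  refine lintegral_congr fun y => lintegral_congr fun x => ?_
  exact hdep _ _ _ fun j hj => extendCoords_restrict_of_mem hj y

theorem measurePreserving_swap_pairMeasure [SigmaFinite ν] [SigmaFinite π] {e : Finset (Fin d)}
    {j : Fin d} (hj : j ∈ e) :
    MeasurePreserving Prod.swap (pairMeasure ν π e j) (pairMeasure ν π e j) := by
  simp only [pairMeasure, if_pos hj]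
  exact Measure.measurePreserving_swap

theorem quasiMeasurePreserving_fst_pair [SigmaFinite ν] [SigmaFinite π] (e : Finset (Fin d)) :
    Measure.QuasiMeasurePreserving (fun (z : Fin d → ℝ × ℝ) j => (z j).1)
      (Measure.pi (pairMeasure ν π e)) (Measure.pi fun _ => ν) := by
  have hs : ∀ j, SigmaFinite (if j ∈ e then ν else π) := fun j => by
    split_ifs <;> infer_instance
  have h1 := measurePreserving_arrowProdEquivProdArrow ℝ ℝ (Fin d) (fun _ => ν)
    (fun j => if j ∈ e then ν else π)
  exact Measure.quasiMeasurePreserving_fst.comp h1.quasiMeasurePreserving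

/-- `pick t` is the first projection after swapping the pairs indexed by `t ⊆ e`, and these swaps
preserve `ν ⊗ ν`. -/
theorem quasiMeasurePreserving_pick [SigmaFinite ν] [SigmaFinite π] {e t : Finset (Fin d)}
    (ht : t ⊆ e) :
    Measure.QuasiMeasurePreserving (pick t)
      (Measure.pi (pairMeasure ν π e)) (Measure.pi fun _ => ν) := by
  have h := (quasiMeasurePreserving_fst_pair ν π e).comp
    (measurePreserving_swapOn t (m := pairMeasure ν π e) fun j hj =>
      measurePreserving_swap_pairMeasure ν π (ht hj)).quasiMeasurePreserving
  have : ((fun (z : Fin d → ℝ × ℝ) j => (z j).1) ∘ swapOn t) = pick t := by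
    funext z
    exact fst_swapOn t z
  rwa [this] at h

/-- The inner double integral of the seminorm. -/
noncomputable def semiIntegral (k : ℝ → ℝ → ℝ≥0∞) (p : ℝ) (e : Finset (Fin d))
    (H : (Fin d → ℝ) → 𝕜) : ℝ≥0∞ :=
  ∫⁻ y : e → ℝ, ∫⁻ x : Fin d → ℝ,
    ‖mixedDiff e (extendCoords e y) H x‖ₑ ^ p * ∏ j : e, k (x j) (y j)
      ∂(prodMeasure d ν) ∂(Measure.pi fun _ : e => ν)

variable {ν}

/-- A mixed difference evaluates the function at points with exchanged coordinates. An exceptional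
null set stays null under all these evaluations, which are the maps `pick t` in paired coordinates.
-/
theorem semiIntegral_congr [SigmaFinite ν] (k : ℝ → ℝ → ℝ≥0∞) (p : ℝ) (e : Finset (Fin d))
    {H H' : (Fin d → ℝ) → 𝕜} (h : H =ᵐ[prodMeasure d ν] H') :
    semiIntegral ν k p e H = semiIntegral ν k p e H' := by
  obtain ⟨N, hN1, hN2, hN3⟩ := exists_measurable_superset_of_null (ae_iff.1 h)
  have hm : ∀ t ∈ e.powerset, ∀ᵐ y ∂(Measure.pi fun _ : e => ν), ∀ᵐ x ∂(prodMeasure d ν),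
      H (replaceCoords t (extendCoords e y) x) = H' (replaceCoords t (extendCoords e y) x) := by
    intro t ht
    rw [Finset.mem_powerset] at ht
    have hΦ : Measurable (Function.uncurry fun y x : Fin d → ℝ =>
        N.indicator (1 : (Fin d → ℝ) → ℝ≥0∞) (replaceCoords t y x)) :=
      (measurable_one.indicator hN2).comp (measurable_replaceCoords t)
    have e1 := lintegral_lintegral_eq_lintegral_pair ν (Measure.dirac (0 : ℝ)) e hΦ
      (fun y y' x hy => by
        have : replaceCoords t y x = replaceCoords t y' x := by
          funext j
          by_cases hj : j ∈ t
          · simp [replaceCoords, hj, hy j (ht hj)]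
          · simp [replaceCoords, hj]
        simp only [this])
    have e2 : ∫⁻ z, N.indicator (1 : (Fin d → ℝ) → ℝ≥0∞) (pick t z)
        ∂(Measure.pi (pairMeasure ν (Measure.dirac (0 : ℝ)) e)) = 0 := by
      have hq := (quasiMeasurePreserving_pick ν (Measure.dirac (0 : ℝ)) ht).ae
        (p := fun x => x ∉ N) (measure_eq_zero_iff_ae_notMem.1 hN3)
      rw [lintegral_congr_ae (g := fun _ => 0)]
      · simp
      · filter_upwards [hq] with z hz
        simp [hz]
    have e3 := e1.trans e2
    have hΦ' : Measurable (Function.uncurry fun (y : e → ℝ) (x : Fin d → ℝ) =>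
        N.indicator (1 : (Fin d → ℝ) → ℝ≥0∞) (replaceCoords t (extendCoords e y) x)) :=
      hΦ.comp (((measurable_extendCoords e).comp measurable_fst).prodMk measurable_snd)
    rw [lintegral_eq_zero_iff (Measurable.lintegral_prod_right hΦ')] at e3
    filter_upwards [e3] with y hy
    have hy' := (lintegral_eq_zero_iff (hΦ'.comp measurable_prodMk_left)).1 hy
    filter_upwards [hy'] with x hx
    by_contra hne
    have : replaceCoords t (extendCoords e y) x ∈ N := hN1 hne
    simp [this] at hx
  have hm' := (ae_ball_iff (Finset.countable_toSet e.powerset)).2 fun t ht => hm t ht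
  refine lintegral_congr_ae ?_
  filter_upwards [hm'] with y hy
  have hy' := (ae_ball_iff (Finset.countable_toSet e.powerset)).2 fun t ht => hy t ht
  refine lintegral_congr_ae ?_
  filter_upwards [hy'] with x hx
  have : mixedDiff e (extendCoords e y) H x = mixedDiff e (extendCoords e y) H' x :=
    Finset.sum_congr rfl fun t ht => by rw [hx t ht]
  simp only [this]

/-- The integral over pairs corresponding to `semiIntegral`. -/
noncomputable def pairEnergy (m : Fin d → Measure (ℝ × ℝ)) (k : ℝ → ℝ → ℝ≥0∞) (p : ℝ)
    (e : Finset (Fin d)) (H : (Fin d → ℝ) → 𝕜) : ℝ≥0∞ :=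
  ∫⁻ z, ‖diffZ e H z‖ₑ ^ p * ∏ j ∈ e, k (z j).1 (z j).2 ∂(Measure.pi m)

theorem measurable_energy_density {k : ℝ → ℝ → ℝ≥0∞} (hk : Measurable (Function.uncurry k))
    (p : ℝ) (e : Finset (Fin d)) {H : (Fin d → ℝ) → 𝕜} (hH : Measurable H) :
    Measurable fun z : Fin d → ℝ × ℝ => ‖diffZ e H z‖ₑ ^ p * ∏ j ∈ e, k (z j).1 (z j).2 := by
  refine ((measurable_diffZ e hH).enorm.pow_const p).mul ?_
  exact Finset.measurable_fun_prod _ fun j _ => hk.comp (measurable_pi_apply j)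

theorem semiIntegral_eq_pairEnergy [SigmaFinite ν] [IsProbabilityMeasure π]
    {k : ℝ → ℝ → ℝ≥0∞} (hk : Measurable (Function.uncurry k)) (p : ℝ) (e : Finset (Fin d))
    {H : (Fin d → ℝ) → 𝕜} (hH : Measurable H) :
    semiIntegral ν k p e H = pairEnergy (pairMeasure ν π e) k p e H := by
  have hΦ : Measurable (Function.uncurry fun y x : Fin d → ℝ =>
      ‖mixedDiff e y H x‖ₑ ^ p * ∏ j ∈ e, k (x j) (y j)) := by
    refine Measurable.mul ?_ ?_
    · refine Measurable.pow_const (Measurable.enorm ?_) p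
      refine Finset.measurable_fun_sum _ fun t _ => ?_
      have := (hH.comp (measurable_replaceCoords t)).const_smul ((-1 : ℤ) ^ t.card)
      exact this
    · refine Finset.measurable_fun_prod _ fun j _ => ?_
      have := hk.comp (((measurable_pi_apply j).comp
        (measurable_snd (α := Fin d → ℝ) (β := Fin d → ℝ))).prodMk
          ((measurable_pi_apply j).comp measurable_fst))
      exact this
  have e1 := lintegral_lintegral_eq_lintegral_pair ν π e hΦ (fun y y' x hy => by
    have h1 : mixedDiff e y H x = mixedDiff e y' H x := by
      refine Finset.sum_congr rfl fun t ht => ?_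
      congr 2
      funext j
      by_cases hj : j ∈ t
      · simp [replaceCoords, hj, hy j (Finset.mem_powerset.1 ht hj)]
      · simp [replaceCoords, hj]
    have h2 : ∏ j ∈ e, k (x j) (y j) = ∏ j ∈ e, k (x j) (y' j) :=
      Finset.prod_congr rfl fun j hj => by rw [hy j hj]
    simp only [h1, h2])
  refine Eq.trans ?_ e1
  refine lintegral_congr fun y => lintegral_congr fun x => ?_
  congr 1
  refine Eq.trans ?_ (Finset.prod_coe_sort e fun j => k (x j) (extendCoords e y j))
  refine Finset.prod_congr rfl fun j _ => ?_
  simp [extendCoords]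

end Paired

/-! ### One-dimensional inequalities for fractional seminorms -/

section OneDim

theorem lintegral_comp_abs_lt_top {h : ℝ → ℝ≥0∞} (hm : Measurable h)
    (hf : ∫⁻ w in Set.Ioi 0, h w < ⊤) : ∫⁻ w, h |w| < ⊤ := by
  have h0 : ∀ᵐ w : ℝ, w ≠ 0 := by simp [ae_iff]
  have h1 : ∫⁻ w, h |w| ≤ ∫⁻ w, ((Set.Ioi 0).indicator h w + (Set.Ioi 0).indicator h (-w)) := by
    refine lintegral_mono_ae ?_
    filter_upwards [h0] with w hw
    rcases lt_or_gt_of_ne hw with hlt | hgt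
    · simp [abs_of_neg hlt, hlt]
    · simp [abs_of_pos hgt, hgt]
  have hm' : Measurable ((Set.Ioi 0).indicator h) := hm.indicator measurableSet_Ioi
  refine h1.trans_lt ?_
  rw [lintegral_add_left hm', lintegral_neg_eq_self, lintegral_indicator measurableSet_Ioi]
  exact ENNReal.add_lt_top.2 ⟨hf, hf⟩

theorem lintegral_abs_rpow_Ioo_lt_top {r : ℝ} (hr : -1 < r) :
    ∫⁻ w, (Set.Ioo (-1 : ℝ) 1).indicator (fun w => ENNReal.ofReal (|w| ^ r)) w < ⊤ := by
  have h := lintegral_comp_abs_lt_top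
    (h := (Set.Iio (1 : ℝ)).indicator fun w => ENNReal.ofReal (w ^ r))
    (Measurable.indicator (by fun_prop) measurableSet_Iio) ?_
  · convert h using 3 with w
    simp only [Set.indicator, Set.mem_Ioo, Set.mem_Iio, abs_lt]
  · rw [setLIntegral_indicator measurableSet_Iio]
    have h1 : IntegrableOn (fun x : ℝ => x ^ r) (Set.Ioc 0 1) := by
      have := intervalIntegral.intervalIntegrable_rpow' (a := 0) (b := 1) hr
      rwa [intervalIntegrable_iff_integrableOn_Ioc_of_le zero_le_one] at this
    have h2 : IntegrableOn (fun x : ℝ => x ^ r) (Set.Iio 1 ∩ Set.Ioi 0) :=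
      h1.mono_set fun x hx => ⟨hx.2, hx.1.le⟩
    exact h2.lintegral_lt_top

theorem lintegral_abs_rpow_compl_lt_top {r : ℝ} (hr : r < -1) :
    ∫⁻ w, (Set.Ioo (-1 : ℝ) 1)ᶜ.indicator (fun w => ENNReal.ofReal (|w| ^ r)) w < ⊤ := by
  have h := lintegral_comp_abs_lt_top
    (h := (Set.Ici (1 : ℝ)).indicator fun w => ENNReal.ofReal (w ^ r))
    (Measurable.indicator (by fun_prop) measurableSet_Ici) ?_
  · convert h using 3 with w
    simp only [Set.indicator, Set.mem_compl_iff, Set.mem_Ioo, Set.mem_Ici, ← abs_lt, not_lt]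
  · rw [setLIntegral_indicator measurableSet_Ici]
    have h1 : IntegrableOn (fun x : ℝ => x ^ r) (Set.Ioi (1 / 2)) :=
      integrableOn_Ioi_rpow_of_lt hr (by norm_num)
    have h2 : IntegrableOn (fun x : ℝ => x ^ r) (Set.Ici 1 ∩ Set.Ioi 0) :=
      h1.mono_set fun x hx => lt_of_lt_of_le (by norm_num : (1 / 2 : ℝ) < 1) hx.1
    exact h2.lintegral_lt_top

theorem measurable_powerKernel (σ : ℝ) : Measurable (Function.uncurry (powerKernel σ)) := by
  unfold powerKernel Function.uncurry
  fun_prop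

theorem powerKernel_comm (σ u v : ℝ) : powerKernel σ u v = powerKernel σ v u := by
  simp [powerKernel, abs_sub_comm]

/-- The Lipschitz bound is used for `|u - v| < 1` and boundedness elsewhere. The resulting exponents
`p - 1 - σ > -1` and `-1 - σ < -1` are integrable at `0` and at infinity respectively. -/
theorem exists_lintegral_sub_rpow_mul_powerKernel_le {ψ : ℝ → ℝ} {L M p σ : ℝ} (hp : 1 ≤ p)
    (hL : ∀ u v, |ψ u - ψ v| ≤ L * |u - v|) (hM : ∀ u, |ψ u| ≤ M) (hσ : 0 < σ) (hσp : σ < p) :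
    ∃ C : ℝ≥0∞, C ≠ ⊤ ∧ ∀ v, ∫⁻ u, ‖ψ u - ψ v‖ₑ ^ p * powerKernel σ u v ≤ C := by
  have hL0 : 0 ≤ L := by
    have := hL 1 0
    have h2 := abs_nonneg (ψ 1 - ψ 0)
    simp at this
    linarith
  have hM0 : 0 ≤ M := (abs_nonneg _).trans (hM 0)
  let g : ℝ → ℝ≥0∞ := fun w =>
    ENNReal.ofReal (L ^ p) *
      (Set.Ioo (-1 : ℝ) 1).indicator (fun w => ENNReal.ofReal (|w| ^ (p - 1 - σ))) w +
    ENNReal.ofReal ((2 * M) ^ p) *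
      (Set.Ioo (-1 : ℝ) 1)ᶜ.indicator (fun w => ENNReal.ofReal (|w| ^ (-1 - σ))) w
  have m1 : Measurable ((Set.Ioo (-1 : ℝ) 1).indicator
      (fun w : ℝ => ENNReal.ofReal (|w| ^ (p - 1 - σ)))) :=
    Measurable.indicator (by fun_prop) measurableSet_Ioo
  have m2 : Measurable ((Set.Ioo (-1 : ℝ) 1)ᶜ.indicator
      (fun w : ℝ => ENNReal.ofReal (|w| ^ (-1 - σ)))) :=
    Measurable.indicator (by fun_prop) measurableSet_Ioo.compl
  refine ⟨∫⁻ w, g w, ?_, fun v => ?_⟩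
  · rw [lintegral_add_left (m1.const_mul _), lintegral_const_mul _ m1, lintegral_const_mul _ m2]
    exact ENNReal.add_ne_top.2
      ⟨ENNReal.mul_ne_top ENNReal.ofReal_ne_top (lintegral_abs_rpow_Ioo_lt_top (by linarith)).ne,
        ENNReal.mul_ne_top ENNReal.ofReal_ne_top
          (lintegral_abs_rpow_compl_lt_top (by linarith)).ne⟩
  · rw [← lintegral_sub_right_eq_self g v]
    have h0 : ∀ᵐ u : ℝ, u ≠ v := by simp [ae_iff]
    refine lintegral_mono_ae ?_
    filter_upwards [h0] with u hu
    have hpos : 0 < |u - v| := abs_pos.2 (sub_ne_zero.2 hu)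
    have e1 : ‖ψ u - ψ v‖ₑ ^ p * powerKernel σ u v =
        ENNReal.ofReal (|ψ u - ψ v| ^ p * (|u - v| ^ (-1 - σ))) := by
      rw [Real.enorm_eq_ofReal_abs, ENNReal.ofReal_rpow_of_nonneg (abs_nonneg _) (by linarith),
        powerKernel, ← ENNReal.ofReal_mul (by positivity)]
      congr 2
      rw [one_div, ← Real.rpow_neg hpos.le]
      congr 1
      ring
    rw [e1]
    by_cases hmem : u - v ∈ Set.Ioo (-1 : ℝ) 1
    · refine le_trans ?_ le_self_add
      rw [Set.indicator_of_mem hmem, ← ENNReal.ofReal_mul (by positivity)]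
      refine ENNReal.ofReal_le_ofReal ?_
      calc |ψ u - ψ v| ^ p * |u - v| ^ (-1 - σ)
          ≤ (L * |u - v|) ^ p * |u - v| ^ (-1 - σ) := by
            gcongr
            exact hL u v
        _ = L ^ p * |u - v| ^ (p - 1 - σ) := by
            rw [Real.mul_rpow hL0 hpos.le, mul_assoc, ← Real.rpow_add hpos]
            congr 2
            ring
    · refine le_trans ?_ le_add_self
      rw [Set.indicator_of_mem (by exact hmem), ← ENNReal.ofReal_mul (by positivity)]
      refine ENNReal.ofReal_le_ofReal ?_
      gcongr
      calc |ψ u - ψ v| ≤ |ψ u| + |ψ v| := abs_sub _ _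
        _ ≤ 2 * M := by linarith [hM u, hM v]

instance isProbabilityMeasure_intervalMeasure_half :
    IsProbabilityMeasure (intervalMeasure (1 / 2)) :=
  ⟨by simp [intervalMeasure]; norm_num⟩

instance isFiniteMeasure_intervalMeasure (ℓ : ℝ) : IsFiniteMeasure (intervalMeasure ℓ) :=
  ⟨by simp [intervalMeasure]⟩

theorem intervalMeasure_prod (ℓ : ℝ) : (intervalMeasure ℓ).prod (intervalMeasure ℓ) =
    (volume.prod volume).restrict (Set.Ioo (-ℓ) ℓ ×ˢ Set.Ioo (-ℓ) ℓ) :=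
  Measure.prod_restrict _ _

theorem lintegral_fst_prob {μ : Measure ℝ} [SFinite μ] {π : Measure ℝ} [IsProbabilityMeasure π]
    {f : ℝ → ℝ≥0∞} (hf : Measurable f) : ∫⁻ w, f w.1 ∂(μ.prod π) = ∫⁻ u, f u ∂μ := by
  rw [lintegral_prod (fun w : ℝ × ℝ => f w.1) (hf.comp measurable_fst).aemeasurable]
  simp

variable {𝕜 : Type*} [RCLike 𝕜]

/-- On the square, `ψ(u)P(u) - ψ(v)P(v) = ψ(u)(P(u) - P(v)) + (ψ(u) - ψ(v))P(v)`. If only one point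
lies in the interval, a single term `(ψ(u) - ψ(v))P` remains; if neither does, nothing remains. In
the terms with `ψ(u) - ψ(v)` the variable not occurring in `P` is integrated first, by `hK`. The
double integral over the whole plane is thus bounded by data on the square. -/
theorem lintegral_diff_smul_le {ψ : ℝ → ℝ} {M p : ℝ} {CK : ℝ≥0∞} {k : ℝ → ℝ → ℝ≥0∞}
    (hk : Measurable (Function.uncurry k)) (hks : ∀ u v, k u v = k v u) (hp : 1 ≤ p)
    (hψm : Measurable ψ) (hM : ∀ u, |ψ u| ≤ M)
    (hψ : ∀ u, u ∉ Set.Ioo (-(1 / 2) : ℝ) (1 / 2) → ψ u = 0)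
    (hK : ∀ v, ∫⁻ u, ‖ψ u - ψ v‖ₑ ^ p * k u v ≤ CK) {P : ℝ → 𝕜} (hP : Measurable P) :
    ∫⁻ w, ‖ψ w.1 • P w.1 - ψ w.2 • P w.2‖ₑ ^ p * k w.1 w.2 ∂(volume.prod volume) ≤
      (2 ^ (p - 1) * (ENNReal.ofReal M ^ p + 2 * CK)) *
        (∫⁻ w, ‖P w.1 - P w.2‖ₑ ^ p * k w.1 w.2
            ∂((intervalMeasure (1 / 2)).prod (intervalMeasure (1 / 2))) +
          ∫⁻ w, ‖P w.1‖ₑ ^ p ∂((intervalMeasure (1 / 2)).prod (intervalMeasure (1 / 2)))) := by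
  set J : Set ℝ := Set.Ioo (-(1 / 2) : ℝ) (1 / 2) with hJ
  have hJm : MeasurableSet J := measurableSet_Ioo
  let Q : ℝ → ℝ≥0∞ := J.indicator fun u => ‖P u‖ₑ ^ p
  have hQ : Measurable Q := (hP.enorm.pow_const p).indicator hJm
  let D : ℝ × ℝ → ℝ≥0∞ := fun w => ‖ψ w.1 - ψ w.2‖ₑ ^ p * k w.1 w.2
  have hD : Measurable D := (((hψm.comp measurable_fst).sub
    (hψm.comp measurable_snd)).enorm.pow_const p).mul hk
  let f1 : ℝ × ℝ → ℝ≥0∞ := (J ×ˢ J).indicator fun w => ‖P w.1 - P w.2‖ₑ ^ p * k w.1 w.2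
  have hf1 : Measurable f1 := ((((hP.comp measurable_fst).sub
    (hP.comp measurable_snd)).enorm.pow_const p).mul hk).indicator (hJm.prod hJm)
  have hp0 : 0 < p := by linarith
  have h2 : (1 : ℝ≥0∞) ≤ 2 ^ (p - 1) := by
    simpa using ENNReal.rpow_le_rpow (one_le_two (α := ℝ≥0∞)) (sub_nonneg.2 hp)
  have hpt : ∀ w : ℝ × ℝ, ‖ψ w.1 • P w.1 - ψ w.2 • P w.2‖ₑ ^ p * k w.1 w.2 ≤
      2 ^ (p - 1) * (ENNReal.ofReal M ^ p * f1 w + Q w.2 * D w + Q w.1 * D w) := by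
    rintro ⟨u, v⟩
    simp only [Q, D, f1]
    by_cases hu : u ∈ J
    · by_cases hv : v ∈ J
      · rw [Set.indicator_of_mem (show (u, v) ∈ J ×ˢ J from ⟨hu, hv⟩), Set.indicator_of_mem hv]
        have e : ψ u • P u - ψ v • P v = ψ u • (P u - P v) + (ψ u - ψ v) • P v := by
          rw [smul_sub, sub_smul]; abel
        have hMu : ‖ψ u‖ₑ ≤ ENNReal.ofReal M := by
          rw [Real.enorm_eq_ofReal_abs]; exact ENNReal.ofReal_le_ofReal (hM u)
        calc ‖ψ u • P u - ψ v • P v‖ₑ ^ p * k u v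
            ≤ (ENNReal.ofReal M * ‖P u - P v‖ₑ + ‖ψ u - ψ v‖ₑ * ‖P v‖ₑ) ^ p * k u v := by
              gcongr
              rw [e]
              refine (enorm_add_le _ _).trans ?_
              rw [enorm_smul, enorm_smul]
              gcongr
          _ ≤ (2 ^ (p - 1) * ((ENNReal.ofReal M * ‖P u - P v‖ₑ) ^ p +
                (‖ψ u - ψ v‖ₑ * ‖P v‖ₑ) ^ p)) * k u v := by
              gcongr
              exact ENNReal.rpow_add_le_mul_rpow_add_rpow _ _ hp
          _ = 2 ^ (p - 1) * (ENNReal.ofReal M ^ p * (‖P u - P v‖ₑ ^ p * k u v) +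
                ‖P v‖ₑ ^ p * (‖ψ u - ψ v‖ₑ ^ p * k u v)) := by
              rw [ENNReal.mul_rpow_of_nonneg _ _ hp0.le, ENNReal.mul_rpow_of_nonneg _ _ hp0.le]
              ring
          _ ≤ _ := mul_le_mul' le_rfl le_self_add
      · have e : ψ u • P u - ψ v • P v = (ψ u - ψ v) • P u := by simp [hψ v hv]
        rw [Set.indicator_of_mem hu, e, enorm_smul, ENNReal.mul_rpow_of_nonneg _ _ hp0.le]
        calc _ = 1 * (‖P u‖ₑ ^ p * (‖ψ u - ψ v‖ₑ ^ p * k u v)) := by ring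
          _ ≤ _ := by
            gcongr
            exact le_add_self
    · by_cases hv : v ∈ J
      · have e : ψ u • P u - ψ v • P v = (ψ u - ψ v) • P v := by simp [hψ u hu]
        rw [Set.indicator_of_mem hv, e, enorm_smul, ENNReal.mul_rpow_of_nonneg _ _ hp0.le]
        calc _ = 1 * (‖P v‖ₑ ^ p * (‖ψ u - ψ v‖ₑ ^ p * k u v)) := by ring
          _ ≤ _ := by
            gcongr
            rw [add_right_comm]
            exact le_add_self
      · simp [hψ u hu, hψ v hv, hp0]
  have i2 : ∫⁻ w : ℝ × ℝ, Q w.2 * D w ∂(volume.prod volume) ≤ CK * ∫⁻ v, Q v := by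
    rw [lintegral_prod_symm' (fun w : ℝ × ℝ => Q w.2 * D w) ((hQ.comp measurable_snd).mul hD), ← lintegral_const_mul _ hQ]
    refine lintegral_mono fun v => ?_
    have hDv : Measurable fun u => D (u, v) := hD.comp (measurable_id.prodMk measurable_const)
    simp only
    rw [lintegral_const_mul _ hDv, mul_comm]
    exact mul_le_mul' (hK v) le_rfl
  have i3 : ∫⁻ w : ℝ × ℝ, Q w.1 * D w ∂(volume.prod volume) ≤ CK * ∫⁻ v, Q v := by
    rw [← lintegral_prod_swap]
    refine le_trans (le_of_eq (lintegral_congr fun w => ?_)) i2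
    simp only [D, Prod.fst_swap, Prod.snd_swap]
    rw [hks, enorm_sub_rev]
  have i1 : ∫⁻ w, f1 w ∂(volume.prod volume) = ∫⁻ w, ‖P w.1 - P w.2‖ₑ ^ p * k w.1 w.2
      ∂((intervalMeasure (1 / 2)).prod (intervalMeasure (1 / 2))) := by
    rw [intervalMeasure_prod, lintegral_indicator (hJm.prod hJm)]
  have i4 : ∫⁻ w, ‖P w.1‖ₑ ^ p ∂((intervalMeasure (1 / 2)).prod (intervalMeasure (1 / 2))) =
      ∫⁻ v, Q v := by
    rw [lintegral_fst_prob (f := fun u => ‖P u‖ₑ ^ p) (hP.enorm.pow_const p), intervalMeasure,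
      ← lintegral_indicator hJm]
  rw [← i1, i4]
  have hm2 : Measurable fun w : ℝ × ℝ => Q w.2 * D w := (hQ.comp measurable_snd).mul hD
  have hm3 : Measurable fun w : ℝ × ℝ => Q w.1 * D w := (hQ.comp measurable_fst).mul hD
  refine (lintegral_mono hpt).trans ?_
  have hm1 : Measurable fun w => ENNReal.ofReal M ^ p * f1 w := hf1.const_mul _
  have hm4 : Measurable fun w => ENNReal.ofReal M ^ p * f1 w + Q w.2 * D w + Q w.1 * D w :=
    (hm1.add hm2).add hm3
  rw [lintegral_const_mul _ hm4,
    lintegral_add_right _ hm3, lintegral_add_right _ hm2, lintegral_const_mul _ hf1]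
  generalize (∫⁻ w, f1 w ∂(volume.prod volume)) = x
  generalize (∫⁻ v, Q v) = y at i2 i3
  calc _ ≤ 2 ^ (p - 1) * (ENNReal.ofReal M ^ p * x + CK * y + CK * y) := by gcongr
    _ ≤ 2 ^ (p - 1) * (ENNReal.ofReal M ^ p * (x + y) + CK * (x + y) + CK * (x + y)) := by
        gcongr <;> first | exact le_self_add | exact le_add_self
    _ = _ := by ring

theorem lintegral_smul_le {ψ : ℝ → ℝ} {M p : ℝ} (hp : 0 < p) (hM : ∀ u, |ψ u| ≤ M)
    (hψm : Measurable ψ)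
    (hψ : ∀ u, u ∉ Set.Ioo (-(1 / 2) : ℝ) (1 / 2) → ψ u = 0) {P : ℝ → 𝕜} (hP : Measurable P) :
    ∫⁻ w, ‖ψ w.1 • P w.1‖ₑ ^ p ∂(volume.prod (intervalMeasure (1 / 2))) ≤
      ENNReal.ofReal M ^ p *
        ∫⁻ w, ‖P w.1‖ₑ ^ p ∂((intervalMeasure (1 / 2)).prod (intervalMeasure (1 / 2))) := by
  rw [lintegral_fst_prob (f := fun u => ‖P u‖ₑ ^ p) (hP.enorm.pow_const p),
    lintegral_fst_prob (f := fun u => ‖ψ u • P u‖ₑ ^ p) ((hψm.smul hP).enorm.pow_const p),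
    intervalMeasure, ← lintegral_const_mul _ (hP.enorm.pow_const p),
    ← lintegral_indicator measurableSet_Ioo]
  refine lintegral_mono fun u => ?_
  by_cases hu : u ∈ Set.Ioo (-(1 / 2) : ℝ) (1 / 2)
  · rw [Set.indicator_of_mem hu, enorm_smul, ENNReal.mul_rpow_of_nonneg _ _ hp.le]
    gcongr
    rw [Real.enorm_eq_ofReal_abs]
    exact ENNReal.ofReal_le_ofReal (hM u)
  · simp [hψ u hu, hp]

theorem lintegral_rpow_le_measure_mul {μ : Measure ℝ} {S : Set ℝ} {p : ℝ} (hp : 1 < p)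
    {P : ℝ → ℝ≥0∞} (hP : Measurable P) :
    (∫⁻ u in S, P u ∂μ) ^ p ≤ μ S ^ (p - 1) * ∫⁻ u in S, P u ^ p ∂μ := by
  have hpq := Real.HolderConjugate.conjExponent hp
  have h := ENNReal.lintegral_mul_le_Lp_mul_Lq (μ.restrict S) hpq hP.aemeasurable
    (aemeasurable_const (b := (1 : ℝ≥0∞)))
  have hp0 : 0 < p := by linarith
  have h1 := ENNReal.rpow_le_rpow h hp0.le
  simp only [Pi.mul_apply, mul_one, ENNReal.one_rpow, lintegral_const, Measure.restrict_apply,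
    MeasurableSet.univ, Set.univ_inter, one_mul] at h1
  refine h1.trans (le_of_eq ?_)
  rw [ENNReal.mul_rpow_of_nonneg _ _ hp0.le, ← ENNReal.rpow_mul, ← ENNReal.rpow_mul, mul_comm,
    one_div_mul_cancel hp0.ne', ENNReal.rpow_one]
  congr 2
  rw [Real.conjExponent]
  field_simp

/-- Hölder bounds the `p`-th power of the integral by `|u-v|^{p-1}` times the integral of `P^p`
between the points, so the kernel leaves `|τ|^{p-2-σ}` with `τ = v - u`. Integrating over `u` at
fixed `τ` gives one more factor `|τ|`, and the exponent `p - 1 - σ` exceeds `-1`. -/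
theorem exists_lintegral_primitive_le {p σ : ℝ} (hp : 1 < p) (hσp : σ < p) :
    ∃ C : ℝ≥0∞, C ≠ ⊤ ∧ ∀ P : ℝ → ℝ≥0∞, Measurable P →
      ∫⁻ w, (∫⁻ u in Set.uIoc w.2 w.1, P u) ^ p * powerKernel σ w.1 w.2
          ∂((intervalMeasure (1 / 2)).prod (intervalMeasure (1 / 2))) ≤
        C * ∫⁻ w, P w.1 ^ p ∂((intervalMeasure (1 / 2)).prod (intervalMeasure (1 / 2))) := by
  set J : Set ℝ := Set.Ioo (-(1 / 2) : ℝ) (1 / 2) with hJ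
  have hJm : MeasurableSet J := measurableSet_Ioo
  have hp0 : 0 < p := by linarith
  let g : ℝ → ℝ≥0∞ :=
    (Set.Ioo (-1 : ℝ) 1).indicator fun w => ENNReal.ofReal (|w| ^ (p - 1 - σ))
  have hg : Measurable g := Measurable.indicator (by fun_prop) measurableSet_Ioo
  refine ⟨∫⁻ τ, g τ, (lintegral_abs_rpow_Ioo_lt_top (by linarith)).ne, fun P hP => ?_⟩
  let R : ℝ → ℝ≥0∞ := J.indicator P
  have hR : Measurable R := hP.indicator hJm
  let A : Set (ℝ × ℝ × ℝ) := {q | q.2.2 ∈ Set.uIoc q.1 0}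
  have hA : MeasurableSet A := by
    have : A = {q | min q.1 0 < q.2.2} ∩ {q | q.2.2 ≤ max q.1 0} := rfl
    rw [this]
    exact (measurableSet_lt (by fun_prop) (by fun_prop)).inter
      (measurableSet_le (by fun_prop) (by fun_prop))
  -- the integrand in the variables `(τ, u)`, where `τ` is the difference of the two points
  let F : ℝ → ℝ → ℝ≥0∞ := fun τ u =>
    (Set.Ioo (-1 : ℝ) 1).indicator (fun τ => ENNReal.ofReal (|τ| ^ (p - 2 - σ))) τ *
      ∫⁻ r, A.indicator (fun q => R (q.2.1 + q.2.2) ^ p) (τ, u, r)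
  have hin : Measurable fun q : ℝ × ℝ × ℝ => A.indicator (fun q => R (q.2.1 + q.2.2) ^ p) q :=
    ((hR.comp (by fun_prop)).pow_const p).indicator hA
  have hF : Measurable (Function.uncurry F) := by
    refine Measurable.mul ?_ ?_
    · exact (Measurable.indicator (by fun_prop) measurableSet_Ioo).comp measurable_fst
    · refine Measurable.lintegral_prod_right' (f := fun q : (ℝ × ℝ) × ℝ =>
        A.indicator (fun q => R (q.2.1 + q.2.2) ^ p) (q.1.1, q.1.2, q.2)) ?_
      exact hin.comp (by fun_prop)
  have step1 : ∀ w ∈ J ×ˢ J, (∫⁻ u in Set.uIoc w.2 w.1, P u) ^ p * powerKernel σ w.1 w.2 ≤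
      F (w.2 - w.1) w.1 := by
    rintro ⟨u, v⟩ ⟨hu, hv⟩
    simp only at hu hv ⊢
    by_cases huv : u = v
    · subst huv
      simp [hp0]
    have hpos : 0 < |v - u| := abs_pos.2 (sub_ne_zero.2 (Ne.symm huv))
    have hsub : Set.uIoc v u ⊆ J := by
      intro r hr
      rw [Set.uIoc, Set.mem_Ioc] at hr
      exact ⟨lt_of_lt_of_le (lt_min hv.1 hu.1) hr.1.le, lt_of_le_of_lt hr.2 (max_lt hv.2 hu.2)⟩
    have e1 : ∫⁻ r in Set.uIoc v u, P r = ∫⁻ r in Set.uIoc v u, R r :=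
      setLIntegral_congr_fun measurableSet_uIoc fun r hr => by
        simp [R, Set.indicator_of_mem (hsub hr)]
    have hmem : v - u ∈ Set.Ioo (-1 : ℝ) 1 := by
      constructor <;> linarith [hu.1, hu.2, hv.1, hv.2]
    have e2 : ∫⁻ r, A.indicator (fun q => R (q.2.1 + q.2.2) ^ p) (v - u, u, r) =
        ∫⁻ r in Set.uIoc v u, R r ^ p := by
      rw [← lintegral_indicator measurableSet_uIoc,
        ← lintegral_add_left_eq_self ((Set.uIoc v u).indicator fun r => R r ^ p) u]
      refine lintegral_congr fun r => ?_
      have hiff : (v - u, u, r) ∈ A ↔ u + r ∈ Set.uIoc v u := by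
        simp only [A, Set.mem_ofPred_eq, Set.uIoc, Set.mem_Ioc]
        rcases le_total v u with h | h
        · rw [min_eq_left (sub_nonpos.2 h), max_eq_right (sub_nonpos.2 h), min_eq_left h,
            max_eq_right h]
          constructor <;> rintro ⟨h1, h2⟩ <;> constructor <;> linarith
        · rw [min_eq_right (sub_nonneg.2 h), max_eq_left (sub_nonneg.2 h), min_eq_right h,
            max_eq_left h]
          constructor <;> rintro ⟨h1, h2⟩ <;> constructor <;> linarith
      by_cases hr : u + r ∈ Set.uIoc v u
      · rw [Set.indicator_of_mem hr, Set.indicator_of_mem (hiff.2 hr)]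
      · rw [Set.indicator_of_notMem hr, Set.indicator_of_notMem (mt hiff.1 hr)]
    simp only [F]
    rw [e1, e2, Set.indicator_of_mem hmem]
    have hvol : volume (Set.uIoc v u) = ENNReal.ofReal |v - u| := by
      rw [Set.uIoc, Real.volume_Ioc, max_sub_min_eq_abs, abs_sub_comm]
    calc (∫⁻ r in Set.uIoc v u, R r) ^ p * powerKernel σ u v
        ≤ (volume (Set.uIoc v u) ^ (p - 1) * ∫⁻ r in Set.uIoc v u, R r ^ p) *
            powerKernel σ u v := by
          gcongr
          exact lintegral_rpow_le_measure_mul hp hR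
      _ = (ENNReal.ofReal (|v - u| ^ (p - 1)) * powerKernel σ u v) *
            ∫⁻ r in Set.uIoc v u, R r ^ p := by
          rw [hvol, ENNReal.ofReal_rpow_of_nonneg (abs_nonneg _) (by linarith)]
          ring
      _ = _ := by
          congr 1
          rw [powerKernel, ← ENNReal.ofReal_mul (by positivity), abs_sub_comm u v, one_div,
            ← Real.rpow_neg hpos.le, ← Real.rpow_add hpos]
          congr 2
          ring
  have hFw : Measurable fun w : ℝ × ℝ => F (w.2 - w.1) w.1 :=
    hF.comp (show Measurable fun w : ℝ × ℝ => (w.2 - w.1, w.1) by fun_prop)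
  -- By translation invariance the integral over `u` does not depend on `r`, and `r` runs over an
  -- interval of length `|τ|`.
  have step2 : ∀ τ, τ ≠ 0 → ∫⁻ u, F τ u = g τ * ∫⁻ u, R u ^ p := by
    intro τ hne
    simp only [F]
    have hin2 : Measurable fun q : ℝ × ℝ => A.indicator (fun q => R (q.2.1 + q.2.2) ^ p) (τ, q.1, q.2) :=
      hin.comp (by fun_prop)
    rw [lintegral_const_mul _ (Measurable.lintegral_prod_right' hin2),
      lintegral_lintegral_swap hin2.aemeasurable]
    have : ∀ r, ∫⁻ u, A.indicator (fun q => R (q.2.1 + q.2.2) ^ p) (τ, u, r) =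
        (Set.uIoc τ 0).indicator (fun _ => ∫⁻ u, R u ^ p) r := by
      intro r
      by_cases hr : r ∈ Set.uIoc τ 0
      · rw [Set.indicator_of_mem hr, ← lintegral_add_right_eq_self (fun u => R u ^ p) r]
        refine lintegral_congr fun u => ?_
        rw [Set.indicator_of_mem (show (τ, u, r) ∈ A from hr)]
      · rw [Set.indicator_of_notMem hr]
        rw [← lintegral_zero (μ := (volume : Measure ℝ))]
        refine lintegral_congr fun u => ?_
        rw [Set.indicator_of_notMem (show (τ, u, r) ∉ A from hr)]
    simp_rw [this]
    rw [lintegral_indicator measurableSet_uIoc, setLIntegral_const, Set.uIoc, Real.volume_Ioc,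
      max_sub_min_eq_abs, zero_sub, abs_neg]
    simp only [g]
    by_cases hτ : τ ∈ Set.Ioo (-1 : ℝ) 1
    · rw [Set.indicator_of_mem hτ, Set.indicator_of_mem hτ]
      have hpos : 0 < |τ| := abs_pos.2 hne
      rw [mul_comm (∫⁻ u, R u ^ p), ← mul_assoc, ← ENNReal.ofReal_mul (by positivity)]
      congr 2
      nth_rw 2 [← Real.rpow_one |τ|]
      rw [← Real.rpow_add hpos]
      congr 1
      ring
    · rw [Set.indicator_of_notMem hτ, Set.indicator_of_notMem hτ]
      simp
  calc ∫⁻ w, (∫⁻ u in Set.uIoc w.2 w.1, P u) ^ p * powerKernel σ w.1 w.2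
          ∂((intervalMeasure (1 / 2)).prod (intervalMeasure (1 / 2)))
      ≤ ∫⁻ w in J ×ˢ J, F (w.2 - w.1) w.1 ∂(volume.prod volume) := by
        rw [intervalMeasure_prod]
        exact setLIntegral_mono' (hJm.prod hJm) step1
    _ ≤ ∫⁻ w, F (w.2 - w.1) w.1 ∂(volume.prod volume) := setLIntegral_le_lintegral _ _
    _ = ∫⁻ u, ∫⁻ v, F (v - u) u := lintegral_prod _ hFw.aemeasurable
    _ = ∫⁻ u, ∫⁻ τ, F τ u := lintegral_congr fun u => lintegral_sub_right_eq_self (F · u) u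
    _ = ∫⁻ τ, ∫⁻ u, F τ u := lintegral_lintegral_swap (hF.comp measurable_swap).aemeasurable
    _ = (∫⁻ τ, g τ) * ∫⁻ u, R u ^ p := by 
      rw [← lintegral_mul_const _ hg]
      have h0 : ∀ᵐ τ : ℝ, τ ≠ 0 := by simp [ae_iff]
      refine lintegral_congr_ae ?_
      filter_upwards [h0] with τ hτ using step2 τ hτ
    _ = _ := by
      rw [lintegral_fst_prob (f := fun u => P u ^ p) (hP.pow_const p), intervalMeasure,
        ← lintegral_indicator hJm]
      congr 2
      funext u
      by_cases hu : u ∈ J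
      · simp [R, hu]
      · simp [R, hu, hp0]

end OneDim

/-! ### Mixed differences of products and of weak derivatives -/

section Tensor

variable {d : ℕ} {𝕜 : Type*} [RCLike 𝕜]

/-- Lebesgue measure on the square `(-1/2, 1/2)²`. -/
noncomputable def squareMeasure : Measure (ℝ × ℝ) :=
  (intervalMeasure (1 / 2)).prod (intervalMeasure (1 / 2))

instance : IsProbabilityMeasure squareMeasure := by
  unfold squareMeasure; infer_instance

/-- The full pair measures for the coordinates in `s`, and `squareMeasure` for the others. -/
noncomputable def partialPairMeasure (e s : Finset (Fin d)) (j : Fin d) : Measure (ℝ × ℝ) :=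
  if j ∈ s then pairMeasure volume (intervalMeasure (1 / 2)) e j else squareMeasure

instance (e s : Finset (Fin d)) (j : Fin d) : SigmaFinite (partialPairMeasure e s j) := by
  unfold partialPairMeasure
  split_ifs <;> infer_instance

theorem partialPairMeasure_erase {e s : Finset (Fin d)} {j : Fin d} (hj : j ∉ s) :
    partialPairMeasure (e.erase j) s = partialPairMeasure e s := by
  funext i
  by_cases hi : i ∈ s
  · have hne : i ≠ j := fun h => hj (h ▸ hi)
    simp [partialPairMeasure, hi, pairMeasure, hne]
  · simp [partialPairMeasure, hi]

/-- Induction on the set `s` of coordinates already multiplied by their cutoff. In these the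
measures live on the whole line; in the others still on the square. A new coordinate `j ∈ e` is
treated by `lintegral_diff_smul_le`, and its second term has no difference in `j`, whence the sum
over subsets of `e`. For `j ∉ e` the sup bound on `ψ j` suffices. -/
theorem exists_pairEnergy_prod_smul_le {k : ℝ → ℝ → ℝ≥0∞} (hk : Measurable (Function.uncurry k))
    (hks : ∀ u v, k u v = k v u) {p M : ℝ} (hp : 1 ≤ p) {CK : ℝ≥0∞} (hCK : CK ≠ ⊤)
    (ψ : Fin d → ℝ → ℝ) (hψm : ∀ j, Measurable (ψ j)) (hM : ∀ j u, |ψ j u| ≤ M)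
    (hψ : ∀ j u, u ∉ Set.Ioo (-(1 / 2) : ℝ) (1 / 2) → ψ j u = 0)
    (hK : ∀ j v, ∫⁻ u, ‖ψ j u - ψ j v‖ₑ ^ p * k u v ≤ CK) (s : Finset (Fin d)) :
    ∃ C : ℝ≥0∞, C ≠ ⊤ ∧ ∀ H : (Fin d → ℝ) → 𝕜, Measurable H → ∀ e : Finset (Fin d),
      pairEnergy (partialPairMeasure e s) k p e (fun x => (∏ j ∈ s, ψ j (x j)) • H x) ≤
        C * ∑ e' ∈ e.powerset, pairEnergy (fun _ => squareMeasure) k p e' H := by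
  have hp0 : 0 < p := by linarith
  induction s using Finset.induction with
  | empty =>
    refine ⟨1, ENNReal.one_ne_top, fun H _ e => ?_⟩
    have : partialPairMeasure e ∅ = fun _ => squareMeasure := by
      funext j; simp [partialPairMeasure]
    simp only [Finset.prod_empty, one_smul, one_mul, this]
    exact Finset.single_le_sum (f := fun e' => pairEnergy (fun _ => squareMeasure) k p e' H)
      (fun _ _ => zero_le) (Finset.mem_powerset_self e)
  | insert j s hj ih =>
    obtain ⟨C, hC, ih⟩ := ih
    set C1 : ℝ≥0∞ := 2 ^ (p - 1) * (ENNReal.ofReal M ^ p + 2 * CK) with hC1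
    have hMt : ENNReal.ofReal M ^ p ≠ ⊤ := ENNReal.rpow_ne_top_of_nonneg hp0.le ENNReal.ofReal_ne_top
    have hC1t : C1 ≠ ⊤ := ENNReal.mul_ne_top
      (ENNReal.rpow_ne_top_of_nonneg (by linarith) (by simp))
      (ENNReal.add_ne_top.2 ⟨hMt, ENNReal.mul_ne_top (by simp) hCK⟩)
    refine ⟨C1 * (2 * C) + ENNReal.ofReal M ^ p * C, ENNReal.add_ne_top.2
      ⟨ENNReal.mul_ne_top hC1t (ENNReal.mul_ne_top (by simp) hC), ENNReal.mul_ne_top hMt hC⟩,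
      fun H hH e => ?_⟩
    set G : (Fin d → ℝ) → 𝕜 := fun x => (∏ i ∈ s, ψ i (x i)) • H x with hG
    have hGm : Measurable G := by
      refine Measurable.smul ?_ hH
      exact Finset.measurable_fun_prod _ fun i _ => (hψm i).comp (measurable_pi_apply i)
    have hF : (fun x => (∏ i ∈ insert j s, ψ i (x i)) • H x) = fun x => ψ j (x j) • G x := by
      funext x
      rw [Finset.prod_insert hj, SemigroupAction.mul_smul]
    have hFm : Measurable fun x : Fin d → ℝ => ψ j (x j) • G x :=
      ((hψm j).comp (measurable_pi_apply j)).smul hGm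
    rw [hF]
    have hoff : ∀ i, i ≠ j → partialPairMeasure e (insert j s) i = partialPairMeasure e s i := by
      intro i hi
      simp [partialPairMeasure, Finset.mem_insert, hi]
    have hat : partialPairMeasure e s j = squareMeasure := by simp [partialPairMeasure, hj]
    have hc : ∀ (t : Finset (Fin d)), j ∉ t → ∀ (z : Fin d → ℝ × ℝ) (w : ℝ × ℝ),
        ∏ i ∈ t, k (Function.update z j w i).1 (Function.update z j w i).2 =
          ∏ i ∈ t, k (z i).1 (z i).2 := by
      intro t ht z w
      refine Finset.prod_congr rfl fun i hi => ?_
      have : i ≠ j := fun h => ht (h ▸ hi)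
      simp [this]
    have hPm : ∀ (t : Finset (Fin d)) (z : Fin d → ℝ × ℝ),
        Measurable fun u : ℝ => diffZ t G (Function.update z j (u, 0)) := fun t z =>
      (measurable_diffZ t hGm).comp ((measurable_update z).comp
        (measurable_id.prodMk measurable_const))
    by_cases hje : j ∈ e
    · set t := e.erase j with ht
      have hjt : j ∉ t := Finset.notMem_erase j e
      have het : e = insert j t := (Finset.insert_erase hje).symm
      have hatI : partialPairMeasure e (insert j s) j = volume.prod volume := by
        simp [partialPairMeasure, pairMeasure, hje]
      have g1m := measurable_energy_density hk p e hGm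
      have g2m := measurable_energy_density hk p t hGm
      have main := lintegral_pi_le_of_coord j hoff (measurable_energy_density hk p e hFm)
        (f' := fun z => C1 * (‖diffZ e G z‖ₑ ^ p * ∏ i ∈ e, k (z i).1 (z i).2 +
          ‖diffZ t G z‖ₑ ^ p * ∏ i ∈ t, k (z i).1 (z i).2))
        ((g1m.add g2m).const_mul _) (fun z => by
          rw [hatI, hat]
          set P : ℝ → 𝕜 := fun u => diffZ t G (Function.update z j (u, 0)) with hP
          set c : ℝ≥0∞ := ∏ i ∈ t, k (z i).1 (z i).2 with hcdef
          have e1 : ∀ w : ℝ × ℝ, ‖diffZ e (fun x => ψ j (x j) • G x) (Function.update z j w)‖ₑ ^ p *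
              ∏ i ∈ e, k (Function.update z j w i).1 (Function.update z j w i).2 =
              (‖ψ j w.1 • P w.1 - ψ j w.2 • P w.2‖ₑ ^ p * k w.1 w.2) * c := by
            rintro ⟨u, v⟩
            rw [het, Finset.prod_insert hjt, hc t hjt, diffZ_insert_update hjt,
              diffZ_smul_of_notMem hjt, diffZ_smul_of_notMem hjt]
            simp only [Function.update_self]
            ring
          have e2 : ∀ w : ℝ × ℝ, ‖diffZ e G (Function.update z j w)‖ₑ ^ p *
              ∏ i ∈ e, k (Function.update z j w i).1 (Function.update z j w i).2 =
              (‖P w.1 - P w.2‖ₑ ^ p * k w.1 w.2) * c := by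
            rintro ⟨u, v⟩
            rw [het, Finset.prod_insert hjt, hc t hjt, diffZ_insert_update hjt]
            simp only [Function.update_self]
            ring
          have e3 : ∀ w : ℝ × ℝ, ‖diffZ t G (Function.update z j w)‖ₑ ^ p *
              ∏ i ∈ t, k (Function.update z j w i).1 (Function.update z j w i).2 =
              ‖P w.1‖ₑ ^ p * c := by
            intro w
            rw [hc t hjt, diffZ_update_of_notMem hjt]
          simp only [e1, e2, e3]
          have hPmz := hPm t z
          have m0 : Measurable fun w : ℝ × ℝ => ‖ψ j w.1 • P w.1 - ψ j w.2 • P w.2‖ₑ ^ p * k w.1 w.2 :=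
            ((((((hψm j).comp measurable_fst).smul (hPmz.comp measurable_fst)).sub
              (((hψm j).comp measurable_snd).smul (hPmz.comp measurable_snd))).enorm.pow_const p)).mul hk
          have m1 : Measurable fun w : ℝ × ℝ => ‖P w.1 - P w.2‖ₑ ^ p * k w.1 w.2 :=
            (((hPmz.comp measurable_fst).sub (hPmz.comp measurable_snd)).enorm.pow_const p).mul hk
          have m2 : Measurable fun w : ℝ × ℝ => ‖P w.1‖ₑ ^ p :=
            (hPmz.comp measurable_fst).enorm.pow_const p
          have m3 : Measurable fun w : ℝ × ℝ => ‖P w.1 - P w.2‖ₑ ^ p * k w.1 w.2 * c +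
            ‖P w.1‖ₑ ^ p * c := (m1.mul_const c).add (m2.mul_const c)
          rw [lintegral_mul_const _ m0, lintegral_const_mul _ m3,
            lintegral_add_right _ (m2.mul_const c), lintegral_mul_const _ m1,
            lintegral_mul_const _ m2, ← add_mul, ← mul_assoc]
          refine mul_le_mul' ?_ le_rfl
          exact lintegral_diff_smul_le hk hks hp (hψm j) (hM j) (hψ j) (hK j) hPmz)
      rw [lintegral_const_mul C1 (f := fun z => ‖diffZ e G z‖ₑ ^ p * ∏ i ∈ e, k (z i).1 (z i).2 +
        ‖diffZ t G z‖ₑ ^ p * ∏ i ∈ t, k (z i).1 (z i).2) (g1m.add g2m),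
        lintegral_add_left g1m] at main
      have i1 := ih H hH e
      have i2 := ih H hH t
      -- Removing `j` from `e` leaves the measures unchanged, since `j ∉ s` still carries the square
      -- measure.
      rw [partialPairMeasure_erase hj] at i2
      have hsum : ∑ e' ∈ t.powerset, pairEnergy (fun _ => squareMeasure) k p e' H ≤
          ∑ e' ∈ e.powerset, pairEnergy (fun _ => squareMeasure) k p e' H :=
        Finset.sum_le_sum_of_subset (Finset.powerset_mono.2 (Finset.erase_subset j e))
      refine main.trans ?_
      calc _ ≤ C1 * (C * ∑ e' ∈ e.powerset, pairEnergy (fun _ => squareMeasure) k p e' H +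
            C * ∑ e' ∈ e.powerset, pairEnergy (fun _ => squareMeasure) k p e' H) :=
            mul_le_mul' le_rfl (add_le_add i1 (i2.trans (mul_le_mul' le_rfl hsum)))
        _ = (C1 * (2 * C)) * ∑ e' ∈ e.powerset, pairEnergy (fun _ => squareMeasure) k p e' H := by
            ring
        _ ≤ _ := mul_le_mul' le_self_add le_rfl
    · have hatI : partialPairMeasure e (insert j s) j = volume.prod (intervalMeasure (1 / 2)) := by
        simp [partialPairMeasure, pairMeasure, hje]
      have g1m := measurable_energy_density hk p e hGm
      have main := lintegral_pi_le_of_coord j hoff (measurable_energy_density hk p e hFm)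
        (f' := fun z => ENNReal.ofReal M ^ p *
          (‖diffZ e G z‖ₑ ^ p * ∏ i ∈ e, k (z i).1 (z i).2)) (g1m.const_mul _) (fun z => by
          rw [hatI, hat]
          set P : ℝ → 𝕜 := fun u => diffZ e G (Function.update z j (u, 0)) with hP
          set c : ℝ≥0∞ := ∏ i ∈ e, k (z i).1 (z i).2 with hcdef
          have e1 : ∀ w : ℝ × ℝ, ‖diffZ e (fun x => ψ j (x j) • G x) (Function.update z j w)‖ₑ ^ p *
              ∏ i ∈ e, k (Function.update z j w i).1 (Function.update z j w i).2 =
              ‖ψ j w.1 • P w.1‖ₑ ^ p * c := by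
            intro w
            rw [hc e hje, diffZ_smul_of_notMem hje, diffZ_update_of_notMem hje]
            simp only [Function.update_self]
            rfl
          have e3 : ∀ w : ℝ × ℝ, ‖diffZ e G (Function.update z j w)‖ₑ ^ p *
              ∏ i ∈ e, k (Function.update z j w i).1 (Function.update z j w i).2 =
              ‖P w.1‖ₑ ^ p * c := by
            intro w
            rw [hc e hje, diffZ_update_of_notMem hje]
          simp only [e1, e3]
          have hPmz := hPm e z
          have m0 : Measurable fun w : ℝ × ℝ => ‖ψ j w.1 • P w.1‖ₑ ^ p :=
            (((hψm j).comp measurable_fst).smul (hPmz.comp measurable_fst)).enorm.pow_const p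
          have m2 : Measurable fun w : ℝ × ℝ => ‖P w.1‖ₑ ^ p :=
            (hPmz.comp measurable_fst).enorm.pow_const p
          rw [lintegral_mul_const _ m0, lintegral_const_mul _ (m2.mul_const c),
            lintegral_mul_const _ m2, ← mul_assoc]
          refine mul_le_mul' ?_ le_rfl
          exact lintegral_smul_le hp0 (hM j) (hψm j) (hψ j) hPmz)
      rw [lintegral_const_mul _ g1m] at main
      refine main.trans ?_
      calc _ ≤ ENNReal.ofReal M ^ p *
            (C * ∑ e' ∈ e.powerset, pairEnergy (fun _ => squareMeasure) k p e' H) :=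
            mul_le_mul' le_rfl (ih H hH e)
        _ = (ENNReal.ofReal M ^ p * C) *
            ∑ e' ∈ e.powerset, pairEnergy (fun _ => squareMeasure) k p e' H := by ring
        _ ≤ _ := mul_le_mul' le_add_self le_rfl

/-- The line formula is applied at each vertex `pick t z` of the mixed difference. Since swapping
the pairs in `t` preserves the measure, the case `t = ∅` gives all the others. -/
theorem ae_diffZ_insert_eq_integral {e : Finset (Fin d)} {j : Fin d} (hj : j ∉ e)
    {H G : (Fin d → ℝ) → 𝕜} (hH : Measurable H) (hG : Measurable G)
    (h : IsWeakDeriv Set.univ (Pi.single j 1) H G) :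
    ∀ᵐ z ∂(Measure.pi fun _ : Fin d => squareMeasure), diffZ (insert j e) H z =
      ∫ u in (z j).2..(z j).1, diffZ e G (Function.update z j (u, 0)) := by
  have hmp := measurePreserving_arrowProdEquivProdArrow ℝ ℝ (Fin d)
    (fun _ => intervalMeasure (1 / 2)) (fun _ => intervalMeasure (1 / 2))
  have hac : (Measure.pi fun _ : Fin d => intervalMeasure (1 / 2)) ≪ volume := by
    have : (Measure.pi fun _ : Fin d => intervalMeasure (1 / 2)) =
        (volume : Measure (Fin d → ℝ)).restrict
          (Set.univ.pi fun _ => Set.Ioo (-(1 / 2) : ℝ) (1 / 2)) := by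
      rw [volume_pi, Measure.restrict_pi_pi]; rfl
    rw [this]
    exact Measure.restrict_le_self.absolutelyContinuous
  have h1 : ∀ᵐ z ∂(Measure.pi fun _ : Fin d => squareMeasure),
      H (fun i => (z i).1) - H (Function.update (fun i => (z i).1) j (z j).2) =
        (∫ u in (z j).2..(z j).1, G (Function.update (fun i => (z i).1) j u)) ∧
      ∀ a b, IntervalIntegrable (fun u => G (Function.update (fun i => (z i).1) j u))
        volume a b := by
    have h0 := (hac.prod hac).ae_le (h.ae_sub_update hH hG)
    exact hmp.quasiMeasurePreserving.ae h0
  have h2 : ∀ t : Finset (Fin d), ∀ᵐ z ∂(Measure.pi fun _ : Fin d => squareMeasure), j ∉ t →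
      H (pick t z) - H (Function.update (pick t z) j (z j).2) =
        (∫ u in (z j).2..(z j).1, G (Function.update (pick t z) j u)) ∧
      ∀ a b, IntervalIntegrable (fun u => G (Function.update (pick t z) j u)) volume a b := by
    intro t
    have := (measurePreserving_swapOn t (m := fun _ => squareMeasure)
      fun _ _ => Measure.measurePreserving_swap).quasiMeasurePreserving.ae h1
    filter_upwards [this] with z hz hjt
    rw [fst_swapOn, swapOn_apply_of_notMem hjt] at hz
    have hpj : pick t z j = (z j).1 := by simp [pick, hjt]
    exact hz
  have h3 := (ae_all_iff (ι := Finset (Fin d))).2 h2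
  filter_upwards [h3] with z hz
  have hjt : ∀ t ∈ e.powerset, j ∉ t := fun t ht h => hj (Finset.mem_powerset.1 ht h)
  rw [diffZ_insert' hj]
  have e1 : ∀ u, diffZ e G (Function.update z j (u, 0)) =
      ∑ t ∈ e.powerset, (-1 : ℤ) ^ t.card • G (Function.update (pick t z) j u) := by
    intro u
    refine Finset.sum_congr rfl fun t ht => ?_
    rw [pick_update_of_notMem (hjt t ht)]
  simp only [e1]
  rw [intervalIntegral.integral_finsetSum]
  · refine Finset.sum_congr rfl fun t ht => ?_
    rw [(hz t (hjt t ht)).1]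
    rcases neg_one_pow_eq_or ℤ t.card with hs | hs <;> simp [hs]
  · intro t ht
    have := (hz t (hjt t ht)).2 (z j).2 (z j).1
    rcases neg_one_pow_eq_or ℤ t.card with hs | hs
    · simpa [hs] using this
    · simp only [hs, neg_smul, one_smul]
      exact this.neg

/-- A fractional difference in direction `j` is controlled by one derivative in that direction:
`ae_diffZ_insert_eq_integral` produces the primitive, and `exists_lintegral_primitive_le` estimates
it in the coordinate `j`. -/
theorem exists_pairEnergy_weakDeriv_le {p σ : ℝ} (hp : 1 < p) (hσp : σ < p) :
    ∃ C : ℝ≥0∞, C ≠ ⊤ ∧ ∀ (e : Finset (Fin d)) (j : Fin d), j ∉ e →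
      ∀ H G : (Fin d → ℝ) → 𝕜, Measurable H → Measurable G →
        IsWeakDeriv Set.univ (Pi.single j 1) H G →
        pairEnergy (fun _ => squareMeasure) (powerKernel σ) p (insert j e) H ≤
          C * pairEnergy (fun _ => squareMeasure) (powerKernel σ) p e G := by
  obtain ⟨C, hC, hle⟩ := exists_lintegral_primitive_le hp hσp
  refine ⟨C, hC, fun e j hj H G hH hG h => ?_⟩
  have hp0 : 0 < p := by linarith
  have hk := measurable_powerKernel σ
  set k := powerKernel σ with hkdef
  let S : (Fin d → ℝ × ℝ) → ℝ≥0∞ := fun z =>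
    ∫⁻ u in Set.uIoc (z j).2 (z j).1, ‖diffZ e G (Function.update z j (u, 0))‖ₑ
  have hupd : Measurable fun q : (Fin d → ℝ × ℝ) × ℝ => Function.update q.1 j (q.2, (0 : ℝ)) := by
    refine measurable_pi_lambda _ fun i => ?_
    by_cases hi : i = j
    · subst hi
      simpa using measurable_snd.prodMk measurable_const
    · simp only [Function.update_of_ne hi]
      exact (measurable_pi_apply i).comp measurable_fst
  have hSm : Measurable S := by
    let A : Set ((Fin d → ℝ × ℝ) × ℝ) := {q | q.2 ∈ Set.uIoc (q.1 j).2 (q.1 j).1}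
    have hA : MeasurableSet A := by
      have : A = {q | min (q.1 j).2 (q.1 j).1 < q.2} ∩ {q | q.2 ≤ max (q.1 j).2 (q.1 j).1} := rfl
      rw [this]
      exact (measurableSet_lt (by fun_prop) (by fun_prop)).inter
        (measurableSet_le (by fun_prop) (by fun_prop))
    have := Measurable.lintegral_prod_right' (ν := volume)
      (((measurable_diffZ e hG).comp hupd).enorm.indicator hA)
    convert this using 2 with z
    simp only [S]
    rw [← lintegral_indicator measurableSet_uIoc]
    rfl
  have step1 : pairEnergy (fun _ => squareMeasure) k p (insert j e) H ≤
      ∫⁻ z, S z ^ p * ∏ i ∈ insert j e, k (z i).1 (z i).2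
        ∂(Measure.pi fun _ : Fin d => squareMeasure) := by
    refine lintegral_mono_ae ?_
    filter_upwards [ae_diffZ_insert_eq_integral hj hH hG h] with z hz
    gcongr
    rw [hz, ← ofReal_norm, intervalIntegral.norm_intervalIntegral_eq, ofReal_norm]
    exact enorm_integral_le_lintegral_enorm _
  refine step1.trans ?_
  have g1m := measurable_energy_density hk p e hG
  have hkm : Measurable fun z : Fin d → ℝ × ℝ => ∏ i ∈ insert j e, k (z i).1 (z i).2 :=
    Finset.measurable_fun_prod _ fun i _ => hk.comp (measurable_pi_apply i)
  have main := lintegral_pi_le_of_coord (μ := fun _ : Fin d => squareMeasure)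
    (μ' := fun _ => squareMeasure) j (fun _ _ => rfl) ((hSm.pow_const p).mul hkm)
    (f' := fun z => C * (‖diffZ e G z‖ₑ ^ p * ∏ i ∈ e, k (z i).1 (z i).2)) (g1m.const_mul _)
    (fun z => by
      set P : ℝ → ℝ≥0∞ := fun u => ‖diffZ e G (Function.update z j (u, 0))‖ₑ with hP
      have hPm : Measurable P := ((measurable_diffZ e hG).comp ((measurable_update z).comp
        (measurable_id.prodMk measurable_const))).enorm
      set c : ℝ≥0∞ := ∏ i ∈ e, k (z i).1 (z i).2 with hcdef
      have hc : ∀ w : ℝ × ℝ,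
          ∏ i ∈ e, k (Function.update z j w i).1 (Function.update z j w i).2 = c := by
        intro w
        refine Finset.prod_congr rfl fun i hi => ?_
        have : i ≠ j := fun h => hj (h ▸ hi)
        simp [this]
      have e1 : ∀ w : ℝ × ℝ, S (Function.update z j w) ^ p *
          ∏ i ∈ insert j e, k (Function.update z j w i).1 (Function.update z j w i).2 =
          ((∫⁻ u in Set.uIoc w.2 w.1, P u) ^ p * k w.1 w.2) * c := by
        intro w
        rw [Finset.prod_insert hj, hc]
        simp only [S, Function.update_self, Function.update_idem, mul_assoc]
        rfl
      have e3 : ∀ w : ℝ × ℝ, ‖diffZ e G (Function.update z j w)‖ₑ ^ p *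
          ∏ i ∈ e, k (Function.update z j w i).1 (Function.update z j w i).2 =
          P w.1 ^ p * c := by
        intro w
        rw [hc, diffZ_update_of_notMem hj]
      simp only [Pi.mul_apply, e1, e3]
      have m0 : Measurable fun w : ℝ × ℝ => (∫⁻ u in Set.uIoc w.2 w.1, P u) ^ p * k w.1 w.2 := by
        refine Measurable.mul (Measurable.pow_const ?_ p) hk
        let A : Set ((ℝ × ℝ) × ℝ) := {q | q.2 ∈ Set.uIoc q.1.2 q.1.1}
        have hA : MeasurableSet A := by
          have : A = {q | min q.1.2 q.1.1 < q.2} ∩ {q | q.2 ≤ max q.1.2 q.1.1} := rfl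
          rw [this]
          exact (measurableSet_lt (by fun_prop) (by fun_prop)).inter
            (measurableSet_le (by fun_prop) (by fun_prop))
        have := Measurable.lintegral_prod_right' (ν := volume)
          ((hPm.comp (measurable_snd (α := ℝ × ℝ))).indicator hA)
        convert this using 2 with w
        rw [← lintegral_indicator measurableSet_uIoc]
        rfl
      have m2 : Measurable fun w : ℝ × ℝ => P w.1 ^ p := (hPm.comp measurable_fst).pow_const p
      rw [lintegral_mul_const _ m0, lintegral_const_mul _ (m2.mul_const c),
        lintegral_mul_const _ m2, ← mul_assoc]
      exact mul_le_mul' (hle P hPm) le_rfl)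
  rw [lintegral_const_mul _ g1m] at main
  exact main

end Tensor

/-! ### Comparison of the Gaussian and the Lebesgue quantities near a point -/

section Gaussian

theorem gaussianPDF_zero_one (x : ℝ) :
    gaussianPDF 0 1 x = ENNReal.ofReal ((√(2 * Real.pi))⁻¹ * Real.exp (-x ^ 2 / 2)) := by
  simp [gaussianPDF, gaussianPDFReal]

theorem map_add_intervalMeasure (c : ℝ) :
    (intervalMeasure (1 / 2)).map (fun x => x + c) =
      volume.restrict (Set.Ioo (c - 1 / 2) (c + 1 / 2)) := by
  have h := (measurePreserving_add_right (volume : Measure ℝ) c).restrict_preimage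
    (s := Set.Ioo (c - 1 / 2) (c + 1 / 2)) measurableSet_Ioo
  have e : (fun x => x + c) ⁻¹' Set.Ioo (c - 1 / 2) (c + 1 / 2) =
      Set.Ioo (-(1 / 2) : ℝ) (1 / 2) := by
    ext x
    simp only [Set.mem_preimage, Set.mem_Ioo]
    constructor <;> rintro ⟨h1, h2⟩ <;> constructor <;> linarith
  rw [e] at h
  exact h.map_eq

/-- On the shifted interval `|x| ≤ |c| + 1/2`, which bounds the Gaussian density from below. -/
theorem map_add_intervalMeasure_le (c : ℝ) :
    (intervalMeasure (1 / 2)).map (fun x => x + c) ≤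
      ENNReal.ofReal (√(2 * Real.pi) * Real.exp ((|c| + 1 / 2) ^ 2 / 2)) • gaussianReal 0 1 := by
  rw [map_add_intervalMeasure, gaussianReal_of_var_ne_zero 0 one_ne_zero,
    ← withDensity_smul _ (measurable_gaussianPDF 0 1), ← withDensity_indicator_one measurableSet_Ioo]
  refine withDensity_mono (Filter.Eventually.of_forall fun x => ?_)
  by_cases hx : x ∈ Set.Ioo (c - 1 / 2) (c + 1 / 2)
  · have hpi : 0 < √(2 * Real.pi) := Real.sqrt_pos.2 (by positivity)
    rw [Set.indicator_of_mem hx, Pi.smul_apply, gaussianPDF_zero_one, smul_eq_mul,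
      ← ENNReal.ofReal_mul (by positivity), Pi.one_apply, ← ENNReal.ofReal_one]
    refine ENNReal.ofReal_le_ofReal ?_
    have e1 : √(2 * Real.pi) * Real.exp ((|c| + 1 / 2) ^ 2 / 2) *
        ((√(2 * Real.pi))⁻¹ * Real.exp (-x ^ 2 / 2)) =
        Real.exp ((|c| + 1 / 2) ^ 2 / 2 + -x ^ 2 / 2) := by
      rw [Real.exp_add]
      field_simp
    rw [e1]
    refine Real.one_le_exp ?_
    have hx' : |x| ≤ |c| + 1 / 2 := by
      have : |x - c| ≤ 1 / 2 := abs_le.2 ⟨by linarith [hx.1], by linarith [hx.2]⟩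
      calc |x| = |c + (x - c)| := by ring_nf
        _ ≤ |c| + |x - c| := abs_add_le _ _
        _ ≤ _ := by linarith
    have : x ^ 2 ≤ (|c| + 1 / 2) ^ 2 := by
      rw [← sq_abs x]
      exact pow_le_pow_left₀ (abs_nonneg x) hx' 2
    linarith
  · rw [Set.indicator_of_notMem hx]
    exact zero_le

/-- The opposite comparison, giving the decay of tile masses: `|x - c| ≤ 1/4` implies `x² ≥ c² -
|c|`. -/
theorem map_sub_gaussianReal_le (c : ℝ) :
    ((gaussianReal 0 1).restrict (Set.Ico (c - 1 / 4) (c + 1 / 4))).map (fun x => x - c) ≤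
      ENNReal.ofReal (Real.exp (-(c ^ 2 - |c|) / 2)) • intervalMeasure (1 / 2) := by
  have hI : (intervalMeasure (1 / 2)) =
      (volume.restrict (Set.Ioo (c - 1 / 2) (c + 1 / 2))).map (fun x => x - c) := by
    rw [← map_add_intervalMeasure, Measure.map_map (by fun_prop) (by fun_prop)]
    have : ((fun x : ℝ => x - c) ∘ fun x => x + c) = id := by funext x; simp
    rw [this, Measure.map_id]
  rw [hI, ← Measure.map_smul]
  refine Measure.map_mono ?_ (by fun_prop)
  rw [gaussianReal_of_var_ne_zero 0 one_ne_zero, restrict_withDensity measurableSet_Ico,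
    ← withDensity_indicator measurableSet_Ico,
    ← withDensity_indicator_one measurableSet_Ioo, ← withDensity_smul _
      (measurable_one.indicator measurableSet_Ioo)]
  refine withDensity_mono (Filter.Eventually.of_forall fun x => ?_)
  by_cases hx : x ∈ Set.Ico (c - 1 / 4) (c + 1 / 4)
  · have hx2 : x ∈ Set.Ioo (c - 1 / 2) (c + 1 / 2) :=
      ⟨by linarith [hx.1], by linarith [hx.2]⟩
    rw [Set.indicator_of_mem hx, Pi.smul_apply, Set.indicator_of_mem hx2, gaussianPDF_zero_one,
      smul_eq_mul, Pi.one_apply, mul_one]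
    refine ENNReal.ofReal_le_ofReal ?_
    have h1 : (√(2 * Real.pi))⁻¹ ≤ 1 := by
      refine inv_le_one_of_one_le₀ ?_
      rw [Real.one_le_sqrt]
      linarith [Real.pi_gt_three]
    have h2 : Real.exp (-x ^ 2 / 2) ≤ Real.exp (-(c ^ 2 - |c|) / 2) := by
      refine Real.exp_le_exp.2 ?_
      have hc : |x - c| ≤ 1 / 4 := abs_le.2 ⟨by linarith [hx.1], by linarith [hx.2]⟩
      have h3 : |c * (x - c)| ≤ |c| * (1 / 4) := by
        rw [abs_mul]
        exact mul_le_mul_of_nonneg_left hc (abs_nonneg c)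
      have h4 := neg_abs_le (c * (x - c))
      nlinarith [sq_nonneg (x - c), abs_nonneg c]
    calc _ ≤ 1 * Real.exp (-(c ^ 2 - |c|) / 2) :=
          mul_le_mul h1 h2 (Real.exp_nonneg _) zero_le_one
      _ = _ := one_mul _
  · rw [Set.indicator_of_notMem hx]
    exact zero_le

/-- With `ρ = e^{-t}`, the exponent is `-ρ²(u-v)²/(2(1-ρ²)) + ρ/(1+ρ) · uv`. In the window for `t`,
`1 - ρ²` is comparable to `(u-v)²`: this bounds the first term by `3/(2ε)` in absolute value and
makes the prefactor at least a constant times `|u-v|^{-1}`. In the second term `θ ≤ ρ/(1+ρ) ≤ 1/2`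
and `uv ≥ (|c| - 1/2)² - 1/2`. -/
theorem mehler_lower_bound {θ ε : ℝ} (hε0 : 0 < ε) (hε1 : ε ≤ 1)
    (hθ : θ ≤ Real.exp (-ε) / (1 + Real.exp (-ε))) {c u v t : ℝ}
    (hu : |u - c| ≤ 1 / 2) (hv : |v - c| ≤ 1 / 2) (huv : u ≠ v)
    (ht1 : ε * (u - v) ^ 2 / 2 ≤ t) (ht2 : t ≤ ε * (u - v) ^ 2) :
    (2 : ℝ) ^ (-(1 / 2) : ℝ) * |u - v| ^ (-1 : ℝ) *
      Real.exp (-(3 / (2 * ε)) - 1 / 4 + θ * (|c| - 1 / 2) ^ 2) ≤ mehler t u v := by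
  have hδ : 0 < |u - v| := abs_pos.2 (sub_ne_zero.2 huv)
  have hδ2 : 0 < (u - v) ^ 2 := by rw [← sq_abs]; positivity
  have hδ1 : (u - v) ^ 2 ≤ 1 := by
    rw [← sq_abs]
    refine pow_le_one₀ hδ.le ?_
    calc |u - v| = |(u - c) - (v - c)| := by ring_nf
      _ ≤ |u - c| + |v - c| := abs_sub _ _
      _ ≤ 1 := by linarith
  have ht0 : 0 < t := lt_of_lt_of_le (by positivity) ht1
  have htε : t ≤ ε := ht2.trans (by nlinarith)
  set ρ := Real.exp (-t) with hρ
  have hρ2 : Real.exp (-2 * t) = ρ ^ 2 := by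
    rw [hρ, ← Real.exp_nat_mul]; congr 1; push_cast; ring
  have hρ0 : 0 < ρ := Real.exp_pos _
  have hρ1 : ρ < 1 := by rw [hρ, Real.exp_lt_one_iff]; linarith
  have hρε : Real.exp (-ε) ≤ ρ := Real.exp_le_exp.2 (by linarith)
  have hD0 : 0 < 1 - ρ ^ 2 := by nlinarith
  have hDle : 1 - ρ ^ 2 ≤ 2 * (u - v) ^ 2 := by
    have := Real.add_one_le_exp (-2 * t)
    rw [hρ2] at this
    nlinarith
  have hDge : 2 * t / 3 ≤ 1 - ρ ^ 2 := by
    have h1 := Real.add_one_le_exp (2 * t)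
    have h2 : ρ ^ 2 * Real.exp (2 * t) = 1 := by
      rw [← hρ2, ← Real.exp_add]; simp
    have h3 : ρ ^ 2 * (2 * t + 1) ≤ 1 :=
      (mul_le_mul_of_nonneg_left h1 (sq_nonneg ρ)).trans h2.le
    nlinarith
  have hη : θ ≤ ρ / (1 + ρ) := by
    refine hθ.trans ?_
    have := Real.exp_pos (-ε)
    rw [div_le_div_iff₀ (by positivity) (by positivity)]
    nlinarith
  have hη2 : ρ / (1 + ρ) ≤ 1 / 2 := by
    rw [div_le_div_iff₀ (by positivity) (by positivity)]
    nlinarith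
  have hX : (|c| - 1 / 2) ^ 2 - 1 / 2 ≤ u * v := by
    have hu' := abs_le.1 hu
    have hv' := abs_le.1 hv
    have h1 : |c * ((u - c) + (v - c))| ≤ |c| * 1 := by
      rw [abs_mul]
      exact mul_le_mul_of_nonneg_left (abs_le.2 ⟨by linarith, by linarith⟩) (abs_nonneg c)
    have h2 := (abs_le.1 h1).1
    have h3 : |(u - c) * (v - c)| ≤ 1 / 2 * (1 / 2) := by
      rw [abs_mul]
      exact mul_le_mul hu hv (abs_nonneg _) (by norm_num)
    have h4 := (abs_le.1 h3).1
    nlinarith [sq_abs c]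
  have hexp : -(3 / (2 * ε)) - 1 / 4 + θ * (|c| - 1 / 2) ^ 2 ≤
      -(ρ ^ 2 * u ^ 2 - 2 * ρ * (u * v) + ρ ^ 2 * v ^ 2) / (2 * (1 - ρ ^ 2)) := by
    have e1 : -(ρ ^ 2 * u ^ 2 - 2 * ρ * (u * v) + ρ ^ 2 * v ^ 2) / (2 * (1 - ρ ^ 2)) =
        -(ρ ^ 2 * (u - v) ^ 2 / (2 * (1 - ρ ^ 2))) + ρ / (1 + ρ) * (u * v) := by
      have h1 : 1 - ρ ≠ 0 := by linarith
      have h2 : 1 + ρ ≠ 0 := by positivity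
      have h3 : 1 - ρ ^ 2 = (1 - ρ) * (1 + ρ) := by ring
      rw [h3]
      field_simp
      ring
    have e2 : ρ ^ 2 * (u - v) ^ 2 / (2 * (1 - ρ ^ 2)) ≤ 3 / (2 * ε) := by
      rw [div_le_div_iff₀ (by positivity) (by positivity)]
      have : ρ ^ 2 ≤ 1 := by linarith
      have h5 : ρ ^ 2 * (u - v) ^ 2 ≤ (u - v) ^ 2 := by nlinarith
      nlinarith
    have e3 : θ * (|c| - 1 / 2) ^ 2 - 1 / 4 ≤ ρ / (1 + ρ) * (u * v) := by
      have h0 : 0 ≤ ρ / (1 + ρ) := by positivity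
      have h1 := mul_le_mul_of_nonneg_left hX h0
      have h2 := mul_le_mul_of_nonneg_right hη (sq_nonneg (|c| - 1 / 2))
      nlinarith
    rw [e1]
    linarith
  have hpre : (2 : ℝ) ^ (-(1 / 2) : ℝ) * |u - v| ^ (-1 : ℝ) ≤
      1 / (1 - ρ ^ 2) ^ (1 / 2 : ℝ) := by
    have e1 : (2 : ℝ) ^ (-(1 / 2) : ℝ) * |u - v| ^ (-1 : ℝ) =
        (2 * (u - v) ^ 2) ^ (-(1 / 2) : ℝ) := by
      rw [Real.mul_rpow (by norm_num) hδ2.le, ← sq_abs (u - v), ← Real.rpow_natCast,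
        ← Real.rpow_mul hδ.le]
      norm_num
    rw [e1, one_div ((1 - ρ ^ 2) ^ (1 / 2 : ℝ)), ← Real.rpow_neg hD0.le]
    exact Real.rpow_le_rpow_of_nonpos hD0 hDle (by norm_num)
  rw [mehler, hρ2]
  exact mul_le_mul hpre (Real.exp_le_exp.2 hexp) (Real.exp_nonneg _) (by positivity)

/-- Restrict the integral defining `K_σ` to `ε(u-v)²/2 ≤ t ≤ ε(u-v)²`. The window has length of
order `|u-v|²`, `t^{-(σ/2+1)}` is at least `|u-v|^{-(σ+2)}`, and `mehler_lower_bound` supplies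
`|u-v|^{-1}` and the Gaussian gain; the powers combine to `|u-v|^{-1-σ}`. A small `ε` exists because
`ρ/(1+ρ) → 1/2` as `ρ → 1`. -/
theorem exists_powerKernel_le_ouKernel {θ : ℝ} (hθ : θ < 1 / 2) {σ : ℝ} (hσ : 0 < σ) :
    ∃ C : ℝ, 0 < C ∧ ∀ c u v : ℝ, |u - c| ≤ 1 / 2 → |v - c| ≤ 1 / 2 →
      powerKernel σ u v ≤
        ENNReal.ofReal (C * Real.exp (-(θ * (|c| - 1 / 2) ^ 2))) * ouKernel σ u v := by
  obtain ⟨ε, hεθ, hε0, hε1⟩ : ∃ ε : ℝ, θ < Real.exp (-ε) / (1 + Real.exp (-ε)) ∧ 0 < ε ∧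
      ε ≤ 1 := by
    have hcont : Continuous fun ε : ℝ => Real.exp (-ε) / (1 + Real.exp (-ε)) :=
      Continuous.div (by fun_prop) (by fun_prop) fun ε => by positivity
    have h0 : θ < (fun ε : ℝ => Real.exp (-ε) / (1 + Real.exp (-ε))) 0 := by
      norm_num
      linarith
    have h1 : ∀ᶠ ε in nhdsWithin (0 : ℝ) (Set.Ioi 0),
        θ < Real.exp (-ε) / (1 + Real.exp (-ε)) :=
      nhdsWithin_le_nhds (hcont.continuousAt.eventually_const_lt h0)
    have h2 : ∀ᶠ ε in nhdsWithin (0 : ℝ) (Set.Ioi 0), ε ∈ Set.Ioc (0 : ℝ) 1 :=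
      Ioc_mem_nhdsGT one_pos
    obtain ⟨ε, h3, h4⟩ := (h1.and h2).exists
    exact ⟨ε, h3, h4.1, h4.2⟩
  set B : ℝ := ε / 2 * (2 : ℝ) ^ (-(1 / 2) : ℝ) * Real.exp (-(3 / (2 * ε)) - 1 / 4) with hB
  have hB0 : 0 < B := by positivity
  refine ⟨B⁻¹, inv_pos.2 hB0, fun c u v hu hv => ?_⟩
  -- On the diagonal `powerKernel` is `0`, by the convention for division by zero.
  by_cases huv : u = v
  · have h1 : (1 + σ) ≠ 0 := by positivity
    simp [powerKernel, huv, Real.zero_rpow h1]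
  have hδ : 0 < |u - v| := abs_pos.2 (sub_ne_zero.2 huv)
  have hδ2 : 0 < (u - v) ^ 2 := by rw [← sq_abs]; positivity
  set X := θ * (|c| - 1 / 2) ^ 2 with hX
  set m : ℝ := (2 : ℝ) ^ (-(1 / 2) : ℝ) * |u - v| ^ (-1 : ℝ) *
      Real.exp (-(3 / (2 * ε)) - 1 / 4 + X) * |u - v| ^ (-(σ + 2)) with hm
  have hm0 : 0 < m := by positivity
  have h1 : ENNReal.ofReal (m * (ε * (u - v) ^ 2 / 2)) ≤ ouKernel σ u v := by
    have hsub : Set.Icc (ε * (u - v) ^ 2 / 2) (ε * (u - v) ^ 2) ⊆ Set.Ioi 0 := fun t ht =>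
      lt_of_lt_of_le (by positivity) ht.1
    calc ENNReal.ofReal (m * (ε * (u - v) ^ 2 / 2))
        = ∫⁻ t in Set.Icc (ε * (u - v) ^ 2 / 2) (ε * (u - v) ^ 2), ENNReal.ofReal m := by
          rw [setLIntegral_const, Real.volume_Icc, ← ENNReal.ofReal_mul hm0.le]
          congr 2
          ring
      _ ≤ ∫⁻ t in Set.Icc (ε * (u - v) ^ 2 / 2) (ε * (u - v) ^ 2),
            ENNReal.ofReal (mehler t u v / t ^ (σ / 2 + 1)) := by
          refine setLIntegral_mono' measurableSet_Icc fun t ht => ENNReal.ofReal_le_ofReal ?_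
          have ht0 : 0 < t := hsub ht
          have h2 := mehler_lower_bound hε0 hε1 hεθ.le hu hv huv ht.1 ht.2
          rw [hm, div_eq_mul_inv (mehler t u v), ← Real.rpow_neg ht0.le]
          refine mul_le_mul h2 ?_ (by positivity) (le_trans (by positivity) h2)
          have e1 : |u - v| ^ (-(σ + 2)) = ((u - v) ^ 2) ^ (-(σ / 2 + 1)) := by
            rw [← sq_abs (u - v), ← Real.rpow_natCast, ← Real.rpow_mul hδ.le]
            congr 1
            push_cast
            ring
          rw [e1]
          refine Real.rpow_le_rpow_of_nonpos ht0 (ht.2.trans ?_) (by linarith)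
          nlinarith
      _ ≤ _ := lintegral_mono_set hsub
  calc powerKernel σ u v = ENNReal.ofReal (B⁻¹ * Real.exp (-X)) *
        ENNReal.ofReal (m * (ε * (u - v) ^ 2 / 2)) := by
        rw [powerKernel, ← ENNReal.ofReal_mul (by positivity)]
        congr 1
        have e2 : |u - v| ^ (-(1 + σ)) =
            |u - v| ^ (-1 : ℝ) * |u - v| ^ (-(σ + 2)) * (u - v) ^ 2 := by
          rw [← sq_abs (u - v), ← Real.rpow_natCast, ← Real.rpow_add hδ, ← Real.rpow_add hδ]
          congr 1
          push_cast
          ring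
        rw [one_div, ← Real.rpow_neg hδ.le, e2, hm, Real.exp_add, Real.exp_neg X]
        have h3 := (Real.exp_pos X).ne'
        have h4 : B⁻¹ * (ε / 2 * (2 : ℝ) ^ (-(1 / 2) : ℝ) * Real.exp (-(3 / (2 * ε)) - 1 / 4)) = 1 :=
          inv_mul_cancel₀ hB0.ne'
        have h5 : (Real.exp X)⁻¹ * Real.exp X = 1 := inv_mul_cancel₀ h3
        linear_combination (-(|u - v| ^ (-1 : ℝ) * |u - v| ^ (-(σ + 2)) * (u - v) ^ 2) *
          ((Real.exp X)⁻¹ * Real.exp X)) * h4 -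
          (|u - v| ^ (-1 : ℝ) * |u - v| ^ (-(σ + 2)) * (u - v) ^ 2) * h5
    _ ≤ _ := by gcongr

/-! ### Transfer of energies from Gaussian measure to the unit cube -/

variable {d : ℕ} {𝕜 : Type*} [RCLike 𝕜]

theorem map_add_pi_intervalMeasure_le (ι : Type*) [Fintype ι] (c : ι → ℝ) :
    (Measure.pi fun _ : ι => intervalMeasure (1 / 2)).map (fun x => x + c) ≤
      (∏ j, ENNReal.ofReal (√(2 * Real.pi) * Real.exp ((|c j| + 1 / 2) ^ 2 / 2))) •
        Measure.pi fun _ : ι => gaussianReal 0 1 := by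
  have hs : ∀ j, SigmaFinite ((intervalMeasure (1 / 2)).map (fun x => x + c j)) := fun j => by
    have : IsFiniteMeasure ((intervalMeasure (1 / 2)).map (fun x => x + c j)) :=
      Measure.isFiniteMeasure_map _ _
    infer_instance
  have h1 := Measure.pi_map_pi (μ := fun _ : ι => intervalMeasure (1 / 2))
    (f := fun j x => x + c j) (fun j => by fun_prop)
  have h2 := pi_le_smul_pi (fun j => map_add_intervalMeasure_le (c j))
  rw [← h1] at h2
  exact h2

theorem lintegral_add_pi_le (ι : Type*) [Fintype ι] (c : ι → ℝ) (f : (ι → ℝ) → ℝ≥0∞) :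
    ∫⁻ x, f (x + c) ∂(Measure.pi fun _ : ι => intervalMeasure (1 / 2)) ≤
      (∏ j, ENNReal.ofReal (√(2 * Real.pi) * Real.exp ((|c j| + 1 / 2) ^ 2 / 2))) *
        ∫⁻ x, f x ∂(Measure.pi fun _ : ι => gaussianReal 0 1) := by
  have h1 := lintegral_map_equiv f (MeasurableEquiv.addRight c)
    (μ := Measure.pi fun _ : ι => intervalMeasure (1 / 2))
  have h2 : ∫⁻ x, f (x + c) ∂(Measure.pi fun _ : ι => intervalMeasure (1 / 2)) =
      ∫⁻ x, f x ∂((Measure.pi fun _ : ι => intervalMeasure (1 / 2)).map (fun x => x + c)) :=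
    h1.symm
  rw [h2, ← smul_eq_mul, ← lintegral_smul_measure]
  exact lintegral_mono' (map_add_pi_intervalMeasure_le ι c) le_rfl

theorem ae_pi_intervalMeasure_abs_le (ι : Type*) [Fintype ι] :
    ∀ᵐ x ∂(Measure.pi fun _ : ι => intervalMeasure (1 / 2)), ∀ j, |x j| ≤ 1 / 2 := by
  rw [ae_all_iff]
  intro j
  have h : ∀ᵐ t ∂(intervalMeasure (1 / 2)), |t| ≤ 1 / 2 := by
    filter_upwards [ae_restrict_mem measurableSet_Ioo] with t ht
    exact abs_le.2 ⟨ht.1.le, ht.2.le⟩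
  exact (Measure.quasiMeasurePreserving_eval (fun _ : ι => intervalMeasure (1 / 2)) j).ae h

theorem mixedDiff_comp_add (e : Finset (Fin d)) (y : e → ℝ) (H : (Fin d → ℝ) → 𝕜)
    (c x : Fin d → ℝ) :
    mixedDiff e (extendCoords e y) (fun x => H (x + c)) x =
      mixedDiff e (extendCoords e (y + fun j : e => c j)) H (x + c) := by
  refine Finset.sum_congr rfl fun t ht => ?_
  have h : replaceCoords t (extendCoords e y) x + c =
      replaceCoords t (extendCoords e (y + fun j : e => c j)) (x + c) := by
    funext j
    by_cases hj : j ∈ t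
    · have hje : j ∈ e := Finset.mem_powerset.1 ht hj
      simp [replaceCoords, hj, extendCoords, hje]
    · simp [replaceCoords, hj]
  simp only [h]

/-- The growth of the local comparison constants. -/
noncomputable def growth (A θ : ℝ) (c : Fin d → ℝ) : ℝ :=
  ∏ j, (A * Real.exp ((1 - θ) * c j ^ 2 + 2 * |c j|))

/-- The comparisons of measures and kernels are multiplied over the coordinates. Since `θ < 1/2`,
the integer-order cost `exp(c²/2)` is absorbed in `exp((1-θ)c²)`, so one function `growth` serves
every `e`, including `e = ∅`. -/
theorem exists_semiIntegral_comp_add_le {θ : ℝ} (hθ0 : 0 ≤ θ) (hθ : θ < 1 / 2) {σ : ℝ}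
    (hσ : 0 < σ) :
    ∃ A : ℝ, 0 < A ∧ ∀ (c : Fin d → ℝ) (p : ℝ) (e : Finset (Fin d)) (H : (Fin d → ℝ) → 𝕜),
      semiIntegral (intervalMeasure (1 / 2)) (powerKernel σ) p e (fun x => H (x + c)) ≤
        ENNReal.ofReal (growth A θ c) * semiIntegral (gaussianReal 0 1) (ouKernel σ) p e H := by
  obtain ⟨C, hC, hK⟩ := exists_powerKernel_le_ouKernel hθ hσ
  set w : ℝ → ℝ := fun c => √(2 * Real.pi) * Real.exp ((|c| + 1 / 2) ^ 2 / 2) with hw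
  set κ : ℝ → ℝ := fun c => C * Real.exp (-(θ * (|c| - 1 / 2) ^ 2)) with hκ
  have hpi : 0 < √(2 * Real.pi) := Real.sqrt_pos.2 (by positivity)
  have hw0 : ∀ c, 0 < w c := fun c => by positivity
  have hκ0 : ∀ c, 0 < κ c := fun c => by positivity
  set A1 : ℝ := √(2 * Real.pi) * Real.exp (1 / 8) with hA1
  set A2 : ℝ := √(2 * Real.pi) * √(2 * Real.pi) * C * Real.exp (1 / 4) with hA2
  have hA1p : 0 < A1 := by positivity
  have hA2p : 0 < A2 := by positivity
  refine ⟨A1 + A2, by positivity, fun c p e H => ?_⟩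
  -- A coordinate outside `e` carries one inverse density `w`; a coordinate in `e` carries `w` for
  -- `x_j`, `w` for `y_j` and the kernel factor `κ`.
  have hb1 : ∀ x, w x ≤ (A1 + A2) * Real.exp ((1 - θ) * x ^ 2 + 2 * |x|) := by
    intro x
    have : w x ≤ A1 * Real.exp ((1 - θ) * x ^ 2 + 2 * |x|) := by
      rw [hw, hA1, mul_assoc, ← Real.exp_add]
      refine mul_le_mul_of_nonneg_left (Real.exp_le_exp.2 ?_) hpi.le
      nlinarith [abs_nonneg x, sq_abs x, sq_nonneg x]
    refine this.trans (mul_le_mul_of_nonneg_right ?_ (Real.exp_nonneg _))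
    linarith
  have hb2 : ∀ x, w x * (w x * κ x) ≤ (A1 + A2) * Real.exp ((1 - θ) * x ^ 2 + 2 * |x|) := by
    intro x
    have : w x * (w x * κ x) ≤ A2 * Real.exp ((1 - θ) * x ^ 2 + 2 * |x|) := by
      have e1 : w x * (w x * κ x) = √(2 * Real.pi) * √(2 * Real.pi) * C *
          Real.exp ((|x| + 1 / 2) ^ 2 / 2 + ((|x| + 1 / 2) ^ 2 / 2 +
            -(θ * (|x| - 1 / 2) ^ 2))) := by
        rw [Real.exp_add, Real.exp_add]
        simp only [hw, hκ]
        ring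
      rw [e1, hA2, mul_assoc _ (Real.exp (1 / 4)), ← Real.exp_add]
      refine mul_le_mul_of_nonneg_left (Real.exp_le_exp.2 ?_) (by positivity)
      nlinarith [abs_nonneg x, sq_abs x, sq_nonneg x, mul_nonneg hθ0 (abs_nonneg x),
        mul_nonneg (sub_nonneg.2 hθ.le) (abs_nonneg x)]
    refine this.trans (mul_le_mul_of_nonneg_right ?_ (Real.exp_nonneg _))
    linarith
  set Ψ : (e → ℝ) → (Fin d → ℝ) → ℝ≥0∞ := fun y x =>
    ‖mixedDiff e (extendCoords e y) H x‖ₑ ^ p * ∏ j : e, ouKernel σ (x j) (y j) with hΨ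
  have h1 : semiIntegral (intervalMeasure (1 / 2)) (powerKernel σ) p e (fun x => H (x + c)) ≤
      ∫⁻ y : e → ℝ, ∫⁻ x : Fin d → ℝ,
        (∏ j : e, ENNReal.ofReal (κ (c j))) * Ψ (y + fun j : e => c j) (x + c)
        ∂(Measure.pi fun _ => intervalMeasure (1 / 2))
        ∂(Measure.pi fun _ : e => intervalMeasure (1 / 2)) := by
    refine lintegral_mono_ae ?_
    filter_upwards [ae_pi_intervalMeasure_abs_le e] with y hy
    refine lintegral_mono_ae ?_
    filter_upwards [ae_pi_intervalMeasure_abs_le (Fin d)] with x hx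
    rw [mixedDiff_comp_add]
    simp only [hΨ]
    rw [mul_left_comm]
    refine mul_le_mul' le_rfl ?_
    rw [← Finset.prod_mul_distrib]
    refine Finset.prod_le_prod' fun j _ => ?_
    have e1 : powerKernel σ (x j) (y j) = powerKernel σ ((x + c) j) ((y + fun j : e => c j) j) := by
      simp [powerKernel]
    rw [e1]
    exact hK (c j) _ _ (by simpa using hx j) (by simpa using hy j)
  refine h1.trans ?_
  have hκt : (∏ j : e, ENNReal.ofReal (κ (c j))) ≠ ⊤ :=
    ENNReal.prod_ne_top fun _ _ => ENNReal.ofReal_ne_top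
  have hwt : (∏ j, ENNReal.ofReal (w (c j))) ≠ ⊤ :=
    ENNReal.prod_ne_top fun _ _ => ENNReal.ofReal_ne_top
  calc _ = (∏ j : e, ENNReal.ofReal (κ (c j))) * ∫⁻ y : e → ℝ, ∫⁻ x : Fin d → ℝ,
          Ψ (y + fun j : e => c j) (x + c) ∂(Measure.pi fun _ => intervalMeasure (1 / 2))
          ∂(Measure.pi fun _ : e => intervalMeasure (1 / 2)) := by
        rw [← lintegral_const_mul' _ _ hκt]
        refine lintegral_congr fun y => ?_
        rw [lintegral_const_mul' _ _ hκt]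
    _ ≤ (∏ j : e, ENNReal.ofReal (κ (c j))) * ∫⁻ y : e → ℝ, (∏ j, ENNReal.ofReal (w (c j))) *
          ∫⁻ x : Fin d → ℝ, Ψ (y + fun j : e => c j) x ∂(Measure.pi fun _ => gaussianReal 0 1)
          ∂(Measure.pi fun _ : e => intervalMeasure (1 / 2)) := by
        gcongr with y
        exact lintegral_add_pi_le (Fin d) c _
    _ = (∏ j : e, ENNReal.ofReal (κ (c j))) * ((∏ j, ENNReal.ofReal (w (c j))) * ∫⁻ y : e → ℝ,
          ∫⁻ x : Fin d → ℝ, Ψ (y + fun j : e => c j) x ∂(Measure.pi fun _ => gaussianReal 0 1)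
          ∂(Measure.pi fun _ : e => intervalMeasure (1 / 2))) := by
        rw [lintegral_const_mul' _ _ hwt]
    _ ≤ (∏ j : e, ENNReal.ofReal (κ (c j))) * ((∏ j, ENNReal.ofReal (w (c j))) *
          ((∏ j : e, ENNReal.ofReal (w (c j))) *
            semiIntegral (gaussianReal 0 1) (ouKernel σ) p e H)) := by
        gcongr
        exact lintegral_add_pi_le e (fun j : e => c j) (fun y => ∫⁻ x : Fin d → ℝ, Ψ y x
          ∂(Measure.pi fun _ => gaussianReal 0 1))
    _ = ((∏ j, ENNReal.ofReal (w (c j))) * ∏ j : e, (ENNReal.ofReal (w (c j)) *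
          ENNReal.ofReal (κ (c j)))) *
            semiIntegral (gaussianReal 0 1) (ouKernel σ) p e H := by
        rw [Finset.prod_mul_distrib]
        ring
    _ ≤ _ := by
        refine mul_le_mul' ?_ le_rfl
        rw [growth, ENNReal.ofReal_prod_of_nonneg (fun j _ => by positivity),
          Finset.prod_coe_sort e fun j => ENNReal.ofReal (w (c j)) * ENNReal.ofReal (κ (c j)),
          ← Finset.prod_filter_mul_prod_filter_not Finset.univ (· ∈ e),
          ← Finset.prod_filter_mul_prod_filter_not Finset.univ (· ∈ e)
            (fun j => ENNReal.ofReal ((A1 + A2) * _))]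
        have hfe : Finset.univ.filter (· ∈ e) = e := by ext; simp
        rw [hfe, mul_right_comm, ← Finset.prod_mul_distrib]
        refine mul_le_mul' (Finset.prod_le_prod' fun j _ => ?_)
          (Finset.prod_le_prod' fun j _ => ENNReal.ofReal_le_ofReal (hb1 _))
        rw [← ENNReal.ofReal_mul (hw0 _).le, ← ENNReal.ofReal_mul (hw0 _).le]
        exact ENNReal.ofReal_le_ofReal (hb2 _)

end Gaussian

/-! ### Local energy bounds for Gaussian Sobolev functions -/

section Local

theorem pi_absolutelyContinuous {ι X : Type*} [Fintype ι] [MeasurableSpace X]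
    {μ ν : ι → Measure X} [∀ i, SigmaFinite (μ i)] [∀ i, SigmaFinite (ν i)]
    (h : ∀ i, μ i ≪ ν i) : Measure.pi μ ≪ Measure.pi ν := by
  classical
  rcases isEmpty_or_nonempty (ι → X) with hX | ⟨⟨z₀⟩⟩
  · exact Measure.AbsolutelyContinuous.mk fun s _ _ => by simp [Set.eq_empty_of_isEmpty s]
  have key : ∀ (f : (ι → X) → ℝ≥0∞), Measurable f → ∀ (s : Finset ι) (z : ι → X),
      lmarginal ν s f z = 0 → lmarginal μ s f z = 0 := by
    intro f hf s
    induction s using Finset.induction with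
    | empty => simp
    | insert i s hi ih =>
      intro z hz
      rw [lmarginal_insert _ hf hi] at hz ⊢
      have hm : ∀ m : ι → Measure X, (∀ i, SigmaFinite (m i)) →
          Measurable fun x => lmarginal m s f (Function.update z i x) := fun m _ =>
        (hf.lmarginal m).comp (measurable_update z)
      rw [lintegral_eq_zero_iff (hm _ inferInstance)] at hz ⊢
      filter_upwards [(h i).ae_le hz] with x hx
      exact ih _ hx
  refine Measure.AbsolutelyContinuous.mk fun s hs h0 => ?_
  have e : ∀ m : ι → Measure X, (∀ i, SigmaFinite (m i)) →
      Measure.pi m s = lmarginal m Finset.univ (s.indicator 1) z₀ := fun m _ => by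
    rw [lmarginal_univ, lintegral_indicator_one hs]
  rw [e _ inferInstance] at h0 ⊢
  exact key _ (measurable_one.indicator hs) _ _ h0

variable {d : ℕ} {𝕜 : Type*} [RCLike 𝕜]

/-- Borel representatives are chosen up to `γ`-null sets, whereas weak derivatives are determined up
to Lebesgue null sets. -/
theorem volume_absolutelyContinuous_gaussMeasure :
    (volume : Measure (Fin d → ℝ)) ≪ gaussMeasure d := by
  rw [volume_pi]
  exact pi_absolutelyContinuous fun _ => gaussianReal_absolutelyContinuous' 0 one_ne_zero

theorem semiIntegral_empty (ν : Measure ℝ) [SigmaFinite ν] (k : ℝ → ℝ → ℝ≥0∞) (p : ℝ)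
    (H : (Fin d → ℝ) → 𝕜) :
    semiIntegral ν k p ∅ H = ∫⁻ x, ‖H x‖ₑ ^ p ∂(prodMeasure d ν) := by
  have : IsEmpty ((∅ : Finset (Fin d)) : Type) := ⟨fun j => Finset.notMem_empty _ j.2⟩
  simp [semiIntegral, mixedDiff_empty]

/-- A Gaussian Sobolev function together with Borel representatives of its derivatives. -/
structure IsJet (s p : ℝ) (N : ℝ≥0∞) (F : (Fin d → ℕ) → (Fin d → ℝ) → 𝕜) : Prop where
  measurable : ∀ β, Measurable (F β)
  locallyIntegrable : LocallyIntegrable (F 0)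
  step : ∀ β j, (β + Pi.single j 1 ≤ fun _ => ⌊s⌋₊) →
    IsWeakDeriv Set.univ (Pi.single j 1) (F β) (F (β + Pi.single j 1))
  lintegral_le : ∀ β, (β ≤ fun _ => ⌊s⌋₊) → ∫⁻ x, ‖F β x‖ₑ ^ p ∂(gaussMeasure d) ≤ N ^ p
  semiIntegral_le : Int.fract s ≠ 0 → ∀ β, (β ≤ fun _ => ⌊s⌋₊) → Finset.univ.sup β = ⌊s⌋₊ →
    ∀ e : Finset (Fin d), e ≠ ∅ →
      semiIntegral (gaussianReal 0 1) (ouKernel (Int.fract s * p)) p e (F β) ≤ N ^ p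

theorem lintegral_enorm_rpow_eq_eLpNorm {X : Type*} [MeasurableSpace X] (μ : Measure X) {p : ℝ}
    (hp : 0 < p) (f : X → 𝕜) : ∫⁻ x, ‖f x‖ₑ ^ p ∂μ = eLpNorm f (ENNReal.ofReal p) μ ^ p := by
  rw [eLpNorm_eq_lintegral_rpow_enorm_toReal (by simpa using hp) ENNReal.ofReal_ne_top,
    ENNReal.toReal_ofReal hp.le, ← ENNReal.rpow_mul, one_div, inv_mul_cancel₀ hp.ne',
    ENNReal.rpow_one]

theorem normInt_le_normMix (U : Set ℝ) (ν : Measure ℝ) (k : ℝ → ℝ → ℝ≥0∞) (s p : ℝ)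
    (f : (Fin d → ℝ) → 𝕜) : normInt U ν ⌊s⌋₊ p f ≤ normMix U ν k s p f := by
  rw [normMix]
  split_ifs
  · exact le_rfl
  · exact le_self_add

theorem eLpNorm_weakDeriv_rpow_le_normMix (U : Set ℝ) (ν : Measure ℝ) (k : ℝ → ℝ → ℝ≥0∞)
    (s : ℝ) {p : ℝ} (hp : 0 < p) (f : (Fin d → ℝ) → 𝕜) {β : Fin d → ℕ}
    (hβ : β ≤ fun _ => ⌊s⌋₊) :
    eLpNorm (weakDeriv (box d U) β f) (ENNReal.ofReal p) (prodMeasure d ν) ^ p ≤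
      normMix U ν k s p f ^ p := by
  refine le_trans ?_ (ENNReal.rpow_le_rpow (normInt_le_normMix U ν k s p f) hp.le)
  rw [normInt, ← ENNReal.rpow_mul, one_div, inv_mul_cancel₀ hp.ne', ENNReal.rpow_one]
  exact Finset.single_le_sum
    (f := fun β => eLpNorm (weakDeriv (box d U) β f) (ENNReal.ofReal p) (prodMeasure d ν) ^ p)
    (fun _ _ => zero_le) (Finset.mem_Iic.2 hβ)

theorem semiIntegral_weakDeriv_le_normMix (U : Set ℝ) (ν : Measure ℝ) (k : ℝ → ℝ → ℝ≥0∞)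
    {s p : ℝ} (hs : Int.fract s ≠ 0) (hp : 0 < p) (f : (Fin d → ℝ) → 𝕜) {β : Fin d → ℕ}
    (hβ : β ≤ fun _ => ⌊s⌋₊) (hβ' : Finset.univ.sup β = ⌊s⌋₊) {e : Finset (Fin d)} (he : e ≠ ∅) :
    semiIntegral ν k p e (weakDeriv (box d U) β f) ≤ normMix U ν k s p f ^ p := by
  have h1 : semiIntegral ν k p e (weakDeriv (box d U) β f) ^ (1 / p) ≤ normMix U ν k s p f := by
    rw [normMix, if_neg hs]
    refine le_trans ?_ le_add_self
    rw [seminormMix]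
    refine le_trans ?_ (Finset.single_le_sum (fun _ _ => zero_le)
      (Finset.mem_filter.2 ⟨Finset.mem_Iic.2 hβ, hβ'⟩))
    exact Finset.single_le_sum (f := fun e : Finset (Fin d) =>
      semiIntegral ν k p e (weakDeriv (box d U) β f) ^ (1 / p)) (fun _ _ => zero_le)
      (Finset.mem_erase.2 ⟨he, by simp⟩)
  calc _ = (semiIntegral ν k p e (weakDeriv (box d U) β f) ^ (1 / p)) ^ p := by
        rw [← ENNReal.rpow_mul, one_div, inv_mul_cancel₀ hp.ne', ENNReal.rpow_one]
    _ ≤ _ := ENNReal.rpow_le_rpow h1 hp.le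

theorem box_univ : box d Set.univ = Set.univ := by
  simp [box, Set.pi_univ]

/-- Representatives are fixed once and the norm is split into separate bounds for its constituents.
Measurability at every point is needed for the coordinatewise integrals. -/
theorem exists_isJet {s p : ℝ} (hp : 0 < p) {f : (Fin d → ℝ) → 𝕜} (hf : MemGauss s p f) :
    ∃ F : (Fin d → ℕ) → (Fin d → ℝ) → 𝕜, F 0 =ᵐ[volume] f ∧ IsJet s p (normGauss s p f) F := by
  classical
  obtain ⟨⟨-, hf2⟩, hf3⟩ := hf
  rw [box_univ] at hf2
  have hm : ∀ β : Fin d → ℕ, (β ≤ fun _ => ⌊s⌋₊) →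
      AEStronglyMeasurable (weakDeriv Set.univ β f) (gaussMeasure d) := fun β hβ =>
    (hf2 β hβ).2.1
  set F : (Fin d → ℕ) → (Fin d → ℝ) → 𝕜 := fun β =>
    if h : β ≤ fun _ => ⌊s⌋₊ then (hm β h).mk else 0 with hF
  have hFγ : ∀ β : Fin d → ℕ, (β ≤ fun _ => ⌊s⌋₊) →
      weakDeriv Set.univ β f =ᵐ[gaussMeasure d] F β := fun β hβ => by
    simp only [hF, dif_pos hβ]
    exact (hm β hβ).ae_eq_mk
  have hFd : ∀ β : Fin d → ℕ, (β ≤ fun _ => ⌊s⌋₊) → IsWeakDeriv Set.univ β f (F β) :=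
    fun β hβ => by
      refine (isWeakDeriv_weakDeriv (hf2 β hβ).1).congr (Filter.EventuallyEq.refl _ _) ?_
      rw [Measure.restrict_univ]
      exact volume_absolutelyContinuous_gaussMeasure.ae_le (hFγ β hβ)
  have h0 : (0 : Fin d → ℕ) ≤ fun _ => ⌊s⌋₊ := fun _ => Nat.zero_le _
  have hF0 : F 0 =ᵐ[volume] f := by
    have := (hFd 0 h0).ae_eq isOpen_univ (isWeakDeriv_zero (hFd 0 h0).1)
    rwa [Measure.restrict_univ] at this
  refine ⟨F, hF0, ?_, ?_, ?_, ?_, ?_⟩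
  · intro β
    by_cases h : β ≤ fun _ => ⌊s⌋₊
    · simp only [hF, dif_pos h]
      exact (hm β h).stronglyMeasurable_mk.measurable
    · simp only [hF, dif_neg h]
      exact measurable_const
  · exact locallyIntegrableOn_univ.1 (hFd 0 h0).2.1
  · intro β j hβ
    exact (hFd β (le_trans (le_add_of_nonneg_right (fun _ => Nat.zero_le _)) hβ)).single_of_add
      (hFd _ hβ)
  · intro β hβ
    rw [lintegral_enorm_rpow_eq_eLpNorm _ hp, ← eLpNorm_congr_ae (hFγ β hβ)]
    have := eLpNorm_weakDeriv_rpow_le_normMix Set.univ (gaussianReal 0 1)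
      (ouKernel (p * Int.fract s)) s hp f hβ
    rw [box_univ] at this
    exact this
  · intro hs β hβ hβ' e he
    rw [← semiIntegral_congr _ _ _ (hFγ β hβ)]
    have := semiIntegral_weakDeriv_le_normMix Set.univ (gaussianReal 0 1)
      (ouKernel (p * Int.fract s)) hs hp f hβ hβ' he
    rw [box_univ] at this
    rw [mul_comm (Int.fract s)]
    exact this

theorem pairEnergy_squareMeasure (k : ℝ → ℝ → ℝ≥0∞) (hk : Measurable (Function.uncurry k))
    (p : ℝ) (e : Finset (Fin d)) {H : (Fin d → ℝ) → 𝕜} (hH : Measurable H) :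
    pairEnergy (fun _ => squareMeasure) k p e H =
      semiIntegral (intervalMeasure (1 / 2)) k p e H := by
  rw [semiIntegral_eq_pairEnergy (intervalMeasure (1 / 2)) hk p e hH]
  congr 1
  funext j
  simp [pairMeasure, squareMeasure]

/-- Each direction in `e` is traded for one derivative in that direction, until no difference is
left and only an `L_p` norm remains. -/
theorem exists_pairEnergy_le_of_steps {p σ : ℝ} (hp : 1 < p) (hσp : σ < p)
    (e : Finset (Fin d)) :
    ∃ C : ℝ≥0∞, C ≠ ⊤ ∧ ∀ (R : Fin d → ℕ) (F : (Fin d → ℕ) → (Fin d → ℝ) → 𝕜),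
      (∀ β, Measurable (F β)) →
      (∀ β j, β + Pi.single j 1 ≤ R →
        IsWeakDeriv Set.univ (Pi.single j 1) (F β) (F (β + Pi.single j 1))) →
      ∀ β, β + ∑ j ∈ e, Pi.single j 1 ≤ R →
        pairEnergy (fun _ => squareMeasure) (powerKernel σ) p e (F β) ≤
          C * pairEnergy (fun _ => squareMeasure) (powerKernel σ) p ∅
            (F (β + ∑ j ∈ e, Pi.single j 1)) := by
  obtain ⟨C, hC, hle⟩ := exists_pairEnergy_weakDeriv_le (d := d) (𝕜 := 𝕜) hp hσp
  induction e using Finset.induction with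
  | empty => exact ⟨1, ENNReal.one_ne_top, fun R F _ _ β _ => by simp⟩
  | insert j e hj ih =>
    obtain ⟨C', hC', hle'⟩ := ih
    refine ⟨C * C', ENNReal.mul_ne_top hC hC', fun R F hm hF β hβ => ?_⟩
    rw [Finset.sum_insert hj, ← add_assoc] at hβ ⊢
    have hβ1 : β + Pi.single j 1 ≤ R :=
      le_trans (le_add_of_nonneg_right (fun _ => Nat.zero_le _)) hβ
    calc _ ≤ C * pairEnergy (fun _ => squareMeasure) (powerKernel σ) p e
            (F (β + Pi.single j 1)) := hle e j hj _ _ (hm _) (hm _) (hF β j hβ1)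
      _ ≤ C * (C' * _) := mul_le_mul' le_rfl (hle' R F hm hF _ hβ)
      _ = _ := (mul_assoc _ _ _).symm

/-- If `max β = ⌊s⌋`, the fractional energy is part of the Gaussian norm. Otherwise each `β_i <
⌊s⌋`, so a further derivative is available in every direction of `e` at once, and the energy is
bounded on the cube by an `L_p` norm. For integer `s` only `e = ∅` occurs and the value of `σ` plays
no role. -/
theorem exists_pairEnergy_jet_le {s p σ θ : ℝ} (hp : 1 < p) (hσ : 0 < σ) (hσp : σ < p)
    (hσs : Int.fract s ≠ 0 → σ = Int.fract s * p) (hθ0 : 0 ≤ θ) (hθ : θ < 1 / 2) :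
    ∃ (A : ℝ) (K : ℝ≥0∞), 0 < A ∧ K ≠ ⊤ ∧ ∀ (N : ℝ≥0∞) (F : (Fin d → ℕ) → (Fin d → ℝ) → 𝕜),
      IsJet s p N F → ∀ (c : Fin d → ℝ) (e : Finset (Fin d)), (Int.fract s ≠ 0 ∨ e = ∅) →
        ∀ β, (β ≤ fun _ => ⌊s⌋₊) →
        pairEnergy (fun _ => squareMeasure) (powerKernel σ) p e (fun x => F β (x + c)) ≤
          K * (ENNReal.ofReal (growth A θ c) * N ^ p) := by
  obtain ⟨A, hA, hle⟩ := exists_semiIntegral_comp_add_le (d := d) (𝕜 := 𝕜) hθ0 hθ hσ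
  choose C hC hCle using exists_pairEnergy_le_of_steps (d := d) (𝕜 := 𝕜) hp hσp
  refine ⟨A, 1 + ∑ e, C e, hA, ENNReal.add_ne_top.2 ⟨ENNReal.one_ne_top,
    ENNReal.sum_ne_top.2 fun e _ => hC e⟩, fun N F hF c e he β hβ => ?_⟩
  have hk := measurable_powerKernel σ
  have hmc : ∀ β, Measurable fun x => F β (x + c) := fun β =>
    (hF.measurable β).comp (measurable_id.add_const c)
  have hempty : ∀ β, (β ≤ fun _ => ⌊s⌋₊) →
      pairEnergy (fun _ => squareMeasure) (powerKernel σ) p ∅ (fun x => F β (x + c)) ≤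
        ENNReal.ofReal (growth A θ c) * N ^ p := fun β hβ => by
    rw [pairEnergy_squareMeasure _ hk p ∅ (hmc β)]
    refine (hle c p ∅ (F β)).trans (mul_le_mul' le_rfl ?_)
    rw [semiIntegral_empty]
    exact hF.lintegral_le β hβ
  have hone : ∀ x : ℝ≥0∞, x ≤ (1 + ∑ e, C e) * x := fun x => by
    calc x = 1 * x := (one_mul x).symm
      _ ≤ _ := mul_le_mul' le_self_add le_rfl
  rcases eq_or_ne e ∅ with rfl | hne
  · exact (hempty β hβ).trans (hone _)
  have hs : Int.fract s ≠ 0 := he.resolve_right hne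
  by_cases hsup : Finset.univ.sup β = ⌊s⌋₊
  · refine le_trans ?_ (hone _)
    rw [pairEnergy_squareMeasure _ hk p e (hmc β)]
    refine (hle c p e (F β)).trans (mul_le_mul' le_rfl ?_)
    rw [hσs hs]
    exact hF.semiIntegral_le hs β hβ hsup e hne
  · have hlt : ∀ i, β i < ⌊s⌋₊ := by
      have h1 : Finset.univ.sup β < ⌊s⌋₊ :=
        lt_of_le_of_ne (Finset.sup_le fun i _ => hβ i) hsup
      exact fun i => lt_of_le_of_lt (Finset.le_sup (Finset.mem_univ i)) h1
    have hβe : (β + ∑ j ∈ e, Pi.single j 1 : Fin d → ℕ) ≤ fun _ => ⌊s⌋₊ := by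
      intro i
      have : (∑ j ∈ e, Pi.single j 1 : Fin d → ℕ) i ≤ 1 := by
        rw [Finset.sum_apply]
        simp only [Pi.single_apply]
        rw [Finset.sum_ite_eq]
        split_ifs <;> simp
      have h2 := hlt i
      simp only [Pi.add_apply]
      omega
    refine (hCle e (fun _ => ⌊s⌋₊) (fun β x => F β (x + c)) hmc
      (fun β j h => (hF.step β j h).comp_add c) β hβe).trans ?_
    refine mul_le_mul' ?_ (hempty _ hβe)
    exact (Finset.single_le_sum (f := C) (fun _ _ => zero_le) (Finset.mem_univ e)).trans
      le_add_self

end Local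

/-! ### Localized derivatives -/

section Localized

variable {d : ℕ} {𝕜 : Type*} [RCLike 𝕜]

theorem measurable_tensorDeriv {ψ : ℝ → ℝ} (hψ : ContDiff ℝ ∞ ψ) (γ : Fin d → ℕ) :
    Measurable (tensorDeriv ψ γ) :=
  (contDiff_tensorDeriv hψ γ).continuous.measurable

theorem measurable_list_map_sum {X ι : Type*} [MeasurableSpace X] (l : List ι)
    {G : ι → X → 𝕜} (hG : ∀ t, Measurable (G t)) :
    Measurable fun x => (l.map fun t => G t x).sum := by
  induction l with
  | nil => simp
  | cons t l ih =>
    simp only [List.map_cons, List.sum_cons]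
    exact (hG t).add ih

theorem diffZ_add (e : Finset (Fin d)) (H H' : (Fin d → ℝ) → 𝕜) (z : Fin d → ℝ × ℝ) :
    diffZ e (fun x => H x + H' x) z = diffZ e H z + diffZ e H' z := by
  simp only [diffZ, smul_add, Finset.sum_add_distrib]

theorem pairEnergy_zero (m : Fin d → Measure (ℝ × ℝ)) (k : ℝ → ℝ → ℝ≥0∞) {p : ℝ} (hp : 0 < p)
    (e : Finset (Fin d)) : pairEnergy m k p e (fun _ => (0 : 𝕜)) = 0 := by
  simp [pairEnergy, diffZ, hp]

theorem pairEnergy_add_le (m : Fin d → Measure (ℝ × ℝ)) {k : ℝ → ℝ → ℝ≥0∞}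
    (hk : Measurable (Function.uncurry k)) {p : ℝ} (hp : 1 ≤ p) (e : Finset (Fin d))
    {H H' : (Fin d → ℝ) → 𝕜} (hH : Measurable H) :
    pairEnergy m k p e (fun x => H x + H' x) ≤
      2 ^ (p - 1) * (pairEnergy m k p e H + pairEnergy m k p e H') := by
  have h2 : (2 : ℝ≥0∞) ^ (p - 1) ≠ ⊤ := ENNReal.rpow_ne_top_of_nonneg (by linarith) (by simp)
  simp only [pairEnergy]
  rw [← lintegral_add_left (measurable_energy_density hk p e hH), ← lintegral_const_mul' _ _ h2]
  refine lintegral_mono fun z => ?_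
  simp only [diffZ_add]
  rw [← add_mul, ← mul_assoc]
  refine mul_le_mul' ?_ le_rfl
  exact (ENNReal.rpow_le_rpow (enorm_add_le _ _) (by linarith)).trans
    (ENNReal.rpow_add_le_mul_rpow_add_rpow _ _ hp)

theorem pairEnergy_list_sum_le (m : Fin d → Measure (ℝ × ℝ)) {k : ℝ → ℝ → ℝ≥0∞}
    (hk : Measurable (Function.uncurry k)) {p : ℝ} (hp : 1 ≤ p) (e : Finset (Fin d)) {ι : Type*}
    (L : List ι) {G : ι → (Fin d → ℝ) → 𝕜} (hG : ∀ t, Measurable (G t)) :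
    pairEnergy m k p e (fun x => (L.map fun t => G t x).sum) ≤
      (2 ^ (p - 1)) ^ L.length * (L.map fun t => pairEnergy m k p e (G t)).sum := by
  induction L with
  | nil => simp [pairEnergy_zero m k (by linarith : 0 < p) e]
  | cons t L ih =>
    simp only [List.map_cons, List.sum_cons, List.length_cons]
    have h1 : (1 : ℝ≥0∞) ≤ 2 ^ (p - 1) := by
      simpa using ENNReal.rpow_le_rpow (one_le_two (α := ℝ≥0∞)) (sub_nonneg.2 hp)
    calc _ ≤ 2 ^ (p - 1) * (pairEnergy m k p e (G t) +
            pairEnergy m k p e (fun x => (L.map fun t => G t x).sum)) :=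
          pairEnergy_add_le m hk hp e (hG t)
      _ ≤ 2 ^ (p - 1) * ((2 ^ (p - 1)) ^ L.length * pairEnergy m k p e (G t) +
            (2 ^ (p - 1)) ^ L.length * (L.map fun t => pairEnergy m k p e (G t)).sum) := by
          refine mul_le_mul' le_rfl (add_le_add ?_ ih)
          calc _ = 1 * pairEnergy m k p e (G t) := (one_mul _).symm
            _ ≤ _ := mul_le_mul' (one_le_pow₀ h1) le_rfl
      _ = _ := by ring

theorem pairEnergy_finset_sum_lt_top (m : Fin d → Measure (ℝ × ℝ)) {k : ℝ → ℝ → ℝ≥0∞}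
    (hk : Measurable (Function.uncurry k)) {p : ℝ} (hp : 1 ≤ p) (e : Finset (Fin d)) {ι : Type*}
    (S : Finset ι) {G : ι → (Fin d → ℝ) → 𝕜} (hG : ∀ t, Measurable (G t))
    (h : ∀ t ∈ S, pairEnergy m k p e (G t) < ⊤) :
    pairEnergy m k p e (fun x => ∑ t ∈ S, G t x) < ⊤ := by
  classical
  induction S using Finset.induction with
  | empty => simp [pairEnergy_zero m k (by linarith : 0 < p) e]
  | insert i S hi ih =>
    simp only [Finset.sum_insert hi]
    refine lt_of_le_of_lt (pairEnergy_add_le m hk hp e (hG i)) ?_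
    refine ENNReal.mul_lt_top (ENNReal.rpow_lt_top_of_nonneg (by linarith) (by simp)) ?_
    exact ENNReal.add_lt_top.2 ⟨h i (Finset.mem_insert_self _ _),
      ih fun t ht => h t (Finset.mem_insert_of_mem ht)⟩

variable {ψ : ℝ → ℝ}

theorem iteratedDeriv_eq_zero_of_notMem {K : Set ℝ} (hK : IsClosed K) (h : ∀ u, u ∉ K → ψ u = 0)
    (n : ℕ) : ∀ u, u ∉ K → iteratedDeriv n ψ u = 0 := by
  intro u hu
  have h1 : ψ =ᶠ[nhds u] fun _ => 0 := by
    filter_upwards [hK.isOpen_compl.mem_nhds hu] with v hv using h v hv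
  rw [(h1.iteratedDeriv n).eq_of_nhds]
  simp

theorem hasCompactSupport_iteratedDeriv {R : ℝ} (h : ∀ u, u ∉ Set.Icc (-R) R → ψ u = 0) (n : ℕ) :
    HasCompactSupport (iteratedDeriv n ψ) :=
  HasCompactSupport.intro isCompact_Icc fun u hu =>
    iteratedDeriv_eq_zero_of_notMem isClosed_Icc h n u hu

theorem tensorDeriv_eq_zero {R : ℝ} (h : ∀ u, u ∉ Set.Icc (-R) R → ψ u = 0) (γ : Fin d → ℕ)
    {x : Fin d → ℝ} {i : Fin d} (hi : x i ∉ Set.Icc (-R) R) : tensorDeriv ψ γ x = 0 :=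
  Finset.prod_eq_zero (Finset.mem_univ i) (iteratedDeriv_eq_zero_of_notMem isClosed_Icc h _ _ hi)

/-- All derivatives of `ψ` are bounded, Lipschitz and supported in `(-1/2, 1/2)`, so the product
estimate applies. The sums over the coordinates are common bounds for the constants of the
individual factors. -/
theorem exists_semiIntegral_tensorDeriv_smul_le (hψ : ContDiff ℝ ∞ ψ) {R : ℝ} (hR : R < 1 / 2)
    (hsupp : ∀ u, u ∉ Set.Icc (-R) R → ψ u = 0) {p σ : ℝ} (hp : 1 ≤ p) (hσ : 0 < σ) (hσp : σ < p)
    (γ : Fin d → ℕ) :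
    ∃ C : ℝ≥0∞, C ≠ ⊤ ∧ ∀ H : (Fin d → ℝ) → 𝕜, Measurable H → ∀ e : Finset (Fin d),
      pairEnergy (partialPairMeasure e Finset.univ) (powerKernel σ) p e
          (fun x => tensorDeriv ψ γ x • H x) ≤
        C * ∑ e' ∈ e.powerset, pairEnergy (fun _ => squareMeasure) (powerKernel σ) p e' H := by
  have hc := fun n => hasCompactSupport_iteratedDeriv hsupp n
  have hd := fun n => contDiff_iteratedDeriv hψ n
  have hb : ∀ n, ∃ M, ∀ u, |iteratedDeriv n ψ u| ≤ M := fun n =>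
    (hc n).exists_bound_of_continuous (hd n).continuous
  choose M hM using hb
  have hLip : ∀ n, ∃ L, LipschitzWith L (iteratedDeriv n ψ) := fun n =>
    ContDiff.lipschitzWith_of_hasCompactSupport (hc n) (hd n) (by simp)
  choose Λ hΛ using hLip
  have hCK : ∀ n, ∃ C : ℝ≥0∞, C ≠ ⊤ ∧ ∀ v, ∫⁻ u,
      ‖iteratedDeriv n ψ u - iteratedDeriv n ψ v‖ₑ ^ p * powerKernel σ u v ≤ C := fun n =>
    exists_lintegral_sub_rpow_mul_powerKernel_le hp
      (fun u v => by simpa [Real.dist_eq] using (hΛ n).dist_le_mul u v) (hM n) hσ hσp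
  choose CK hCK hK using hCK
  have hM0 : ∀ n, 0 ≤ M n := fun n => (abs_nonneg _).trans (hM n 0)
  exact exists_pairEnergy_prod_smul_le (measurable_powerKernel σ) (powerKernel_comm σ) hp
    (M := ∑ j, M (γ j)) (CK := ∑ j, CK (γ j)) (ENNReal.sum_ne_top.2 fun j _ => hCK _)
    (fun j => iteratedDeriv (γ j) ψ) (fun j => (hd _).continuous.measurable)
    (fun j u => (hM _ u).trans
      (Finset.single_le_sum (f := fun j => M (γ j)) (fun _ _ => hM0 _) (Finset.mem_univ j)))
    (fun j u hu => iteratedDeriv_eq_zero_of_notMem isClosed_Icc hsupp _ _ fun h =>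
      hu ⟨by linarith [h.1], by linarith [h.2]⟩)
    (fun j v => (hK _ v).trans
      (Finset.single_le_sum (f := fun j => CK (γ j)) (fun _ _ => zero_le) (Finset.mem_univ j)))
    Finset.univ

theorem semiIntegral_volume_eq {k : ℝ → ℝ → ℝ≥0∞} (hk : Measurable (Function.uncurry k)) (p : ℝ)
    (e : Finset (Fin d)) {H : (Fin d → ℝ) → 𝕜} (hH : Measurable H) :
    semiIntegral volume k p e H = pairEnergy (partialPairMeasure e Finset.univ) k p e H := by
  rw [semiIntegral_eq_pairEnergy (intervalMeasure (1 / 2)) hk p e hH]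
  congr 1
  funext j
  simp [partialPairMeasure]

/-- The functions `h α` are derivatives of `H`, supported in a cube and of energy at most `M`. -/
structure IsLocalized (s p σ R : ℝ) (M : ℝ≥0∞) (H : (Fin d → ℝ) → 𝕜)
    (h : (Fin d → ℕ) → (Fin d → ℝ) → 𝕜) : Prop where
  measurable : ∀ α, Measurable (h α)
  eq_zero : ∀ x i, x i ∉ Set.Icc (-R) R → H x = 0
  isWeakDeriv : ∀ α, (α ≤ fun _ => ⌊s⌋₊) → IsWeakDeriv Set.univ α H (h α)
  semiIntegral_le : ∀ α, (α ≤ fun _ => ⌊s⌋₊) → ∀ e : Finset (Fin d), (Int.fract s ≠ 0 ∨ e = ∅) →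
    semiIntegral volume (powerKernel σ) p e (h α) ≤ M

/-- The derivatives of the localized function are taken from the Leibniz list. Every term of the
list is bounded on the cube by `exists_pairEnergy_jet_le` and extended to `ℝ^d` by the cutoff; the
constants depend neither on `c` nor on `f`. -/
theorem exists_isLocalized (hψ : ContDiff ℝ ∞ ψ) {R : ℝ} (hR : R < 1 / 2)
    (hsupp : ∀ u, u ∉ Set.Icc (-R) R → ψ u = 0) {s p σ θ : ℝ} (hp : 1 < p) (hσ : 0 < σ)
    (hσp : σ < p) (hσs : Int.fract s ≠ 0 → σ = Int.fract s * p) (hθ0 : 0 ≤ θ) (hθ : θ < 1 / 2) :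
    ∃ (A : ℝ) (K : ℝ≥0∞), 0 < A ∧ K ≠ ⊤ ∧ ∀ (N : ℝ≥0∞) (F : (Fin d → ℕ) → (Fin d → ℝ) → 𝕜),
      IsJet s p N F → ∀ c : Fin d → ℝ, ∃ h : (Fin d → ℕ) → (Fin d → ℝ) → 𝕜,
        IsLocalized s p σ R (K * (ENNReal.ofReal (growth A θ c) * N ^ p))
          (fun x => tensorDeriv ψ 0 x • F 0 (x + c)) h := by
  obtain ⟨A, K, hA, hK, hle⟩ := exists_pairEnergy_jet_le (d := d) (𝕜 := 𝕜) hp hσ hσp hσs hθ0 hθ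
  choose L hL1 hL2 using exists_leibniz_list (d := d) (𝕜 := 𝕜)
  choose C hC hCle using exists_semiIntegral_tensorDeriv_smul_le (d := d) (𝕜 := 𝕜) hψ hR hsupp
    hp.le hσ hσp
  set P : ℝ≥0∞ := ((Finset.univ : Finset (Finset (Fin d))).card : ℝ≥0∞) with hP
  have h2 : (2 : ℝ≥0∞) ^ (p - 1) ≠ ⊤ := ENNReal.rpow_ne_top_of_nonneg (by linarith) (by simp)
  set K' : (Fin d → ℕ) → ℝ≥0∞ := fun α =>
    (2 ^ (p - 1)) ^ (L α).length * ((L α).map fun t => C t.1 * (P * K)).sum with hK'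
  have hK't : ∀ α, K' α ≠ ⊤ := by
    intro α
    refine ENNReal.mul_ne_top (ENNReal.pow_ne_top h2) ?_
    have : ∀ l : List ((Fin d → ℕ) × (Fin d → ℕ)),
        (l.map fun t => C t.1 * (P * K)).sum ≠ ⊤ := by
      intro l
      induction l with
      | nil => simp
      | cons t l ih =>
        simp only [List.map_cons, List.sum_cons]
        exact ENNReal.add_ne_top.2
          ⟨ENNReal.mul_ne_top (hC _) (ENNReal.mul_ne_top (by simp [hP]) hK), ih⟩
    exact this _
  refine ⟨A, ∑ α ∈ Finset.Iic (fun _ : Fin d => ⌊s⌋₊), K' α, hA,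
    ENNReal.sum_ne_top.2 fun α _ => hK't α, fun N F hF c =>
      ⟨fun α x => ((L α).map fun t => tensorDeriv ψ t.1 x • F t.2 (x + c)).sum, ?_, ?_, ?_, ?_⟩⟩
  · exact fun α => measurable_list_map_sum _ fun t => (measurable_tensorDeriv hψ _).smul
      ((hF.measurable _).comp (measurable_id.add_const c))
  · intro x i hi
    simp only [tensorDeriv_eq_zero hsupp 0 hi, zero_smul]
  · intro α hα
    refine hL2 α ψ hψ (fun β x => F β (x + c)) ?_ fun β j hβ =>
      (hF.step β j (hβ.trans hα)).comp_add c
    have h0 := ((isWeakDeriv_zero (𝕜 := 𝕜) (locallyIntegrableOn_univ.2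
      hF.locallyIntegrable)).comp_add c).1
    exact locallyIntegrableOn_univ.1 h0
  · intro α hα e he
    set W := ENNReal.ofReal (growth A θ c) * N ^ p with hW
    have hmF : ∀ β, Measurable fun x => F β (x + c) := fun β =>
      (hF.measurable β).comp (measurable_id.add_const c)
    have hmT : ∀ t : (Fin d → ℕ) × (Fin d → ℕ),
        Measurable fun x => tensorDeriv ψ t.1 x • F t.2 (x + c) := fun t =>
      (measurable_tensorDeriv hψ _).smul (hmF _)
    rw [semiIntegral_volume_eq (measurable_powerKernel σ) p e
      (measurable_list_map_sum _ hmT)]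
    refine (pairEnergy_list_sum_le _ (measurable_powerKernel σ) hp.le e (L α) hmT).trans ?_
    have hterm : ∀ t ∈ L α, pairEnergy (partialPairMeasure e Finset.univ) (powerKernel σ) p e
        (fun x => tensorDeriv ψ t.1 x • F t.2 (x + c)) ≤ C t.1 * (P * K) * W := by
      intro t ht
      refine (hCle t.1 _ (hmF t.2) e).trans ?_
      rw [mul_assoc (C t.1), mul_assoc P]
      refine mul_le_mul' le_rfl ?_
      calc _ ≤ ∑ e' ∈ e.powerset, K * W := by
            refine Finset.sum_le_sum fun e' he' => ?_
            refine hle N F hF c e' ?_ t.2 ((hL1 α t ht).trans hα)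
            rcases he with he | rfl
            · exact Or.inl he
            · exact Or.inr (Finset.subset_empty.1 (Finset.mem_powerset.1 he'))
        _ ≤ _ := by
            rw [Finset.sum_const, nsmul_eq_mul]
            refine mul_le_mul' ?_ le_rfl
            rw [hP]
            exact_mod_cast Finset.card_le_card (Finset.subset_univ e.powerset)
    have hsum : ∀ l : List ((Fin d → ℕ) × (Fin d → ℕ)), (∀ t ∈ l, t ∈ L α) →
        (l.map fun t => pairEnergy (partialPairMeasure e Finset.univ) (powerKernel σ) p e
          (fun x => tensorDeriv ψ t.1 x • F t.2 (x + c))).sum ≤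
        (l.map fun t => C t.1 * (P * K)).sum * W := by
      intro l hl
      induction l with
      | nil => simp
      | cons t l ih =>
        simp only [List.map_cons, List.sum_cons, add_mul]
        exact add_le_add (hterm t (hl t (by simp))) (ih fun t' ht' => hl t' (by simp [ht']))
    calc _ ≤ (2 ^ (p - 1)) ^ (L α).length * (((L α).map fun t => C t.1 * (P * K)).sum * W) :=
          mul_le_mul' le_rfl (hsum _ fun _ h => h)
      _ = K' α * W := by rw [hK', mul_assoc]
      _ ≤ _ := mul_le_mul' (Finset.single_le_sum (f := K') (fun _ _ => zero_le)
          (Finset.mem_Iic.2 hα)) le_rfl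

end Localized

/-! ### Periodization of localized functions -/

section Periodic

variable {d : ℕ} {𝕜 : Type*} [RCLike 𝕜]

theorem prodMeasure_intervalMeasure (ℓ : ℝ) :
    prodMeasure d (intervalMeasure ℓ) =
      (volume : Measure (Fin d → ℝ)).restrict (box d (Set.Ioo (-ℓ) ℓ)) := by
  rw [volume_pi, box, Measure.restrict_pi_pi]
  rfl

theorem isOpen_box (a b : ℝ) : IsOpen (box d (Set.Ioo a b)) :=
  isOpen_set_pi Set.finite_univ fun _ _ => isOpen_Ioo

/-- Passes from energy bounds on arbitrary Borel representatives to the norm and to membership. The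
constant only counts multi-indices and subsets, so it does not depend on `ℓ`. -/
theorem exists_normCube_le (d : ℕ) (s : ℝ) {p : ℝ} (hp : 0 < p) :
    ∃ K : ℝ≥0∞, K ≠ ⊤ ∧ ∀ (ℓ : ℝ) (f : (Fin d → ℝ) → 𝕜) (g : (Fin d → ℕ) → (Fin d → ℝ) → 𝕜)
      (M : ℝ≥0∞), (∀ α, Measurable (g α)) →
      (∀ α, (α ≤ fun _ => ⌊s⌋₊) → IsWeakDeriv (box d (Set.Ioo (-ℓ) ℓ)) α f (g α)) →
      (∀ α, (α ≤ fun _ => ⌊s⌋₊) → ∀ e : Finset (Fin d), (Int.fract s ≠ 0 ∨ e = ∅) →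
        semiIntegral (intervalMeasure ℓ) (powerKernel (Int.fract s * p)) p e (g α) ≤ M) →
      normCube ℓ s p f ≤ K * M ^ (1 / p) ∧ (M ≠ ⊤ → MemCube ℓ s p f) := by
  set I := Finset.Iic (fun _ : Fin d => ⌊s⌋₊) with hI
  set E := (Finset.univ : Finset (Fin d)).powerset.erase ∅ with hE
  refine ⟨(I.card : ℝ≥0∞) ^ (1 / p) + I.card * E.card, ?_, fun ℓ f g M hm hd hM => ?_⟩
  · refine ENNReal.add_ne_top.2 ⟨ENNReal.rpow_ne_top_of_nonneg (by positivity) (by simp), ?_⟩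
    exact ENNReal.mul_ne_top (by simp) (by simp)
  have hae : ∀ α, (α ≤ fun _ => ⌊s⌋₊) → weakDeriv (box d (Set.Ioo (-ℓ) ℓ)) α f
      =ᵐ[prodMeasure d (intervalMeasure ℓ)] g α := fun α hα => by
    rw [prodMeasure_intervalMeasure]
    exact (hd α hα).weakDeriv_ae_eq (isOpen_box _ _)
  have hL : ∀ α, (α ≤ fun _ => ⌊s⌋₊) →
      eLpNorm (weakDeriv (box d (Set.Ioo (-ℓ) ℓ)) α f) (ENNReal.ofReal p)
        (prodMeasure d (intervalMeasure ℓ)) ^ p ≤ M := fun α hα => by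
    rw [eLpNorm_congr_ae (hae α hα), ← lintegral_enorm_rpow_eq_eLpNorm _ hp]
    have := hM α hα ∅ (Or.inr rfl)
    rwa [semiIntegral_empty] at this
  have hint : normInt (Set.Ioo (-ℓ) ℓ) (intervalMeasure ℓ) ⌊s⌋₊ p f ≤
      (I.card : ℝ≥0∞) ^ (1 / p) * M ^ (1 / p) := by
    rw [normInt, ← ENNReal.mul_rpow_of_nonneg _ _ (by positivity)]
    refine ENNReal.rpow_le_rpow ?_ (by positivity)
    calc _ ≤ ∑ α ∈ I, M := Finset.sum_le_sum fun α hα => hL α (Finset.mem_Iic.1 hα)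
      _ = _ := by rw [Finset.sum_const, nsmul_eq_mul]
  have hsem : Int.fract s ≠ 0 → seminormMix (Set.Ioo (-ℓ) ℓ) (intervalMeasure ℓ)
      (powerKernel (Int.fract s * p)) ⌊s⌋₊ p f ≤ (I.card * E.card : ℝ≥0∞) * M ^ (1 / p) := by
    intro hs
    calc _ ≤ ∑ α ∈ I.filter (fun α => Finset.univ.sup α = ⌊s⌋₊), ∑ e ∈ E, M ^ (1 / p) := by
          refine Finset.sum_le_sum fun α hα => Finset.sum_le_sum fun e _ => ?_
          refine ENNReal.rpow_le_rpow ?_ (by positivity)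
          have hα' := Finset.mem_Iic.1 (Finset.mem_filter.1 hα).1
          exact (semiIntegral_congr _ _ _ (hae α hα')).le.trans (hM α hα' e (Or.inl hs))
      _ ≤ ∑ α ∈ I, ∑ e ∈ E, M ^ (1 / p) :=
          Finset.sum_le_sum_of_subset (Finset.filter_subset _ _)
      _ = _ := by rw [Finset.sum_const, Finset.sum_const, nsmul_eq_mul, nsmul_eq_mul, mul_assoc]
  refine ⟨?_, fun hMt => ⟨⟨?_, fun α hα => ⟨⟨_, hd α hα⟩, ?_⟩⟩, fun hs => ?_⟩⟩
  · rw [normCube, normMix]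
    split_ifs with hs
    · exact hint.trans (mul_le_mul' le_self_add le_rfl)
    · rw [add_mul]
      exact add_le_add hint (hsem hs)
  · have h0 : (0 : Fin d → ℕ) ≤ fun _ => ⌊s⌋₊ := fun _ => Nat.zero_le _
    have h1 : f =ᵐ[prodMeasure d (intervalMeasure ℓ)] g 0 := by
      rw [prodMeasure_intervalMeasure]
      exact (isWeakDeriv_zero (hd 0 h0).1).ae_eq (isOpen_box _ _) (hd 0 h0)
    refine ⟨(hm 0).aestronglyMeasurable.congr h1.symm, ?_⟩
    rw [eLpNorm_congr_ae (h1.trans (hae 0 h0).symm)]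
    exact (ENNReal.rpow_lt_top_iff_of_pos hp).1 (lt_of_le_of_lt (hL 0 h0) hMt.lt_top)
  · refine ⟨(hm α).aestronglyMeasurable.congr (hae α hα).symm, ?_⟩
    exact (ENNReal.rpow_lt_top_iff_of_pos hp).1 (lt_of_le_of_lt (hL α hα) hMt.lt_top)
  · refine lt_of_le_of_lt (hsem hs) (ENNReal.mul_lt_top ?_ ?_)
    · exact ENNReal.mul_lt_top (by simp) (by simp)
    · exact ENNReal.rpow_lt_top_of_nonneg (by positivity) hMt

/-- The extension of `H`, restricted to `[-1/2, 1/2)^d`, that is `1`-periodic in each variable. -/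
noncomputable def periodize {X : Type*} (H : (Fin d → ℝ) → X) (x : Fin d → ℝ) : X :=
  H fun i => x i - ⌊x i + 1 / 2⌋

theorem periodize_add_single {X : Type*} (H : (Fin d → ℝ) → X) (x : Fin d → ℝ) (i : Fin d) :
    periodize H (x + Pi.single i 1) = periodize H x := by
  unfold periodize
  congr 1
  funext j
  by_cases h : j = i
  · subst h
    have : x j + 1 + 1 / 2 = x j + 1 / 2 + 1 := by ring
    simp only [Pi.add_apply, Pi.single_eq_same, this, Int.floor_add_one]
    push_cast
    ring
  · simp [h]

theorem periodize_ae_eq {X : Type*} (H : (Fin d → ℝ) → X) : periodize H =ᵐ[unitCubeMeasure d] H := by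
  rw [unitCubeMeasure, prodMeasure_intervalMeasure]
  filter_upwards [ae_restrict_mem (isOpen_box _ _).measurableSet] with x hx
  unfold periodize
  congr 1
  funext i
  have hi := hx i (Set.mem_univ i)
  have : ⌊x i + 1 / 2⌋ = 0 := by
    rw [Int.floor_eq_zero_iff]
    exact ⟨by linarith [hi.1], by linarith [hi.2]⟩
  rw [this, Int.cast_zero, sub_zero]

/-- Since `R < 1/2`, the translates of `H` by integer vectors have disjoint supports: at `x` only
the one with `j_i = ⌊x_i + 1/2⌋` can be nonzero. On a bounded box these indices stay in a finite
set. -/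
theorem periodize_eq_sum {R : ℝ} (hR : R < 1 / 2) {H : (Fin d → ℝ) → 𝕜}
    (hH : ∀ x i, x i ∉ Set.Icc (-R) R → H x = 0) {ℓ : ℝ} {n : ℕ} (hn : ℓ + 1 ≤ n)
    {x : Fin d → ℝ} (hx : x ∈ box d (Set.Ioo (-ℓ) ℓ)) :
    periodize H x = ∑ j ∈ Fintype.piFinset fun _ : Fin d => Finset.Icc (-(n : ℤ)) n,
      H (x + fun i => -(j i : ℝ)) := by
  have hf1 := fun i => Int.floor_le (x i + 1 / 2)
  have hf2 := fun i => Int.lt_floor_add_one (x i + 1 / 2)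
  rw [Finset.sum_eq_single fun i => ⌊x i + 1 / 2⌋]
  · rfl
  · intro j _ hj
    obtain ⟨i, hi⟩ := Function.ne_iff.1 hj
    refine hH _ i fun h => hi ?_
    simp only [Pi.add_apply, Set.mem_Icc] at h
    symm
    rw [Int.floor_eq_iff]
    exact ⟨by linarith [h.1], by linarith [h.2]⟩
  · intro hj
    refine absurd (Fintype.mem_piFinset.2 fun i => Finset.mem_Icc.2 ⟨?_, ?_⟩) hj
    · have := (hx i (Set.mem_univ i)).1
      have h3 : (-(n : ℤ) : ℝ) ≤ x i + 1 / 2 := by push_cast; linarith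
      exact Int.le_floor.2 (by exact_mod_cast h3)
    · have := (hx i (Set.mem_univ i)).2
      have h3 : x i + 1 / 2 < ((n : ℤ) : ℝ) + 1 := by push_cast; linarith
      have h4 : (⌊x i + 1 / 2⌋ : ℝ) < ((n : ℤ) : ℝ) + 1 := (hf1 i).trans_lt h3
      have h5 : ⌊x i + 1 / 2⌋ < (n : ℤ) + 1 := by exact_mod_cast h4
      omega

theorem semiIntegral_intervalMeasure_le (ℓ : ℝ) (k : ℝ → ℝ → ℝ≥0∞) (p : ℝ)
    (e : Finset (Fin d)) (H : (Fin d → ℝ) → 𝕜) :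
    semiIntegral (intervalMeasure ℓ) k p e H ≤ semiIntegral volume k p e H := by
  have h : ∀ ι : Type, [Fintype ι] → (Measure.pi fun _ : ι => intervalMeasure ℓ) ≤
      Measure.pi fun _ : ι => volume := fun ι _ => by
    have := pi_le_smul_pi (ι := ι) (μ := fun _ => intervalMeasure ℓ) (ν := fun _ => volume)
      (D := fun _ => 1) fun _ => by rw [one_smul]; exact Measure.restrict_le_self
    simpa using this
  exact lintegral_mono' (h e) fun y => lintegral_mono' (h (Fin d)) le_rfl

theorem semiIntegral_volume_comp_add (σ p : ℝ) (e : Finset (Fin d)) (H : (Fin d → ℝ) → 𝕜)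
    (c : Fin d → ℝ) : semiIntegral volume (powerKernel σ) p e (fun x => H (x + c)) =
      semiIntegral volume (powerKernel σ) p e H := by
  set Ψ : (e → ℝ) → (Fin d → ℝ) → ℝ≥0∞ := fun y x =>
    ‖mixedDiff e (extendCoords e y) H x‖ₑ ^ p * ∏ j : e, powerKernel σ (x j) (y j) with hΨ
  have h1 : semiIntegral volume (powerKernel σ) p e (fun x => H (x + c)) =
      ∫⁻ y : e → ℝ, ∫⁻ x : Fin d → ℝ, Ψ (y + fun j : e => c j) (x + c) := by
    refine lintegral_congr fun y => lintegral_congr fun x => ?_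
    rw [mixedDiff_comp_add]
    simp only [hΨ]
    congr 1
    refine Finset.prod_congr rfl fun j _ => ?_
    simp [powerKernel]
  rw [h1]
  calc _ = ∫⁻ y : e → ℝ, ∫⁻ x : Fin d → ℝ, Ψ (y + fun j : e => c j) x :=
        lintegral_congr fun y => lintegral_add_right_eq_self _ c
    _ = ∫⁻ y : e → ℝ, ∫⁻ x : Fin d → ℝ, Ψ y x :=
        lintegral_add_right_eq_self (fun y => ∫⁻ x, Ψ y x) fun j : e => c j

/-- The norm sees only the open unit cube, where `g` agrees with `H` almost everywhere, so it is
bounded uniformly. Membership requires finiteness on every larger cube; there the periodization is a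
finite sum of translates of `H`, each of the same energy over `ℝ^d`. -/
theorem exists_normPer_le {s p σ R : ℝ} (hp : 1 ≤ p)
    (hσs : Int.fract s ≠ 0 → σ = Int.fract s * p) (hR : R < 1 / 2) :
    ∃ K : ℝ≥0∞, K ≠ ⊤ ∧ ∀ (M : ℝ≥0∞) (H : (Fin d → ℝ) → 𝕜)
      (h : (Fin d → ℕ) → (Fin d → ℝ) → 𝕜), IsLocalized s p σ R M H h →
      ∀ g : (Fin d → ℝ) → 𝕜, g =ᵐ[unitCubeMeasure d] H →
        normPer s p g ≤ K * M ^ (1 / p) ∧ (M ≠ ⊤ → MemPer s p g) := by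
  obtain ⟨K, hK, hle⟩ := exists_normCube_le (𝕜 := 𝕜) d s (by linarith : 0 < p)
  refine ⟨K, hK, fun M H h hH g hg => ⟨?_, fun hM => ?_⟩⟩
  all_goals
    have hker : ∀ α, (α ≤ fun _ => ⌊s⌋₊) → ∀ e : Finset (Fin d), (Int.fract s ≠ 0 ∨ e = ∅) →
        semiIntegral volume (powerKernel (Int.fract s * p)) p e (h α) ≤ M := by
      intro α hα e he
      rcases he with hs | rfl
      · rw [← hσs hs]
        exact hH.semiIntegral_le α hα e (Or.inl hs)
      · have := hH.semiIntegral_le α hα ∅ (Or.inr rfl)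
        rwa [semiIntegral_empty] at this ⊢
  · refine (hle (1 / 2) g h M hH.measurable (fun α hα => ?_) fun α hα e he =>
      (semiIntegral_intervalMeasure_le _ _ _ _ _).trans (hker α hα e he)).1
    refine (hH.isWeakDeriv α hα).mono.congr ?_ (Filter.EventuallyEq.refl _ _)
    rw [← prodMeasure_intervalMeasure]
    exact hg.symm
  · refine ⟨periodize H, fun x i => periodize_add_single H x i,
      (periodize_ae_eq H).trans hg.symm, fun ℓ hℓ => ?_⟩
    obtain ⟨n, hn⟩ := exists_nat_ge (ℓ + 1)
    set S := Fintype.piFinset fun _ : Fin d => Finset.Icc (-(n : ℤ)) n with hS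
    set G : (Fin d → ℕ) → (Fin d → ℝ) → 𝕜 := fun α x =>
      ∑ j ∈ S, h α (x + fun i => -(j i : ℝ)) with hG
    have hmt : ∀ α (j : Fin d → ℤ), Measurable fun x => h α (x + fun i => -(j i : ℝ)) :=
      fun α j => (hH.measurable α).comp (measurable_id.add_const _)
    have hGm : ∀ α, Measurable (G α) := fun α => Finset.measurable_fun_sum _ fun j _ => hmt α j
    set k := powerKernel (Int.fract s * p) with hk
    have hkm : Measurable (Function.uncurry k) := measurable_powerKernel _
    have hfin : ∀ α, (α ≤ fun _ => ⌊s⌋₊) → ∀ e : Finset (Fin d), (Int.fract s ≠ 0 ∨ e = ∅) →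
        semiIntegral volume k p e (G α) < ⊤ := by
      intro α hα e he
      rw [semiIntegral_volume_eq hkm p e (hGm α)]
      refine pairEnergy_finset_sum_lt_top _ hkm hp e S (hmt α) fun j _ => ?_
      rw [← semiIntegral_volume_eq hkm p e (hmt α j), semiIntegral_volume_comp_add]
      exact lt_of_le_of_lt (hker α hα e he) hM.lt_top
    classical
    -- Energies not required for integer `s` are set to `0`, so that the sum of all of them is a
    -- finite common bound.
    set Mf : (Fin d → ℕ) → Finset (Fin d) → ℝ≥0∞ := fun α e =>
      if Int.fract s ≠ 0 ∨ e = ∅ then semiIntegral volume k p e (G α) else 0 with hMf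
    refine (hle ℓ (periodize H) G (∑ α ∈ Finset.Iic (fun _ : Fin d => ⌊s⌋₊), ∑ e, Mf α e)
      hGm (fun α hα => ?_) fun α hα e he => ?_).2 ?_
    · refine IsWeakDeriv.congr (IsWeakDeriv.finset_sum S fun j _ =>
        ((hH.isWeakDeriv α hα).comp_add fun i => -(j i : ℝ)).mono) ?_
        (Filter.EventuallyEq.refl _ _)
      filter_upwards [ae_restrict_mem (isOpen_box _ _).measurableSet] with x hx
      exact (periodize_eq_sum hR hH.eq_zero hn hx).symm
    · calc _ ≤ semiIntegral volume k p e (G α) := semiIntegral_intervalMeasure_le _ _ _ _ _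
        _ = Mf α e := by simp only [hMf, if_pos he]
        _ ≤ ∑ e, Mf α e := Finset.single_le_sum (f := Mf α) (fun _ _ => zero_le)
            (Finset.mem_univ e)
        _ ≤ _ := Finset.single_le_sum (f := fun α => ∑ e, Mf α e) (fun _ _ => zero_le)
            (Finset.mem_Iic.2 hα)
    · refine ENNReal.sum_ne_top.2 fun α hα => ENNReal.sum_ne_top.2 fun e _ => ?_
      simp only [hMf]
      split_ifs with he
      · exact (hfin α (Finset.mem_Iic.1 hα) e he).ne
      · simp

end Periodic

/-! ### Operators between the periodic and the Gaussian spaces -/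

section Transfer

/-- The domination hypothesis makes `f ↦ w · (f ∘ τ)` well defined on classes modulo null sets and
bounded on `L_q`. Both the localization to the unit cube and the way back have this form. -/
theorem exists_weighted_comp {X Y : Type*} [MeasurableSpace X] [MeasurableSpace Y]
    (𝕜 : Type*) [RCLike 𝕜] {μ : Measure X} {ν : Measure Y} {τ : X → Y} (hτ : Measurable τ)
    {w : X → ℝ} (hw : Measurable w) (hw1 : ∀ x, |w x| ≤ 1) {D : ℝ≥0∞} (hD : D ≠ ⊤)
    (hle : (μ.restrict {x | w x ≠ 0}).map τ ≤ D • ν) {q : ℝ} (hq : 1 ≤ q) :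
    ∃ T : Lp 𝕜 (ENNReal.ofReal q) ν →ₗ[𝕜] Lp 𝕜 (ENNReal.ofReal q) μ,
      (∀ f, T f =ᵐ[μ] fun x => w x • f (τ x)) ∧
      ∃ K : ℝ, ∀ f, ‖T f‖ ≤ K * ‖f‖ := by
  have hq0 : 0 < q := by linarith
  have hset : MeasurableSet {x | w x ≠ 0} := (hw (measurableSet_singleton 0)).compl
  have hae : ∀ u v : Y → 𝕜, u =ᵐ[ν] v → ∀ᵐ x ∂μ, w x • u (τ x) = w x • v (τ x) := by
    intro u v huv
    have h1 : ∀ᵐ x ∂(μ.restrict {x | w x ≠ 0}), u (τ x) = v (τ x) :=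
      ae_of_ae_map hτ.aemeasurable
        ((Measure.absolutelyContinuous_of_le_smul hle).ae_le huv)
    filter_upwards [(ae_restrict_iff' hset).1 h1] with x hx
    by_cases h0 : w x = 0
    · simp [h0]
    · rw [hx h0]
  have hbound : ∀ f : Lp 𝕜 (ENNReal.ofReal q) ν,
      eLpNorm (fun x => w x • f (τ x)) (ENNReal.ofReal q) μ ≤
        D ^ (1 / q) * eLpNorm f (ENNReal.ofReal q) ν := by
    intro f
    have hfm : Measurable f := (Lp.stronglyMeasurable f).measurable
    have h1 : eLpNorm (fun x => w x • f (τ x)) (ENNReal.ofReal q) μ ^ q ≤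
        D * eLpNorm f (ENNReal.ofReal q) ν ^ q := by
      rw [← lintegral_enorm_rpow_eq_eLpNorm _ hq0, ← lintegral_enorm_rpow_eq_eLpNorm _ hq0]
      calc ∫⁻ x, ‖w x • f (τ x)‖ₑ ^ q ∂μ
          ≤ ∫⁻ x, {x | w x ≠ 0}.indicator (fun x => ‖f (τ x)‖ₑ ^ q) x ∂μ := by
            refine lintegral_mono fun x => ?_
            by_cases h0 : w x = 0
            · simp [h0, hq0]
            · rw [Set.indicator_of_mem (show x ∈ {x | w x ≠ 0} from h0), enorm_smul]
              refine ENNReal.rpow_le_rpow ?_ hq0.le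
              refine mul_le_of_le_one_left' ?_
              rw [Real.enorm_eq_ofReal_abs]
              exact ENNReal.ofReal_le_one.2 (hw1 x)
        _ = ∫⁻ y, ‖f y‖ₑ ^ q ∂((μ.restrict {x | w x ≠ 0}).map τ) := by
            rw [lintegral_indicator hset, lintegral_map (hfm.enorm.pow_const q) hτ]
        _ ≤ ∫⁻ y, ‖f y‖ₑ ^ q ∂(D • ν) := lintegral_mono' hle le_rfl
        _ = _ := by rw [lintegral_smul_measure, smul_eq_mul]
    calc _ = (eLpNorm (fun x => w x • f (τ x)) (ENNReal.ofReal q) μ ^ q) ^ (1 / q) := by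
          rw [← ENNReal.rpow_mul, mul_one_div_cancel hq0.ne', ENNReal.rpow_one]
      _ ≤ (D * eLpNorm f (ENNReal.ofReal q) ν ^ q) ^ (1 / q) :=
          ENNReal.rpow_le_rpow h1 (by positivity)
      _ = _ := by
          rw [ENNReal.mul_rpow_of_nonneg _ _ (by positivity), ← ENNReal.rpow_mul,
            mul_one_div_cancel hq0.ne', ENNReal.rpow_one]
  have hDq : D ^ (1 / q) ≠ ⊤ := ENNReal.rpow_ne_top_of_nonneg (by positivity) hD
  have hmem : ∀ f : Lp 𝕜 (ENNReal.ofReal q) ν,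
      MemLp (fun x => w x • f (τ x)) (ENNReal.ofReal q) μ := fun f =>
    ⟨(hw.smul ((Lp.stronglyMeasurable f).measurable.comp hτ)).aestronglyMeasurable,
      lt_of_le_of_lt (hbound f) (ENNReal.mul_lt_top hDq.lt_top (Lp.eLpNorm_lt_top f))⟩
  refine ⟨{ toFun := fun f => (hmem f).toLp, map_add' := fun f g => ?_, map_smul' := fun c f => ?_ },
    fun f => (hmem f).coeFn_toLp, (D ^ (1 / q)).toReal, fun f => ?_⟩
  · rw [← MemLp.toLp_add]
    refine MemLp.toLp_congr _ _ ?_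
    filter_upwards [hae _ _ (Lp.coeFn_add f g)] with x hx
    rw [hx]
    simp [smul_add]
  · rw [RingHom.id_apply, ← MemLp.toLp_const_smul]
    refine MemLp.toLp_congr _ _ ?_
    filter_upwards [hae _ _ (Lp.coeFn_smul c f)] with x hx
    rw [hx]
    simp
  · change ‖(hmem f).toLp‖ ≤ _
    rw [Lp.norm_toLp, Lp.norm_def, ← ENNReal.toReal_mul]
    exact ENNReal.toReal_mono (ENNReal.mul_ne_top hDq (Lp.eLpNorm_ne_top f)) (hbound f)

variable {d : ℕ} {𝕜 : Type*} [RCLike 𝕜]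

theorem ofReal_norm_rpow_eq_lintegral {X : Type*} [MeasurableSpace X] {μ : Measure X} {q : ℝ}
    (hq : 0 < q) (f : Lp 𝕜 (ENNReal.ofReal q) μ) :
    ENNReal.ofReal ‖f‖ ^ q = ∫⁻ x, ‖f x‖ₑ ^ q ∂μ := by
  rw [lintegral_enorm_rpow_eq_eLpNorm μ hq, Lp.norm_def,
    ENNReal.ofReal_toReal (Lp.eLpNorm_ne_top f)]

instance : IsProbabilityMeasure (unitCubeMeasure d) := by
  unfold unitCubeMeasure prodMeasure; infer_instance

/-- The `L_q` norm is at most the `L_p` norm on a probability space, and the latter is the term of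
order zero. This is the error bound on tiles that receive no rank. -/
theorem eLpNorm_le_normPer (s : ℝ) {p q : ℝ} (hq : 1 ≤ q) (hqp : q ≤ p)
    {g : (Fin d → ℝ) → 𝕜} (hg : MemLp g (ENNReal.ofReal q) (unitCubeMeasure d)) :
    eLpNorm g (ENNReal.ofReal q) (unitCubeMeasure d) ≤ normPer s p g := by
  have hp : 0 < p := by linarith
  have hu : unitCubeMeasure d =
      (volume : Measure (Fin d → ℝ)).restrict (box d (Set.Ioo (-(1 / 2)) (1 / 2))) :=
    prodMeasure_intervalMeasure _
  have hint : Integrable g (unitCubeMeasure d) := hg.integrable (by simpa using hq)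
  have hloc : LocallyIntegrableOn g (box d (Set.Ioo (-(1 / 2)) (1 / 2))) := by
    rw [hu] at hint
    exact IntegrableOn.locallyIntegrableOn hint
  have hae : weakDeriv (box d (Set.Ioo (-(1 / 2)) (1 / 2))) 0 g =ᵐ[unitCubeMeasure d] g := by
    rw [hu]
    exact (isWeakDeriv_zero hloc).weakDeriv_ae_eq (isOpen_box _ _)
  have h1 := eLpNorm_weakDeriv_rpow_le_normMix (Set.Ioo (-(1 / 2)) (1 / 2))
    (intervalMeasure (1 / 2)) (powerKernel (Int.fract s * p)) s hp g
    (β := 0) (fun _ => Nat.zero_le _)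
  rw [ENNReal.rpow_le_rpow_iff hp] at h1
  calc eLpNorm g (ENNReal.ofReal q) (unitCubeMeasure d)
      ≤ eLpNorm g (ENNReal.ofReal p) (unitCubeMeasure d) :=
        eLpNorm_le_eLpNorm_of_exponent_le (ENNReal.ofReal_le_ofReal hqp) hg.1
    _ = eLpNorm (weakDeriv (box d (Set.Ioo (-(1 / 2)) (1 / 2))) 0 g) (ENNReal.ofReal p)
          (unitCubeMeasure d) := (eLpNorm_congr_ae hae).symm
    _ ≤ _ := h1

theorem ofReal_norm_le_normPer (s : ℝ) {p q : ℝ} (hq : 1 ≤ q) (hqp : q ≤ p) (g : PerLp 𝕜 d q) :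
    ENNReal.ofReal ‖g‖ ≤ normPer s p g := by
  rw [Lp.norm_def, ENNReal.ofReal_toReal (Lp.eLpNorm_ne_top g)]
  exact eLpNorm_le_normPer s hq hqp (Lp.memLp g)

/-- A smooth cutoff function for the cube `[-1/4, 1/4)`. -/
structure IsCutoff (ψ : ℝ → ℝ) (R : ℝ) : Prop where
  contDiff : ContDiff ℝ ∞ ψ
  lt_half : R < 1 / 2
  eq_zero : ∀ u, u ∉ Set.Icc (-R) R → ψ u = 0
  eq_one : ∀ u, u ∈ Set.Icc (-(1 / 4) : ℝ) (1 / 4) → ψ u = 1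
  abs_le_one : ∀ u, |ψ u| ≤ 1

theorem exists_isCutoff : ∃ ψ R, IsCutoff ψ R := by
  -- The plateau `[-1/4, 1/4]` covers a tile of side `1/2`, and `3/8 < 1/2` leaves a margin for
  -- periodization.
  let b : ContDiffBump (0 : ℝ) := ⟨1 / 4, 3 / 8, by norm_num, by norm_num⟩
  refine ⟨b, 3 / 8, b.contDiff, by norm_num, fun u hu => ?_, fun u hu => ?_, fun u => ?_⟩
  · refine b.zero_of_le_dist ?_
    by_contra h
    push Not at h
    rw [Real.dist_eq, sub_zero] at h
    exact hu ⟨(abs_le.1 h.le).1, (abs_le.1 h.le).2⟩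
  · refine b.one_of_mem_closedBall ?_
    rw [Metric.mem_closedBall, Real.dist_eq, sub_zero]
    exact abs_le.2 ⟨hu.1, hu.2⟩
  · rw [abs_of_nonneg b.nonneg]
    exact b.le_one

/-- The local estimate in its final form: `c` enters only through the `p`-th root of `growth`. -/
theorem exists_normPer_localized_le {ψ : ℝ → ℝ} {R : ℝ} (hψ : IsCutoff ψ R) {s p θ : ℝ}
    (hp : 1 < p) (hθ0 : 0 ≤ θ) (hθ : θ < 1 / 2) :
    ∃ (A : ℝ) (K : ℝ≥0∞), 0 < A ∧ K ≠ ⊤ ∧ ∀ f : (Fin d → ℝ) → 𝕜, MemGauss s p f →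
      normGauss s p f ≠ ⊤ → ∀ (c : Fin d → ℝ) (g : (Fin d → ℝ) → 𝕜),
        g =ᵐ[unitCubeMeasure d] (fun x => tensorDeriv ψ 0 x • f (x + c)) →
        MemPer s p g ∧ normPer s p g ≤
          K * ENNReal.ofReal (growth A θ c) ^ (1 / p) * normGauss s p f := by
  have hp0 : 0 < p := by linarith
  obtain ⟨σ, hσ, hσp, hσs⟩ : ∃ σ : ℝ, 0 < σ ∧ σ < p ∧ (Int.fract s ≠ 0 → σ = Int.fract s * p) := by
    by_cases h : Int.fract s = 0
    -- For integer `s` no fractional energy enters; any `σ` in `(0, p)` would do.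
    · exact ⟨p / 2, by positivity, by linarith, fun h' => absurd h h'⟩
    · have h0 : 0 < Int.fract s := lt_of_le_of_ne (Int.fract_nonneg s) (Ne.symm h)
      exact ⟨Int.fract s * p, by positivity, by nlinarith [Int.fract_lt_one s], fun _ => rfl⟩
  obtain ⟨A, K, hA, hK, hloc⟩ := exists_isLocalized (d := d) (𝕜 := 𝕜) hψ.contDiff hψ.lt_half
    hψ.eq_zero hp hσ hσp hσs hθ0 hθ
  obtain ⟨K', hK', hper⟩ := exists_normPer_le (d := d) (𝕜 := 𝕜) hp.le hσs hψ.lt_half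
  refine ⟨A, K' * K ^ (1 / p), hA, ENNReal.mul_ne_top hK'
    (ENNReal.rpow_ne_top_of_nonneg (by positivity) hK), fun f hf hN c g hg => ?_⟩
  obtain ⟨F, hF0, hF⟩ := exists_isJet hp0 hf
  obtain ⟨h, hh⟩ := hloc _ F hF c
  have hac : unitCubeMeasure d ≪ volume := by
    rw [unitCubeMeasure, prodMeasure_intervalMeasure]
    exact Measure.restrict_le_self.absolutelyContinuous
  have hFc : ∀ᵐ x ∂(volume : Measure (Fin d → ℝ)), F 0 (x + c) = f (x + c) :=
    (measurePreserving_add_right volume c).quasiMeasurePreserving.ae hF0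
  have hg' : g =ᵐ[unitCubeMeasure d] fun x => tensorDeriv ψ 0 x • F 0 (x + c) := by
    refine hg.trans ?_
    filter_upwards [hac.ae_le hFc] with x hx
    rw [hx]
  obtain ⟨h1, h2⟩ := hper _ _ h hh g hg'
  refine ⟨h2 ?_, h1.trans (le_of_eq ?_)⟩
  · exact ENNReal.mul_ne_top hK (ENNReal.mul_ne_top ENNReal.ofReal_ne_top
      (ENNReal.rpow_ne_top_of_nonneg hp0.le hN))
  · rw [ENNReal.mul_rpow_of_nonneg _ _ (by positivity),
      ENNReal.mul_rpow_of_nonneg _ _ (by positivity), ← ENNReal.rpow_mul,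
      mul_one_div_cancel hp0.ne', ENNReal.rpow_one]
    ring

theorem exists_localization {ψ : ℝ → ℝ} {R : ℝ} (hψ : IsCutoff ψ R) {q : ℝ} (hq : 1 ≤ q)
    (c : Fin d → ℝ) :
    ∃ T : GaussLp 𝕜 d q →ₗ[𝕜] PerLp 𝕜 d q,
      (∀ f, T f =ᵐ[unitCubeMeasure d] fun x => tensorDeriv ψ 0 x • f (x + c)) ∧
      ∃ K : ℝ, ∀ f, ‖T f‖ ≤ K * ‖f‖ := by
  refine exists_weighted_comp 𝕜 (measurable_id.add_const c)
    (measurable_tensorDeriv hψ.contDiff 0) (fun x => ?_) (D := ∏ j,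
      ENNReal.ofReal (√(2 * Real.pi) * Real.exp ((|c j| + 1 / 2) ^ 2 / 2)))
    (ENNReal.prod_ne_top fun _ _ => ENNReal.ofReal_ne_top) ?_ hq
  · rw [tensorDeriv, Finset.abs_prod]
    refine Finset.prod_le_one (fun _ _ => abs_nonneg _) fun i _ => ?_
    simpa using hψ.abs_le_one (x i)
  · exact (Measure.map_mono Measure.restrict_le_self (measurable_id.add_const c)).trans
      (map_add_pi_intervalMeasure_le (Fin d) c)

/-- The half-open cube of side length `1/2` centred at `c`. -/
def tile (c : Fin d → ℝ) : Set (Fin d → ℝ) :=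
  Set.univ.pi fun j => Set.Ico (c j - 1 / 4) (c j + 1 / 4)

theorem measurableSet_tile (c : Fin d → ℝ) : MeasurableSet (tile c) :=
  MeasurableSet.univ_pi fun _ => measurableSet_Ico

theorem map_sub_gaussMeasure_le (c : Fin d → ℝ) :
    ((gaussMeasure d).restrict (tile c)).map (fun x => x - c) ≤
      (∏ j, ENNReal.ofReal (Real.exp (-(c j ^ 2 - |c j|) / 2))) • unitCubeMeasure d := by
  have h1 := pi_le_smul_pi (fun j => map_sub_gaussianReal_le (c j))
  have h2 := Measure.pi_map_pi
    (μ := fun j => (gaussianReal 0 1).restrict (Set.Ico (c j - 1 / 4) (c j + 1 / 4)))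
    (f := fun j x => x - c j) (fun j => by fun_prop)
  rw [← h2, ← Measure.restrict_pi_pi] at h1
  exact h1

theorem exists_globalization {q : ℝ} (hq : 1 ≤ q) (c : Fin d → ℝ) :
    ∃ S : PerLp 𝕜 d q →ₗ[𝕜] GaussLp 𝕜 d q,
      (∀ g, S g =ᵐ[gaussMeasure d] fun x => (tile c).indicator (1 : (Fin d → ℝ) → ℝ) x • g (x - c)) ∧
      ∃ K : ℝ, ∀ g, ‖S g‖ ≤ K * ‖g‖ := by
  refine exists_weighted_comp 𝕜 (measurable_id.sub_const c)
    (measurable_one.indicator (measurableSet_tile c)) (fun x => ?_)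
    (D := ∏ j, ENNReal.ofReal (Real.exp (-(c j ^ 2 - |c j|) / 2)))
    (ENNReal.prod_ne_top fun _ _ => ENNReal.ofReal_ne_top) ?_ hq
  · by_cases h : x ∈ tile c <;> simp [h]
  · have : {x | (tile c).indicator (1 : (Fin d → ℝ) → ℝ) x ≠ 0} = tile c := by
      ext x
      by_cases h : x ∈ tile c <;> simp [h]
    rw [this]
    exact map_sub_gaussMeasure_le c

end Transfer

/-! ### Summation over the tiles -/

section Summation

variable {d : ℕ}

/-- A finite set of indices is enclosed in the box spanned by its coordinate projections, and the
sum over a box factors. -/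
theorem tsum_prod_le_prod_tsum (φ : ℤ → ℝ≥0∞) :
    ∑' k : Fin d → ℤ, ∏ j, φ (k j) ≤ (∑' i, φ i) ^ d := by
  classical
  rw [ENNReal.tsum_eq_iSup_sum]
  refine iSup_le fun s => ?_
  calc ∑ k ∈ s, ∏ j, φ (k j)
      ≤ ∑ k ∈ Fintype.piFinset fun j => s.image fun k => k j, ∏ j, φ (k j) :=
        Finset.sum_le_sum_of_subset fun k hk =>
          Fintype.mem_piFinset.2 fun j => Finset.mem_image_of_mem _ hk
    _ = ∏ j, ∑ i ∈ s.image fun k => k j, φ i := by rw [Finset.prod_univ_sum]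
    _ ≤ ∏ _j : Fin d, ∑' i, φ i := Finset.prod_le_prod' fun j _ => ENNReal.sum_le_tsum _
    _ = _ := by simp

theorem summable_exp_neg_abs : Summable fun i : ℤ => Real.exp (-|(i : ℝ)|) :=
  Summable.of_nat_of_neg (by simpa using Real.summable_exp_neg_nat)
    (by simpa using Real.summable_exp_neg_nat)

theorem tsum_ofReal_exp_quadratic_ne_top {δ : ℝ} (hδ : 0 < δ) (β c : ℝ) :
    ∑' i : ℤ, ENNReal.ofReal (c * Real.exp (-δ * (i : ℝ) ^ 2 + β * |(i : ℝ)|)) ≠ ⊤ := by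
  refine Summable.tsum_ofReal_ne_top ?_
  refine Summable.mul_left c ?_
  refine Summable.of_nonneg_of_le (fun _ => Real.exp_nonneg _) (fun i => ?_)
    -- Completing the square: `-δx² + βx ≤ (β+1)²/(4δ) - x`.
    (summable_exp_neg_abs.mul_left (Real.exp ((β + 1) ^ 2 / (4 * δ))))
  rw [← Real.exp_add]
  refine Real.exp_le_exp.2 ?_
  rw [← sq_abs (i : ℝ), ← sub_le_iff_le_add, le_div_iff₀ (by positivity)]
  nlinarith [sq_nonneg (2 * δ * |(i : ℝ)| - (β + 1))]

theorem exists_sampling_weight :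
    ∃ Z : ℝ, 0 < Z ∧ ∑' i : ℤ, ENNReal.ofReal (Real.exp (-|(i : ℝ)|) / Z) = 1 := by
  have hZ : 0 < ∑' i : ℤ, Real.exp (-|(i : ℝ)|) :=
    summable_exp_neg_abs.tsum_pos (fun _ => Real.exp_nonneg _) 0 (Real.exp_pos _)
  refine ⟨_, hZ, ?_⟩
  rw [← ENNReal.ofReal_tsum_of_nonneg (fun _ => by positivity)
    (summable_exp_neg_abs.div_const _), tsum_div_const, div_self hZ.ne', ENNReal.ofReal_one]

/-- For `⌊x⌋ ≥ 1` the integer part is at least `x/2`, so rounding costs a factor `2^a`; the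
logarithm is monotone. -/
theorem rate_le {C a b x : ℝ} {n : ℕ} (hC : 0 < C) (ha : 0 < a) (hb : 0 ≤ b) (hx : 0 < x)
    (hxn : x ≤ n) (hm : 1 ≤ ⌊x⌋₊) :
    C * (⌊x⌋₊ : ℝ) ^ (-a) * Real.log (max (⌊x⌋₊ : ℝ) 2) ^ b ≤
      (C * 2 ^ a + Real.log 2 ^ (-b)) * x ^ (-a) * Real.log (max (n : ℝ) 2) ^ b := by
  have hl2 : 0 < Real.log 2 := Real.log_pos one_lt_two
  have hm0 : (1 : ℝ) ≤ ⌊x⌋₊ := by exact_mod_cast hm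
  have h1 : (⌊x⌋₊ : ℝ) ≤ x := Nat.floor_le hx.le
  have h2 : x / 2 ≤ ⌊x⌋₊ := by
    have := Nat.lt_floor_add_one x
    linarith
  have h3 : (⌊x⌋₊ : ℝ) ^ (-a) ≤ 2 ^ a * x ^ (-a) := by
    calc (⌊x⌋₊ : ℝ) ^ (-a) ≤ (x / 2) ^ (-a) :=
          Real.rpow_le_rpow_of_nonpos (by positivity) h2 (by linarith)
      _ = 2 ^ a * x ^ (-a) := by
          rw [Real.div_rpow hx.le zero_le_two, Real.rpow_neg zero_le_two, div_inv_eq_mul, mul_comm]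
  have h4 : Real.log (max (⌊x⌋₊ : ℝ) 2) ≤ Real.log (max (n : ℝ) 2) :=
    Real.log_le_log (by positivity) (max_le_max (h1.trans hxn) le_rfl)
  have h5 : 0 ≤ Real.log (max (⌊x⌋₊ : ℝ) 2) :=
    Real.log_nonneg (one_le_two.trans (le_max_right _ _))
  have h6 : 0 ≤ Real.log 2 ^ (-b) * x ^ (-a) := by positivity
  refine mul_le_mul ?_ (Real.rpow_le_rpow h5 h4 hb) (by positivity) (by positivity)
  calc C * (⌊x⌋₊ : ℝ) ^ (-a) ≤ C * (2 ^ a * x ^ (-a)) := mul_le_mul_of_nonneg_left h3 hC.le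
    _ ≤ _ := by rw [add_mul]; linarith

/-- For `x = n w_k < 1` no rank is assigned, and the claimed rate already exceeds `1`. The summand
`(log 2)^{-b}` of the constant normalizes the logarithmic factor. -/
theorem one_le_rate {C a b x : ℝ} {n : ℕ} (hC : 0 < C) (ha : 0 < a) (hb : 0 ≤ b) (hx : 0 < x)
    (hx1 : x < 1) :
    1 ≤ (C * 2 ^ a + Real.log 2 ^ (-b)) * x ^ (-a) * Real.log (max (n : ℝ) 2) ^ b := by
  have hl2 : 0 < Real.log 2 := Real.log_pos one_lt_two
  have h1 : 1 ≤ x ^ (-a) := Real.one_le_rpow_of_pos_of_le_one_of_nonpos hx hx1.le (by linarith)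
  have h2 : Real.log 2 ^ b ≤ Real.log (max (n : ℝ) 2) ^ b :=
    Real.rpow_le_rpow hl2.le (Real.log_le_log two_pos (le_max_right _ _)) hb
  have h3 : 0 ≤ C * (2 : ℝ) ^ a := by positivity
  calc (1 : ℝ) = Real.log 2 ^ (-b) * 1 * Real.log 2 ^ b := by
        rw [mul_one, ← Real.rpow_add hl2]; simp
    _ ≤ _ := by
        refine mul_le_mul (mul_le_mul (by linarith) h1 zero_le_one (by positivity)) h2
          (by positivity) (by positivity)

/-- The centre of the tile with index `k`. -/
noncomputable def centre (k : Fin d → ℤ) : Fin d → ℝ := fun j => (k j : ℝ) / 2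

theorem iUnion_tile_centre : ⋃ k : Fin d → ℤ, tile (centre k) = Set.univ := by
  refine Set.eq_univ_of_forall fun x => Set.mem_iUnion.2 ⟨fun j => ⌊2 * x j + 1 / 2⌋, fun j _ => ?_⟩
  have h1 := Int.floor_le (2 * x j + 1 / 2)
  have h2 := Int.lt_floor_add_one (2 * x j + 1 / 2)
  simp only [centre, Set.mem_Ico]
  constructor <;> linarith

/-- The bound for the Gaussian measure of a tile. -/
noncomputable def tileWeight (c : Fin d → ℝ) : ℝ≥0∞ :=
  ∏ j, ENNReal.ofReal (Real.exp (-(c j ^ 2 - |c j|) / 2))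

/-- The summand factors over the coordinates. With `c_j = i/2` the quadratic exponent is `-i²/8`
from the tile mass plus `(1-θ)(q/p) i²/4` from `growth`, which is `-δ i²`. The sampling weights and
the remaining terms are at most exponential in `|i|` and go into `β`. -/
theorem tsum_tileWeight_ne_top {p q a θ A Z : ℝ} (hp : 0 < p)
    (hθ : (1 - θ) * (q / p) < 1 / 2) (hA : 0 < A) (hZ : 0 < Z) :
    ∑' k : Fin d → ℤ, tileWeight (centre k) *
      (ENNReal.ofReal ((∏ j, Real.exp (-|(k j : ℝ)|) / Z) ^ (-a)) *
        ENNReal.ofReal (growth A θ (centre k)) ^ (1 / p)) ^ q ≠ ⊤ := by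
  set δ : ℝ := (1 / 2 - (1 - θ) * (q / p)) / 4 with hδ
  set β : ℝ := 1 / 4 + a * q + q / p with hβ
  set c : ℝ := Z ^ (a * q) * A ^ (q / p) with hc
  have hδ0 : 0 < δ := by rw [hδ]; linarith
  set φ : ℤ → ℝ≥0∞ := fun i => ENNReal.ofReal (c * Real.exp (-δ * (i : ℝ) ^ 2 + β * |(i : ℝ)|))
    with hφ
  have hterm : ∀ k : Fin d → ℤ, tileWeight (centre k) *
      (ENNReal.ofReal ((∏ j, Real.exp (-|(k j : ℝ)|) / Z) ^ (-a)) *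
        ENNReal.ofReal (growth A θ (centre k)) ^ (1 / p)) ^ q = ∏ j, φ (k j) := by
    intro k
    have hg : growth A θ (centre k) =
        ∏ j, (A * Real.exp ((1 - θ) * centre k j ^ 2 + 2 * |centre k j|)) := rfl
    rw [tileWeight, hg, ← Real.finsetProd_rpow _ _ (fun j _ => by positivity),
      ENNReal.ofReal_rpow_of_pos (Finset.prod_pos fun j _ => by positivity),
      ← Real.finsetProd_rpow _ _ (fun j _ => by positivity),
      ← ENNReal.ofReal_mul (Finset.prod_nonneg fun j _ => by positivity),
      ← Finset.prod_mul_distrib,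
      ENNReal.ofReal_rpow_of_pos (Finset.prod_pos fun j _ => by positivity),
      ← Real.finsetProd_rpow _ _ (fun j _ => by positivity),
      ENNReal.ofReal_prod_of_nonneg (fun j _ => by positivity), ← Finset.prod_mul_distrib]
    refine Finset.prod_congr rfl fun j _ => ?_
    rw [← ENNReal.ofReal_mul (Real.exp_nonneg _)]
    simp only [hφ, centre]
    congr 1
    set i : ℝ := (k j : ℝ) with hi
    rw [Real.div_rpow (Real.exp_nonneg _) hZ.le, ← Real.exp_mul, Real.rpow_neg hZ.le,
      div_inv_eq_mul, Real.mul_rpow hA.le (Real.exp_nonneg _), ← Real.exp_mul,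
      Real.mul_rpow (by positivity) (by positivity), Real.mul_rpow (by positivity) (by positivity),
      Real.mul_rpow (by positivity) (by positivity), ← Real.rpow_mul hZ.le, ← Real.rpow_mul hA.le,
      ← Real.exp_mul, ← Real.exp_mul, hc, one_div, inv_mul_eq_div]
    have e : Real.exp (-δ * i ^ 2 + β * |i|) = Real.exp (-((i / 2) ^ 2 - |i / 2|) / 2) *
        Real.exp (-|i| * -a * q) *
          Real.exp (((1 - θ) * (i / 2) ^ 2 + 2 * |i / 2|) * p⁻¹ * q) := by
      rw [← Real.exp_add, ← Real.exp_add]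
      congr 1
      rw [abs_div, abs_two, hδ, hβ]
      field_simp
      ring
    rw [e]
    ring
  simp only [hterm]
  exact ne_top_of_le_ne_top (ENNReal.pow_ne_top (tsum_ofReal_exp_quadratic_ne_top hδ0 β c))
    (tsum_prod_le_prod_tsum φ)

/-- With `x = q/p` and `θ = x/2`, the condition `(1 - x/2)x < 1/2` is `(1 - x)² > 0`; this is where
`q < p` is decisive. -/
theorem exists_growth_exponent {p q : ℝ} (hq : 0 < q) (hqp : q < p) :
    ∃ θ : ℝ, 0 ≤ θ ∧ θ < 1 / 2 ∧ (1 - θ) * (q / p) < 1 / 2 := by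
  have hp : 0 < p := hq.trans hqp
  have h1 : 0 < q / p := by positivity
  have h2 : q / p < 1 := (div_lt_one hp).2 hqp
  refine ⟨(1 - (1 - q / p)) / 2, by linarith, by linarith, ?_⟩
  nlinarith

end Summation

/-! ### Decomposition of the global error into errors on tiles -/

section Error

variable {d : ℕ} {𝕜 : Type*} [RCLike 𝕜]

theorem coeFn_finset_sum_Lp {X ι : Type*} [MeasurableSpace X] {μ : Measure X} {r : ℝ≥0∞}
    (F : Finset ι) (u : ι → Lp 𝕜 r μ) :
    ⇑(∑ i ∈ F, u i) =ᵐ[μ] fun x => ∑ i ∈ F, u i x := by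
  classical
  induction F using Finset.induction with
  | empty =>
    simp only [Finset.sum_empty]
    exact Lp.coeFn_zero _ _ _
  | insert i F hi ih =>
    simp only [Finset.sum_insert hi]
    filter_upwards [Lp.coeFn_add (u i) (∑ i ∈ F, u i), ih] with x h1 h2
    rw [h1, Pi.add_apply, h2]

theorem tile_centre_disjoint {k k' : Fin d → ℤ} (h : k' ≠ k) {x : Fin d → ℝ}
    (hx : x ∈ tile (centre k)) : x ∉ tile (centre k') := by
  obtain ⟨j, hj⟩ := Function.ne_iff.1 h
  intro hx'
  refine hj ?_
  have h1 := hx j (Set.mem_univ j)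
  have h2 := hx' j (Set.mem_univ j)
  simp only [centre, Set.mem_Ico] at h1 h2
  have e1 : (k' j : ℝ) < k j + 1 := by linarith
  have e2 : (k j : ℝ) < k' j + 1 := by linarith
  have e3 : k' j < k j + 1 := by exact_mod_cast e1
  have e4 : k j < k' j + 1 := by exact_mod_cast e2
  omega

/-- The tiles are disjoint and the cutoff is `1` on the relevant tile, so `f` minus its
approximation is there exactly the translate of `T k f - A k (T k f)`. The change of measure
contributes the tile weight. Outside `F` both the operator and its contribution vanish. -/
theorem ofReal_norm_sub_rpow_le_tsum {ψ : ℝ → ℝ} {R : ℝ} (hψ : IsCutoff ψ R) {q : ℝ} (hq : 1 ≤ q)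
    {T : (Fin d → ℤ) → GaussLp 𝕜 d q →ₗ[𝕜] PerLp 𝕜 d q}
    (hT : ∀ k f, T k f =ᵐ[unitCubeMeasure d] fun x => tensorDeriv ψ 0 x • f (x + centre k))
    {S : (Fin d → ℤ) → PerLp 𝕜 d q →ₗ[𝕜] GaussLp 𝕜 d q}
    (hS : ∀ k g, S k g =ᵐ[gaussMeasure d] fun x =>
      (tile (centre k)).indicator (1 : (Fin d → ℝ) → ℝ) x • g (x - centre k))
    {F : Finset (Fin d → ℤ)} {A : (Fin d → ℤ) → PerLp 𝕜 d q →ₗ[𝕜] PerLp 𝕜 d q}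
    (hA : ∀ k, k ∉ F → A k = 0) (f : GaussLp 𝕜 d q) :
    ENNReal.ofReal ‖f - (∑ k ∈ F, S k ∘ₗ A k ∘ₗ T k) f‖ ^ q ≤
      ∑' k, tileWeight (centre k) * ENNReal.ofReal ‖T k f - A k (T k f)‖ ^ q := by
  have hq0 : 0 < q := by linarith
  set B : GaussLp 𝕜 d q →ₗ[𝕜] GaussLp 𝕜 d q := ∑ k ∈ F, S k ∘ₗ A k ∘ₗ T k with hB
  have hBae : B f =ᵐ[gaussMeasure d] fun x => ∑ k ∈ F,
      (tile (centre k)).indicator (1 : (Fin d → ℝ) → ℝ) x • (A k (T k f)) (x - centre k) := by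
    have e : B f = ∑ k ∈ F, S k (A k (T k f)) := by
      simp [hB, LinearMap.sum_apply]
    rw [e]
    have h1 : ∀ᵐ x ∂(gaussMeasure d), ∀ k, S k (A k (T k f)) x =
        (tile (centre k)).indicator (1 : (Fin d → ℝ) → ℝ) x • (A k (T k f)) (x - centre k) :=
      ae_all_iff.2 fun k => hS k _
    filter_upwards [coeFn_finset_sum_Lp F fun k => S k (A k (T k f)), h1] with x hx h2
    rw [hx]
    exact Finset.sum_congr rfl fun k _ => h2 k
  rw [ofReal_norm_rpow_eq_lintegral hq0, ← setLIntegral_univ, ← iUnion_tile_centre]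
  refine (lintegral_iUnion_le _ _).trans (ENNReal.tsum_le_tsum fun k => ?_)
  set v : PerLp 𝕜 d q := T k f - A k (T k f) with hv
  have hmap := map_sub_gaussMeasure_le (centre k)
  have hmeas : Measurable fun x : Fin d → ℝ => x - centre k := measurable_id.sub_const _
  have hP : ∀ᵐ y ∂(unitCubeMeasure d), v y = T k f y - (A k (T k f)) y ∧
      T k f y = tensorDeriv ψ 0 y • f (y + centre k) ∧ (k ∉ F → (A k (T k f)) y = 0) := by
    have h0 : ∀ᵐ y ∂(unitCubeMeasure d), k ∉ F → (A k (T k f)) y = 0 := by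
      by_cases hk : k ∈ F
      · exact Filter.Eventually.of_forall fun _ h => absurd hk h
      · rw [hA k hk]
        filter_upwards [Lp.coeFn_zero 𝕜 (ENNReal.ofReal q) (unitCubeMeasure d)] with y hy _
        exact hy
    filter_upwards [Lp.coeFn_sub (T k f) (A k (T k f)), hT k f, h0] with y h1 h2 h3
    exact ⟨h1, h2, h3⟩
  have hP' : ∀ᵐ x ∂((gaussMeasure d).restrict (tile (centre k))),
      v (x - centre k) = T k f (x - centre k) - (A k (T k f)) (x - centre k) ∧
      T k f (x - centre k) = tensorDeriv ψ 0 (x - centre k) • f (x - centre k + centre k) ∧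
        (k ∉ F → (A k (T k f)) (x - centre k) = 0) :=
    ae_of_ae_map hmeas.aemeasurable ((Measure.absolutelyContinuous_of_le_smul hmap).ae_le hP)
  have hvm : Measurable fun y => ‖v y‖ₑ ^ q :=
    (Lp.stronglyMeasurable v).measurable.enorm.pow_const q
  calc ∫⁻ x in tile (centre k), ‖(f - B f : GaussLp 𝕜 d q) x‖ₑ ^ q ∂(gaussMeasure d)
      = ∫⁻ x in tile (centre k), ‖v (x - centre k)‖ₑ ^ q ∂(gaussMeasure d) := by
        refine lintegral_congr_ae ?_
        filter_upwards [hP', ae_restrict_mem (measurableSet_tile _), ae_restrict_of_ae hBae,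
          ae_restrict_of_ae (Lp.coeFn_sub f (B f))] with x ⟨h1, h2, h3⟩ hx h4 h5
        have hone : tensorDeriv ψ 0 (x - centre k) = 1 := by
          refine Finset.prod_eq_one fun j _ => ?_
          have hj := hx j (Set.mem_univ j)
          simp only [Set.mem_Ico] at hj
          simp only [Pi.zero_apply, iteratedDeriv_zero, Pi.sub_apply]
          exact hψ.eq_one _ ⟨by linarith [hj.1], by linarith [hj.2]⟩
        have hBx : B f x = (A k (T k f)) (x - centre k) := by
          rw [h4]
          by_cases hk : k ∈ F
          · rw [Finset.sum_eq_single k]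
            · simp [hx]
            · intro k' _ hne
              simp [tile_centre_disjoint hne hx]
            · exact fun h => absurd hk h
          · rw [h3 hk]
            refine Finset.sum_eq_zero fun k' hk' => ?_
            have hne : k' ≠ k := fun h => hk (h ▸ hk')
            simp [tile_centre_disjoint hne hx]
        rw [h5, Pi.sub_apply, hBx, h1, h2, hone, one_smul, sub_add_cancel]
    _ = ∫⁻ y, ‖v y‖ₑ ^ q ∂(((gaussMeasure d).restrict (tile (centre k))).map
          fun x => x - centre k) := (lintegral_map hvm hmeas).symm
    _ ≤ ∫⁻ y, ‖v y‖ₑ ^ q ∂(tileWeight (centre k) • unitCubeMeasure d) := lintegral_mono' hmap le_rfl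
    _ = _ := by
        rw [lintegral_smul_measure, smul_eq_mul, ← ofReal_norm_rpow_eq_lintegral hq0]

end Error

/-! ### Bounded operators -/

section Bounded

/-- Boundedness survives because only finitely many tiles carry an operator; the bound may depend on
`n`. -/
theorem exists_bound_sum_comp {𝕜 : Type*} [RCLike 𝕜] {d : ℕ} {q : ℝ} {ι : Type*} (F : Finset ι)
    {T : ι → GaussLp 𝕜 d q →ₗ[𝕜] PerLp 𝕜 d q} {A : ι → PerLp 𝕜 d q →ₗ[𝕜] PerLp 𝕜 d q}
    {S : ι → PerLp 𝕜 d q →ₗ[𝕜] GaussLp 𝕜 d q} (hq : 1 ≤ q)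
    (hT : ∀ k, ∃ K : ℝ, ∀ f, ‖T k f‖ ≤ K * ‖f‖)
    (hA : ∀ k ∈ F, ∃ K : ℝ, ∀ g, ‖A k g‖ ≤ K * ‖g‖)
    (hS : ∀ k, ∃ K : ℝ, ∀ g, ‖S k g‖ ≤ K * ‖g‖) :
    ∃ K : ℝ, ∀ f, ‖(∑ k ∈ F, S k ∘ₗ A k ∘ₗ T k) f‖ ≤ K * ‖f‖ := by
  have : Fact (1 ≤ ENNReal.ofReal q) := ⟨by simpa using hq⟩
  choose KT hKT using hT
  choose! KA hKA using hA
  choose KS hKS using hS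
  refine ⟨∑ k ∈ F, |KS k| * (|KA k| * KT k), fun f => ?_⟩
  have e : (∑ k ∈ F, S k ∘ₗ A k ∘ₗ T k) f = ∑ k ∈ F, S k (A k (T k f)) := by
    simp [LinearMap.sum_apply]
  rw [e, Finset.sum_mul]
  refine (norm_sum_le _ _).trans (Finset.sum_le_sum fun k hk => ?_)
  calc ‖S k (A k (T k f))‖ ≤ KS k * ‖A k (T k f)‖ := hKS k _
    _ ≤ |KS k| * ‖A k (T k f)‖ := mul_le_mul_of_nonneg_right (le_abs_self _) (norm_nonneg _)
    _ ≤ |KS k| * (|KA k| * (KT k * ‖f‖)) := by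
        refine mul_le_mul_of_nonneg_left ?_ (abs_nonneg _)
        calc ‖A k (T k f)‖ ≤ KA k * ‖T k f‖ := hKA k hk _
          _ ≤ |KA k| * ‖T k f‖ := mul_le_mul_of_nonneg_right (le_abs_self _) (norm_nonneg _)
          _ ≤ _ := mul_le_mul_of_nonneg_left (hKT k f) (abs_nonneg _)
    _ = _ := by ring

end Bounded

end MixedSobolev

/-! ### Distribution of the rank over the tiles and conclusion -/

theorem mainTheorem6 (𝕜 : Type*) [RCLike 𝕜] (d : ℕ) (hd : 1 ≤ d) (s p q a b C : ℝ)
    (hs : 0 < s) (hq : 1 ≤ q) (hqp : q < p) (ha : 0 < a) (hb : 0 ≤ b) (hC : 0 < C) :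
    ∃ C' : ℝ, 0 < C' ∧
      ∀ A : ℕ → (MixedSobolev.PerLp 𝕜 d q →ₗ[𝕜] MixedSobolev.PerLp 𝕜 d q),
        (∀ m : ℕ, 1 ≤ m →
          LinearMap.rank (A m) ≤ (m : Cardinal) ∧
          ∀ g : MixedSobolev.PerLp 𝕜 d q, MixedSobolev.MemPer s p g →
            ENNReal.ofReal ‖g - A m g‖ ≤
              ENNReal.ofReal (C * (m : ℝ) ^ (-a) * Real.log (max (m : ℝ) 2) ^ b) *
                MixedSobolev.normPer s p g) →
        ∀ n : ℕ, 1 ≤ n →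
          ∃ B : MixedSobolev.GaussLp 𝕜 d q →ₗ[𝕜] MixedSobolev.GaussLp 𝕜 d q,
            LinearMap.rank B ≤ (n : Cardinal) ∧
            (∀ f : MixedSobolev.GaussLp 𝕜 d q, MixedSobolev.MemGauss s p f →
              ENNReal.ofReal ‖f - B f‖ ≤
                ENNReal.ofReal (C' * (n : ℝ) ^ (-a) * Real.log (max (n : ℝ) 2) ^ b) *
                  MixedSobolev.normGauss s p f) ∧
            ((∀ m : ℕ, 1 ≤ m → ∃ K : ℝ, ∀ g : MixedSobolev.PerLp 𝕜 d q, ‖A m g‖ ≤ K * ‖g‖) →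
              ∃ K : ℝ, ∀ f : MixedSobolev.GaussLp 𝕜 d q, ‖B f‖ ≤ K * ‖f‖) := by
  classical
  have hq0 : 0 < q := by linarith
  have hp : 1 < p := by linarith
  have hp0 : 0 < p := by linarith
  obtain ⟨ψ, R, hψ⟩ := MixedSobolev.exists_isCutoff
  obtain ⟨θ, hθ0, hθ, hθq⟩ := MixedSobolev.exists_growth_exponent hq0 hqp
  obtain ⟨G, K, hG, hK, hloc⟩ := MixedSobolev.exists_normPer_localized_le (d := d) (𝕜 := 𝕜)
    (s := s) hψ hp hθ0 hθ
  obtain ⟨Z, hZ, hZ1⟩ := MixedSobolev.exists_sampling_weight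
  have hsum := MixedSobolev.tsum_tileWeight_ne_top (d := d) (a := a) hp0 hθq hG hZ
  choose T hT hTb using fun k : Fin d → ℤ =>
    MixedSobolev.exists_localization (𝕜 := 𝕜) hψ hq (MixedSobolev.centre k)
  choose S hS hSb using fun k : Fin d → ℤ =>
    MixedSobolev.exists_globalization (𝕜 := 𝕜) hq (MixedSobolev.centre k)
  -- The fraction of the rank given to a tile: summable, yet decaying only exponentially, so that
  -- `w_k^{-aq}` cannot spoil the Gaussian convergence.
  set w : (Fin d → ℤ) → ℝ := fun k => ∏ j, Real.exp (-|(k j : ℝ)|) / Z with hw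
  have hw0 : ∀ k, 0 < w k := fun k => Finset.prod_pos fun j _ => by positivity
  have hwsum : ∑' k, ENNReal.ofReal (w k) ≤ 1 := by
    have h := MixedSobolev.tsum_prod_le_prod_tsum (d := d)
      fun i => ENNReal.ofReal (Real.exp (-|(i : ℝ)|) / Z)
    rw [hZ1, one_pow] at h
    refine le_trans (le_of_eq (tsum_congr fun k => ?_)) h
    exact ENNReal.ofReal_prod_of_nonneg fun j _ => by positivity
  have hw1 : ∀ k, w k ≤ 1 := fun k =>
    ENNReal.ofReal_le_one.1 ((ENNReal.le_tsum k).trans hwsum)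
  set u : (Fin d → ℤ) → ℝ≥0∞ := fun k => ENNReal.ofReal (w k ^ (-a)) *
    ENNReal.ofReal (MixedSobolev.growth G θ (MixedSobolev.centre k)) ^ (1 / p) with hu
  set V : ℝ≥0∞ := ∑' k, MixedSobolev.tileWeight (MixedSobolev.centre k) * u k ^ q with hV
  set Y : ℝ≥0∞ := K * V ^ (1 / q) with hY
  have hYt : Y ≠ ⊤ := ENNReal.mul_ne_top hK (ENNReal.rpow_ne_top_of_nonneg (by positivity) hsum)
  have hl2 : 0 < Real.log 2 := Real.log_pos one_lt_two
  set C1 : ℝ := C * 2 ^ a + Real.log 2 ^ (-b) with hC1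
  have hC10 : 0 < C1 := by positivity
  -- The `1` only secures positivity. `C1` comes from the rate lemmas, and `Y` combines the local
  -- norm constant with the convergent series.
  refine ⟨C1 * (Y.toReal + 1), by positivity, fun A hA n hn => ?_⟩
  have hn0 : (0 : ℝ) < n := by exact_mod_cast hn
  set L : ℝ := Real.log (max (n : ℝ) 2) ^ b with hL
  have hL0 : 0 < L :=
    Real.rpow_pos_of_pos (hl2.trans_le (Real.log_le_log two_pos (le_max_right _ _))) _
  set m : (Fin d → ℤ) → ℕ := fun k => ⌊(n : ℝ) * w k⌋₊ with hm
  have hnw : ∀ k, 0 < (n : ℝ) * w k := fun k => mul_pos hn0 (hw0 k)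
  -- A tile receives rank only if `w_k ≥ 1/n`, which happens finitely often because the weights are
  -- summable.
  have hfin : {k | 1 ≤ m k}.Finite := by
    refine (ENNReal.finite_const_le_of_tsum_ne_top (ne_top_of_le_ne_top ENNReal.one_ne_top hwsum)
      (ε := ENNReal.ofReal (1 / n)) (ENNReal.ofReal_pos.2 (by positivity)).ne').subset fun k hk => ?_
    have h1 : (1 : ℝ) ≤ n * w k := by
      simpa using (Nat.le_floor_iff (hnw k).le).1 hk
    exact ENNReal.ofReal_le_ofReal ((div_le_iff₀' hn0).2 h1)
  set F : Finset (Fin d → ℤ) := hfin.toFinset with hF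
  have hmF : ∀ k, k ∈ F ↔ 1 ≤ m k := fun k => by simp [hF]
  set A' : (Fin d → ℤ) → MixedSobolev.PerLp 𝕜 d q →ₗ[𝕜] MixedSobolev.PerLp 𝕜 d q :=
    fun k => if k ∈ F then A (m k) else 0 with hA'
  have hA'0 : ∀ k, k ∉ F → A' k = 0 := fun k hk => by simp only [hA', if_neg hk]
  have hA'F : ∀ k, k ∈ F → A' k = A (m k) := fun k hk => by simp only [hA', if_pos hk]
  -- One rate for all tiles: by assumption where an operator is present, and by the trivial bound
  -- where `n w_k < 1`.
  have happrox : ∀ k (g : MixedSobolev.PerLp 𝕜 d q), MixedSobolev.MemPer s p g →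
      ENNReal.ofReal ‖g - A' k g‖ ≤
        ENNReal.ofReal (C1 * (n * w k) ^ (-a) * L) * MixedSobolev.normPer s p g := by
    intro k g hg
    by_cases hk : k ∈ F
    · rw [hA'F k hk]
      refine ((hA (m k) ((hmF k).1 hk)).2 g hg).trans (mul_le_mul' ?_ le_rfl)
      exact ENNReal.ofReal_le_ofReal (MixedSobolev.rate_le hC ha hb (hnw k)
        (mul_le_of_le_one_right hn0.le (hw1 k)) ((hmF k).1 hk))
    · rw [hA'0 k hk, LinearMap.zero_apply, sub_zero]
      refine (MixedSobolev.ofReal_norm_le_normPer s hq hqp.le g).trans (le_mul_of_one_le_left' ?_)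
      rw [← ENNReal.ofReal_one]
      refine ENNReal.ofReal_le_ofReal (MixedSobolev.one_le_rate hC ha hb (hnw k) ?_)
      rw [hmF, not_le, Nat.lt_one_iff] at hk
      exact Nat.floor_eq_zero.1 hk
  refine ⟨∑ k ∈ F, S k ∘ₗ A' k ∘ₗ T k, ?_, fun f hf => ?_, fun hbd => ?_⟩
  -- The rank budget: `∑ ⌊n w_k⌋ ≤ n ∑ w_k ≤ n`.
  · have h1 : ∑ k ∈ F, m k ≤ n := by
      have h2 : ((∑ k ∈ F, m k : ℕ) : ℝ≥0∞) ≤ n := by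
        calc ((∑ k ∈ F, m k : ℕ) : ℝ≥0∞) = ∑ k ∈ F, (m k : ℝ≥0∞) := by push_cast; rfl
          _ ≤ ∑ k ∈ F, (n : ℝ≥0∞) * ENNReal.ofReal (w k) := by
              refine Finset.sum_le_sum fun k _ => ?_
              rw [← ENNReal.ofReal_natCast n, ← ENNReal.ofReal_natCast (m k),
                ← ENNReal.ofReal_mul hn0.le]
              exact ENNReal.ofReal_le_ofReal (Nat.floor_le (hnw k).le)
          _ ≤ n * 1 := by
              rw [← Finset.mul_sum]
              exact mul_le_mul' le_rfl ((ENNReal.sum_le_tsum F).trans hwsum)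
          _ = n := mul_one _
      exact_mod_cast h2
    calc _ ≤ ∑ k ∈ F, LinearMap.rank (S k ∘ₗ A' k ∘ₗ T k) := LinearMap.rank_finsetSum_le _ _
      _ ≤ ∑ k ∈ F, (m k : Cardinal) := by
          refine Finset.sum_le_sum fun k hk => ?_
          refine (LinearMap.rank_comp_le_right _ _).trans
            ((LinearMap.rank_comp_le_left _ _).trans ?_)
          rw [hA'F k hk]
          exact (hA (m k) ((hmF k).1 hk)).1
      _ = ((∑ k ∈ F, m k : ℕ) : Cardinal) := by push_cast; rfl
      _ ≤ _ := by exact_mod_cast h1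
  · set N := MixedSobolev.normGauss s p f with hN
    -- With an infinite norm the right-hand side is `⊤`, because the constant in front is positive.
    by_cases hNt : N = ⊤
    · rw [hNt, ENNReal.mul_top]
      · exact le_top
      · exact (ENNReal.ofReal_pos.2 (by positivity)).ne'
    set P : ℝ≥0∞ := ENNReal.ofReal (C1 * (n : ℝ) ^ (-a) * L) * K * N with hP
    have hk : ∀ k, ENNReal.ofReal ‖T k f - A' k (T k f)‖ ≤ P * u k := by
      intro k
      obtain ⟨h1, h2⟩ := hloc f hf hNt (MixedSobolev.centre k) (T k f) (hT k f)
      refine (happrox k _ h1).trans ((mul_le_mul' le_rfl h2).trans (le_of_eq ?_))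
      have e : C1 * (n * w k) ^ (-a) * L = C1 * (n : ℝ) ^ (-a) * L * w k ^ (-a) := by
        rw [Real.mul_rpow hn0.le (hw0 k).le]
        ring
      rw [e, ENNReal.ofReal_mul (by positivity), hP, hu]
      ring
    -- The factor `P` is common to all tiles, so the `q`-th powers sum to `P^q` times the series
    -- `V`.
    have hq' : ENNReal.ofReal ‖f - (∑ k ∈ F, S k ∘ₗ A' k ∘ₗ T k) f‖ ^ q ≤ P ^ q * V := by
      refine (MixedSobolev.ofReal_norm_sub_rpow_le_tsum hψ hq hT hS hA'0 f).trans ?_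
      rw [hV, ← ENNReal.tsum_mul_left]
      refine ENNReal.tsum_le_tsum fun k => ?_
      rw [mul_left_comm, ← ENNReal.mul_rpow_of_nonneg _ _ hq0.le]
      exact mul_le_mul' le_rfl (ENNReal.rpow_le_rpow (hk k) hq0.le)
    have h1 : ENNReal.ofReal ‖f - (∑ k ∈ F, S k ∘ₗ A' k ∘ₗ T k) f‖ ≤ P * V ^ (1 / q) := by
      rw [← ENNReal.rpow_le_rpow_iff hq0, ENNReal.mul_rpow_of_nonneg _ _ hq0.le,
        ← ENNReal.rpow_mul V, one_div_mul_cancel hq0.ne', ENNReal.rpow_one]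
      exact hq'
    refine h1.trans ?_
    have h2 : Y ≤ ENNReal.ofReal (Y.toReal + 1) := by
      rw [← ENNReal.ofReal_toReal hYt, ENNReal.toReal_ofReal ENNReal.toReal_nonneg]
      exact ENNReal.ofReal_le_ofReal (by linarith)
    have h3 : C1 * (Y.toReal + 1) * (n : ℝ) ^ (-a) * L =
        C1 * (n : ℝ) ^ (-a) * L * (Y.toReal + 1) := by ring
    rw [h3, ENNReal.ofReal_mul (by positivity)]
    calc P * V ^ (1 / q) = ENNReal.ofReal (C1 * (n : ℝ) ^ (-a) * L) * Y * N := by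
          rw [hP, hY]; ring
      _ ≤ _ := mul_le_mul' (mul_le_mul' le_rfl h2) le_rfl
  · refine MixedSobolev.exists_bound_sum_comp F hq hTb (fun k hk => ?_) hSb
    rw [hA'F k hk]
    exact hbd (m k) ((hmF k).1 hk)
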